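/- Let $M$ be a connected smooth $n$-manifold without boundary, and let $(M,g(t))$, $t\in[t_0,t_1)$, be a smooth Ricci flow $\partial_t g=-2\,\mathrm{Ric}$ with every $g(t)$ complete. Write $\tau=t_1-t$. Fix $x_1\in M$ and let $K=(4\pi\tau)^{-n/2}e^{-f}$ be a conjugate heat kernel centered at $(x_1,t_1)$: a positive smooth solution of $\partial_t K=-\Delta K+RK$ on $M\times[t_0,t_1)$ ($R$ is the scalar curvature) such that $K\,dV_{g(t)}$ tends to the Dirac mass at $x_1$ as $t\nearrow t_1$. Put $d\nu_t=K(\cdot,t)\,dV_{g(t)}$. Let $[a,b]\subset[t_0,t_1)$ with $a<b$. Assume that the Ricci curvature is bounded on $M\times[a,b]$ and that $$\mathrm{Ric}+\mathrm{Hess}_f\le\frac{\kappa(t)}{2\tau}\,g\qquad\text{on } M\times[a,b]$$ for some integrable function $\kappa:[a,b]\to\mathbb{R}$. Let $u:M\times[a,b]\to\mathbb{R}$ be a smooth solution of the heat equation $\partial_t u=\Delta_{g(t)}u$ along the flow such that $u(\cdot,t)$ and $\partial_t u(\cdot,t)$ lie in $W^{2,2}(d\nu_t)$ for every $t\in[a,b]$,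 with norms bounded uniformly in $t$; here $\|v\|_{W^{2,2}(d\nu_t)}^2=\int_M\big(v^2+|\nabla v|^2+|\mathrm{Hess}_v|^2\big)\,d\nu_t$. If $u(\cdot,b)=0$, then $u\equiv0$ on $M\times[a,b]$. -/

import Mathlib

open Set Filter Topology MeasureTheory Manifold
open scoped Bundle ContDiff ENNReal NNReal

namespace RicciHeat

noncomputable section

/-- The model space `ℝⁿ`. -/
abbrev Model (n : ℕ) : Type := EuclideanSpace ℝ (Fin n)

/-- Smooth Riemannian metrics on an `n`-dimensional manifold without boundary. -/
abbrev Metric (n : ℕ) (M : Type*) [TopologicalSpace M] [ChartedSpace (Model n) M]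
    [IsManifold (𝓡 n) ∞ M] : Type _ :=
  Bundle.ContMDiffRiemannianMetric (𝓡 n) ∞ (Model n) (fun x : M => TangentSpace (𝓡 n) x)

/-- The partial derivative `∂F/∂yⁱ` of a function on (an open subset of) `ℝⁿ`. -/
def pd {n : ℕ} (i : Fin n) (F : Model n → ℝ) (y : Model n) : ℝ :=
  fderiv ℝ F y (EuclideanSpace.single i (1 : ℝ))

/-! ### Local expressions in the chart around `c`, at a point `y` of the target of that chart -/

section Coordinates

variable {n : ℕ} {M : Type*} [TopologicalSpace M] [ChartedSpace (Model n) M]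

/-- The coordinate vector field `∂ᵢ`, at the point of `M` with coordinates `y`. -/
def coordVec (c : M) (y : Model n) (i : Fin n) :
    TangentSpace (𝓡 n) ((extChartAt (𝓡 n) c).symm y) :=
  mfderiv 𝓘(ℝ, Model n) (𝓡 n) (extChartAt (𝓡 n) c).symm y
    (EuclideanSpace.single i (1 : ℝ) : Model n)

/-- The `i`-th component of a tangent vector at `x`, in the chart around `x`. -/
def vcomp (x : M) (v : TangentSpace (𝓡 n) x) (i : Fin n) : ℝ :=
  let w : Model n := mfderiv (𝓡 n) 𝓘(ℝ, Model n) (extChartAt (𝓡 n) x) x v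
  w i

/-- The expression of a function in coordinates. -/
def localRep (u : M → ℝ) (c : M) (y : Model n) : ℝ := u ((extChartAt (𝓡 n) c).symm y)

variable [IsManifold (𝓡 n) ∞ M]

/-- The matrix `g_ij` of the metric in coordinates. -/
def gMat (g : Metric n M) (c : M) (y : Model n) : Matrix (Fin n) (Fin n) ℝ :=
  Matrix.of fun i j =>
    g.inner ((extChartAt (𝓡 n) c).symm y) (coordVec c y i) (coordVec c y j)

/-- The inverse matrix `g^ij`. -/
def gInv (g : Metric n M) (c : M) (y : Model n) : Matrix (Fin n) (Fin n) ℝ := (gMat g c y)⁻¹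

/-- The Christoffel symbol `Γ^k_ij` of the Levi-Civita connection. -/
def christoffel (g : Metric n M) (c : M) (k i j : Fin n) (y : Model n) : ℝ :=
  (1 / 2) * ∑ l, gInv g c y k l *
    (pd i (fun z => gMat g c z j l) y + pd j (fun z => gMat g c z i l) y
      - pd l (fun z => gMat g c z i j) y)

/-- The components `R_ij = ∂ₖΓ^k_ij - ∂ⱼΓ^k_ik + Γ^k_kl Γ^l_ij - Γ^k_jl Γ^l_ik` of the Ricci
tensor. -/
def ricciMat (g : Metric n M) (c : M) (y : Model n) (i j : Fin n) : ℝ :=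
  ∑ k, (pd k (christoffel g c k i j) y - pd j (christoffel g c k i k) y
    + ∑ l, (christoffel g c k k l y * christoffel g c l i j y
      - christoffel g c k j l y * christoffel g c l i k y))

/-- The components `∂ᵢ∂ⱼu - Γ^k_ij ∂ₖu` of the Hessian `∇²u`. -/
def hessMat (g : Metric n M) (u : M → ℝ) (c : M) (y : Model n) (i j : Fin n) : ℝ :=
  pd i (pd j (localRep u c)) y - ∑ k, christoffel g c k i j y * pd k (localRep u c) y

end Coordinates

/-! ### Geometric quantities, evaluated at `x` in the chart around `x` -/

section Geometry

variable {n : ℕ} {M : Type*} [TopologicalSpace M] [ChartedSpace (Model n) M]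
  [IsManifold (𝓡 n) ∞ M]

/-- The Ricci curvature `Ric(v, w)`. -/
def ricci (g : Metric n M) (x : M) (v w : TangentSpace (𝓡 n) x) : ℝ :=
  ∑ i, ∑ j, ricciMat g x (extChartAt (𝓡 n) x x) i j * vcomp x v i * vcomp x w j

/-- The scalar curvature `R = g^ij R_ij`. -/
def scalar (g : Metric n M) (x : M) : ℝ :=
  ∑ i, ∑ j, gInv g x (extChartAt (𝓡 n) x x) i j * ricciMat g x (extChartAt (𝓡 n) x x) i j

/-- The Hessian `∇²u(v, w)`. -/
def hess (g : Metric n M) (u : M → ℝ) (x : M) (v w : TangentSpace (𝓡 n) x) : ℝ :=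
  ∑ i, ∑ j, hessMat g u x (extChartAt (𝓡 n) x x) i j * vcomp x v i * vcomp x w j

/-- The Laplace-Beltrami operator `Δu = g^ij ∇²_ij u`. -/
def laplacian (g : Metric n M) (u : M → ℝ) (x : M) : ℝ :=
  ∑ i, ∑ j, gInv g x (extChartAt (𝓡 n) x x) i j * hessMat g u x (extChartAt (𝓡 n) x x) i j

/-- `|∇u|² = g^ij ∂ᵢu ∂ⱼu`. -/
def gradSq (g : Metric n M) (u : M → ℝ) (x : M) : ℝ :=
  ∑ i, ∑ j, gInv g x (extChartAt (𝓡 n) x x) i j *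
    pd i (localRep u x) (extChartAt (𝓡 n) x x) * pd j (localRep u x) (extChartAt (𝓡 n) x x)

/-- `|∇²u|² = g^ik g^jl ∇²_ij u ∇²_kl u`. -/
def hessSq (g : Metric n M) (u : M → ℝ) (x : M) : ℝ :=
  ∑ i, ∑ j, ∑ k, ∑ l,
    gInv g x (extChartAt (𝓡 n) x x) i k * gInv g x (extChartAt (𝓡 n) x x) j l *
      hessMat g u x (extChartAt (𝓡 n) x x) i j * hessMat g u x (extChartAt (𝓡 n) x x) k l

/-- The Riemannian distance of `g` (the infimum of the lengths of `C¹` paths). -/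
def rdist (g : Metric n M) (x y : M) : ℝ≥0∞ :=
  letI : Bundle.RiemannianBundle (fun x : M => TangentSpace (𝓡 n) x) := ⟨g.toRiemannianMetric⟩
  Manifold.riemannianEDist (𝓡 n) x y

/-- `g` is complete: every Cauchy sequence of the Riemannian distance converges. -/
def IsCompleteMetric (g : Metric n M) : Prop :=
  ∀ s : ℕ → M,
    (∀ ε : ℝ≥0∞, 0 < ε → ∃ N, ∀ i ≥ N, ∀ j ≥ N, rdist g (s i) (s j) < ε) →
    ∃ x, Tendsto (fun i => rdist g (s i) x) atTop (𝓝 0)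

/-- The Riemannian volume `√(det g_ij) dy` of the chart around `c`, as a measure on `M`
concentrated on the domain of that chart. -/
def chartVolume [MeasurableSpace M] (g : Metric n M) (c : M) : Measure M :=
  Measure.map (extChartAt (𝓡 n) c).symm
    ((volume.restrict (extChartAt (𝓡 n) c).target).withDensity
      fun y => ENNReal.ofReal (Real.sqrt (gMat g c y).det))

/-- The Riemannian volume measure `dV`. The measures `chartVolume g c` agree on the overlaps of the
charts, so that their supremum is the measure that restricts to `chartVolume g c` on the domain
of each chart. -/
def vol [MeasurableSpace M] (g : Metric n M) : Measure M := ⨆ c : M, chartVolume g c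

/-- The square `∫ (|u|² + |∇u|² + |∇²u|²) dν` of the `W^{2,2}(dν)` norm of a (smooth) function. -/
def sobolevSq [MeasurableSpace M] (g : Metric n M) (ν : Measure M) (u : M → ℝ) : ℝ≥0∞ :=
  ∫⁻ x, ENNReal.ofReal (u x ^ 2 + gradSq g u x + hessSq g u x) ∂ν

/-- `(g t)` is a smooth Ricci flow `∂ₜg = -2 Ric` for `t ∈ [t₀, t₁)`, by complete metrics. -/
structure IsRicciFlow (g : ℝ → Metric n M) (t₀ t₁ : ℝ) : Prop where
  smooth : ∀ (c : M) (i j : Fin n),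
    ContDiffOn ℝ ∞ (fun p : ℝ × Model n => gMat (g p.1) c p.2 i j)
      (Ico t₀ t₁ ×ˢ (extChartAt (𝓡 n) c).target)
  complete : ∀ t ∈ Ico t₀ t₁, IsCompleteMetric (g t)
  flow : ∀ t ∈ Ico t₀ t₁, ∀ (x : M) (v w : TangentSpace (𝓡 n) x),
    HasDerivWithinAt (fun s => (g s).inner x v w) (-2 * ricci (g t) x v w) (Ico t₀ t₁) t

/-- The function `K = (4πτ)^{-n/2} e^{-f}`, where `τ = t₁ - t`. -/
def kernel (n : ℕ) (f : ℝ → M → ℝ) (t₁ t : ℝ) (x : M) : ℝ :=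
  (4 * Real.pi * (t₁ - t)) ^ (-(n : ℝ) / 2) * Real.exp (-f t x)

/-- `K = (4πτ)^{-n/2} e^{-f}` is a smooth (positive) solution of the conjugate heat equation
`∂ₜK = -ΔK + RK` on `[t₀, t₁)`, and it tends to the Dirac mass at `x₁` as `t ↗ t₁`. -/
structure IsConjugateHeatKernel [MeasurableSpace M] (g : ℝ → Metric n M) (f : ℝ → M → ℝ)
    (t₀ t₁ : ℝ) (x₁ : M) : Prop where
  smooth : ContMDiffOn (𝓘(ℝ, ℝ).prod (𝓡 n)) 𝓘(ℝ, ℝ) ∞ (fun p : ℝ × M => f p.1 p.2)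
    (Ico t₀ t₁ ×ˢ univ)
  conjugate_heat : ∀ t ∈ Ico t₀ t₁, ∀ x : M,
    HasDerivWithinAt (fun s => kernel n f t₁ s x)
      (-laplacian (g t) (kernel n f t₁ t) x + scalar (g t) x * kernel n f t₁ t x)
      (Ico t₀ t₁) t
  dirac : ∀ φ : M → ℝ, Continuous φ → HasCompactSupport φ →
    Tendsto (fun t => ∫ x, φ x * kernel n f t₁ t x ∂(vol (g t))) (𝓝[<] t₁) (𝓝 (φ x₁))

/-- The conjugate heat kernel measure `dν = K dV` at time `t`. -/
def nu [MeasurableSpace M] (g : ℝ → Metric n M) (f : ℝ → M → ℝ) (t₁ t : ℝ) : Measure M :=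
  (vol (g t)).withDensity fun x => ENNReal.ofReal (kernel n f t₁ t x)

/-- `u` is a smooth solution of the heat equation `∂ₜu = Δu` on `M × [a, b]`. -/
structure IsHeatSolution (g : ℝ → Metric n M) (u : ℝ → M → ℝ) (a b : ℝ) : Prop where
  smooth : ContMDiffOn (𝓘(ℝ, ℝ).prod (𝓡 n)) 𝓘(ℝ, ℝ) ∞ (fun p : ℝ × M => u p.1 p.2)
    (Icc a b ×ˢ univ)
  heat : ∀ t ∈ Icc a b, ∀ x : M,
    HasDerivWithinAt (fun s => u s x) (laplacian (g t) (u t) x) (Icc a b) t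

end Geometry

end

end RicciHeat

open RicciHeat

/-!
# Backward uniqueness for the heat equation along a Ricci flow

The proof follows the parabolic frequency of Poon, for the conjugate heat kernel measure `dν`. Write
`I = ∫ u² dν`, `E = ∫ |∇u|² dν`, `H = ∫ |∇²u|² dν`, `Lu = Δu - ⟨∇f, ∇u⟩` and `Q = ∫ (Lu)² dν`.
Since `∂ₜ - Δ` is adjoint to the conjugate heat operator,

* `I' = -2E`, from `(∂ₜ - Δ) u² = -2 |∇u|²`;
* `E' = -2H`, from `(∂ₜ - Δ) |∇u|² = -2 |∇²u|²`, where the Ricci term of Bochner's formula cancels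
  against the derivative of the metric (`IsFlowOn.deriv_gradSq`).

At a fixed time, the integrated Bochner formula for `L` and the bound `Ric + ∇²f ≤ κ / (2τ) g` give
`Q ≤ H + κ / (2τ) E`, and the Cauchy–Schwarz inequality gives `E² = (∫ u Lu dν)² ≤ I Q`
(`weighted_bochner`). Hence the frequency `N = E / I` satisfies `N' ≤ (κ / τ) N` as long as `I > 0`,
so that it is bounded, and `I' = -2NI` then prevents `I` from reaching `0` in finite time
(`frequency_le`, `energy_eq_zero`). As `I(b) = 0`, the function `u` vanishes. The derivatives in
time exist almost everywhere only, and `I` and `E` are treated as absolutely continuous functions.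

The integrations by parts on the noncompact manifold need justification
(`IsConjugateFlow.integral_evolution`). Cutoff functions `ηₖ` with gradients that are bounded
uniformly in `k` and `t` come from the Riemannian distance of the initial metric: its balls are
compact by the Hopf–Rinow theorem (`isCompact_closedEBall_of_length`), it can be smoothed
(`exists_smooth_of_lipschitz`), and the bound of the Ricci curvature makes the metrics `g(t)`
equivalent (`IsRicciFlow.exists_isCutoff`). The boundary terms involve `∫ v |∇ηₖ| |∇f| dν` with
`v = u²` or `v = |∇u|²`, and there is no a priori bound of `|∇f|`. But `Δf` is bounded from above,
and an integration by parts of `∫ v Δf dν` bounds `∫ v |∇f|² dν` by the Sobolev norms of `u`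
(`integrable_mul_gradSq`).

The definitions of the geometric quantities use the chart around the given point. The volume
densities of different charts agree by the change of variables formula, the inner product
of gradients is invariant by the chain rule, and the Laplacian is invariant because Green's formula
determines it (`lapC_eq`).
-/

namespace RicciHeat

noncomputable section

/-! ### Partial derivatives -/

section PartialDerivatives

variable {n : ℕ} {i j k : Fin n} {F G : Model n → ℝ} {y : Model n} {U : Set (Model n)}

lemma pd_congr (h : F =ᶠ[𝓝 y] G) : pd i F y = pd i G y := by
  simp only [pd, h.fderiv_eq]

lemma pd_congr_of_eqOn (hU : IsOpen U) (hy : y ∈ U) (h : ∀ z ∈ U, F z = G z) :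
    pd i F y = pd i G y :=
  pd_congr (eventually_of_mem (hU.mem_nhds hy) h)

lemma pd_const (c : ℝ) : pd i (fun _ : Model n => c) y = 0 := by simp [pd]

lemma pd_add (hF : DifferentiableAt ℝ F y) (hG : DifferentiableAt ℝ G y) :
    pd i (fun z => F z + G z) y = pd i F y + pd i G y := by
  simp only [pd]; rw [fderiv_fun_add hF hG]; rfl

lemma pd_sub (hF : DifferentiableAt ℝ F y) (hG : DifferentiableAt ℝ G y) :
    pd i (fun z => F z - G z) y = pd i F y - pd i G y := by
  simp only [pd]; rw [fderiv_fun_sub hF hG]; rfl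

lemma pd_mul (hF : DifferentiableAt ℝ F y) (hG : DifferentiableAt ℝ G y) :
    pd i (fun z => F z * G z) y = pd i F y * G y + F y * pd i G y := by
  simp only [pd]; rw [fderiv_fun_mul hF hG]; simp; ring

lemma pd_const_mul (c : ℝ) (hF : DifferentiableAt ℝ F y) :
    pd i (fun z => c * F z) y = c * pd i F y := by
  simp only [pd]; rw [fderiv_const_mul hF]; rfl

lemma pd_sum {ι : Type*} {s : Finset ι} {H : ι → Model n → ℝ}
    (h : ∀ a ∈ s, DifferentiableAt ℝ (H a) y) :
    pd i (fun z => ∑ a ∈ s, H a z) y = ∑ a ∈ s, pd i (H a) y := by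
  simp only [pd]; rw [fderiv_fun_sum h]; simp

lemma pd_sum_mul {ι : Type*} [Fintype ι] {H K : ι → Model n → ℝ}
    (hH : ∀ a, DifferentiableAt ℝ (H a) y) (hK : ∀ a, DifferentiableAt ℝ (K a) y) :
    pd i (fun z => ∑ a, H a z * K a z) y = ∑ a, (pd i (H a) y * K a y + H a y * pd i (K a) y) := by
  rw [pd_sum (H := fun a z => H a z * K a z) fun a _ => (hH a).mul (hK a)]
  exact Finset.sum_congr rfl fun a _ => pd_mul (hH a) (hK a)

lemma pd_comp {φ : ℝ → ℝ} {φ' : ℝ} (hφ : HasDerivAt φ φ' (F y)) (hF : DifferentiableAt ℝ F y) :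
    pd i (fun z => φ (F z)) y = φ' * pd i F y := by
  simp only [pd]
  have := (hφ.comp_hasFDerivAt y hF.hasFDerivAt).fderiv
  simp only [Function.comp_def] at this
  rw [this]; simp

lemma contDiffOn_pd (hU : IsOpen U) (hF : ContDiffOn ℝ ∞ F U) : ContDiffOn ℝ ∞ (pd i F) U := by
  have := hF.fderiv_of_isOpen (m := ∞) hU (by simp)
  exact this.clm_apply contDiffOn_const

lemma two_le_infty : (2 : WithTop ℕ∞) ≤ ((⊤ : ℕ∞) : WithTop ℕ∞) :=
  WithTop.coe_le_coe.2 (le_top : (2 : ℕ∞) ≤ ⊤)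

lemma pd_comm (hU : IsOpen U) (hF : ContDiffOn ℝ ∞ F U) (hy : y ∈ U) :
    pd i (pd j F) y = pd j (pd i F) y := by
  have h1 : ContDiffAt ℝ ∞ F y := hF.contDiffAt (hU.mem_nhds hy)
  have h2 : DifferentiableAt ℝ (fderiv ℝ F) y :=
    (h1.fderiv_right (m := 1) (by rw [one_add_one_eq_two]; exact two_le_infty)).differentiableAt (by simp)
  have h3 : IsSymmSndFDerivAt ℝ F y := h1.isSymmSndFDerivAt (by simpa using two_le_infty)
  have key : ∀ v w : Model n, fderiv ℝ (fun z => fderiv ℝ F z v) y w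
      = fderiv ℝ (fderiv ℝ F) y w v := by
    intro v w
    rw [fderiv_clm_apply h2 (differentiableAt_const v)]
    simp
  change fderiv ℝ (fun z => fderiv ℝ F z _) y _ = fderiv ℝ (fun z => fderiv ℝ F z _) y _
  rw [key, key]
  exact h3 _ _

end PartialDerivatives

lemma _root_.ContDiffOn.diffAt {E : Type*} [NormedAddCommGroup E] [NormedSpace ℝ E] {F : E → ℝ}
    {U : Set E} {y : E} (hF : ContDiffOn ℝ ∞ F U) (hU : IsOpen U) (hy : y ∈ U) :
    DifferentiableAt ℝ F y :=
  (hF.contDiffAt (hU.mem_nhds hy)).differentiableAt (by simp)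

/-! ### Derivatives of determinants and of inverse matrices -/

section MatrixCalculus

variable {n : ℕ}

/-- Jacobi's formula. -/
lemma hasFDerivAt_det {E : Type*} [NormedAddCommGroup E] [NormedSpace ℝ E]
    {A : E → Matrix (Fin n) (Fin n) ℝ} {A' : Fin n → Fin n → E →L[ℝ] ℝ} {y : E}
    (hA : ∀ i j, HasFDerivAt (fun z => A z i j) (A' i j) y) :
    HasFDerivAt (fun z => (A z).det) (∑ i, ∑ j, (A y).adjugate i j • A' j i) y := by
  have h1 : ∀ z, (A z).det = ∑ σ : Equiv.Perm (Fin n), (Equiv.Perm.sign σ : ℝ) *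
      ∏ i, A z (σ i) i := fun z => Matrix.det_apply' _
  have h2 : HasFDerivAt (fun z => (A z).det) (∑ σ : Equiv.Perm (Fin n), (Equiv.Perm.sign σ : ℝ) •
      ∑ i, (∏ j ∈ Finset.univ.erase i, A y (σ j) j) • A' (σ i) i) y := by
    simp only [h1]
    refine HasFDerivAt.fun_sum fun σ _ => ?_
    refine HasFDerivAt.const_mul ?_ _
    exact HasFDerivAt.finsetProd fun i _ => hA (σ i) i
  convert h2 using 1
  ext v
  simp only [_root_.sum_apply, _root_.smul_apply, smul_eq_mul,
    Finset.mul_sum]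
  rw [Finset.sum_comm (s := (Finset.univ : Finset (Equiv.Perm (Fin n))))]
  refine Finset.sum_congr rfl fun i _ => ?_
  have h3 : ∑ j, (A y).adjugate i j * A' j i v
      = ((A y).updateCol i fun j => A' j i v).det := by
    rw [← Matrix.cramer_apply, Matrix.cramer_eq_adjugate_mulVec]; rfl
  rw [h3, Matrix.det_apply']
  refine Finset.sum_congr rfl fun σ _ => ?_
  rw [← Finset.mul_prod_erase _ _ (Finset.mem_univ i)]
  have h4 : ∏ j ∈ Finset.univ.erase i, ((A y).updateCol i fun j => A' j i v) (σ j) j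
      = ∏ j ∈ Finset.univ.erase i, A y (σ j) j := by
    refine Finset.prod_congr rfl fun j hj => ?_
    rw [Matrix.updateCol_ne (Finset.ne_of_mem_erase hj)]
  rw [h4, Matrix.updateCol_self]; ring

lemma contDiffOn_det {E : Type*} [NormedAddCommGroup E] [NormedSpace ℝ E]
    {A : E → Matrix (Fin n) (Fin n) ℝ} {U : Set E}
    (hA : ∀ i j, ContDiffOn ℝ ∞ (fun z => A z i j) U) :
    ContDiffOn ℝ ∞ (fun z => (A z).det) U := by
  simp only [Matrix.det_apply']
  exact ContDiffOn.sum fun σ _ => contDiffOn_const.mul (contDiffOn_prod fun i _ => hA _ _)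

lemma contDiffOn_inv {E : Type*} [NormedAddCommGroup E] [NormedSpace ℝ E]
    {A : E → Matrix (Fin n) (Fin n) ℝ} {U : Set E}
    (hA : ∀ i j, ContDiffOn ℝ ∞ (fun z => A z i j) U) (hdet : ∀ z ∈ U, (A z).det ≠ 0)
    (i j : Fin n) : ContDiffOn ℝ ∞ (fun z => (A z)⁻¹ i j) U := by
  have : ∀ z, (A z)⁻¹ i j = (A z).det⁻¹ * ((A z).updateRow j (Pi.single i 1)).det := by
    intro z
    rw [Matrix.inv_def, Matrix.smul_apply, Matrix.adjugate_apply, Ring.inverse_eq_inv']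
    rfl
  simp only [this]
  refine ((contDiffOn_det hA).inv hdet).mul (contDiffOn_det fun k l => ?_)
  by_cases h : k = j
  · subst h; simp only [Matrix.updateRow_self]; exact contDiffOn_const
  · simp only [Matrix.updateRow_ne h]; exact hA _ _

end MatrixCalculus


/-! ### Riemannian geometry of an open subset of `ℝⁿ` -/

section Euclidean

variable {n : ℕ}

/-- `G` is a smooth Riemannian metric, as a matrix-valued function, on the open set `U`. -/
structure IsMetricOn (G : Model n → Matrix (Fin n) (Fin n) ℝ) (U : Set (Model n)) : Prop where
  isOpen : IsOpen U
  smooth : ∀ i j, ContDiffOn ℝ ∞ (fun y => G y i j) U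
  posDef : ∀ y ∈ U, (G y).PosDef

/-- The Christoffel symbol `Γ^k_ij` of a matrix-valued function. -/
def chr (G : Model n → Matrix (Fin n) (Fin n) ℝ) (k i j : Fin n) (y : Model n) : ℝ :=
  (1 / 2) * ∑ l, (G y)⁻¹ k l *
    (pd i (fun z => G z j l) y + pd j (fun z => G z i l) y - pd l (fun z => G z i j) y)

/-- The Ricci tensor in coordinates. -/
def ricE (G : Model n → Matrix (Fin n) (Fin n) ℝ) (y : Model n) (i j : Fin n) : ℝ :=
  ∑ k, (pd k (chr G k i j) y - pd j (chr G k i k) y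
    + ∑ l, (chr G k k l y * chr G l i j y - chr G k j l y * chr G l i k y))

/-- The Hessian in coordinates. -/
def hessE (G : Model n → Matrix (Fin n) (Fin n) ℝ) (u : Model n → ℝ) (y : Model n)
    (i j : Fin n) : ℝ :=
  pd i (pd j u) y - ∑ k, chr G k i j y * pd k u y

/-- The Laplacian in coordinates. -/
def lapE (G : Model n → Matrix (Fin n) (Fin n) ℝ) (u : Model n → ℝ) (y : Model n) : ℝ :=
  ∑ i, ∑ j, (G y)⁻¹ i j * hessE G u y i j

/-- The inner product of the gradients of two functions, in coordinates. -/
def innE (G : Model n → Matrix (Fin n) (Fin n) ℝ) (u v : Model n → ℝ) (y : Model n) : ℝ :=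
  ∑ i, ∑ j, (G y)⁻¹ i j * pd i u y * pd j v y

/-- The squared norm of the Hessian, in coordinates. -/
def hsqE (G : Model n → Matrix (Fin n) (Fin n) ℝ) (u : Model n → ℝ) (y : Model n) : ℝ :=
  ∑ i, ∑ j, ∑ k, ∑ l, (G y)⁻¹ i k * (G y)⁻¹ j l * hessE G u y i j * hessE G u y k l

/-- The components of the gradient of a function. -/
def gradV (G : Model n → Matrix (Fin n) (Fin n) ℝ) (u : Model n → ℝ) (i : Fin n)
    (y : Model n) : ℝ :=
  ∑ j, (G y)⁻¹ i j * pd j u y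

/-- The components `∇ₖXⁱ` of the covariant derivative of the gradient `X` of a function. -/
def covA (G : Model n → Matrix (Fin n) (Fin n) ℝ) (u : Model n → ℝ) (k i : Fin n)
    (y : Model n) : ℝ :=
  pd k (gradV G u i) y + ∑ l, chr G i k l y * gradV G u l y

variable {G : Model n → Matrix (Fin n) (Fin n) ℝ} {U : Set (Model n)} {u v : Model n → ℝ}
  {y : Model n}

namespace IsMetricOn

lemma symm (h : IsMetricOn G U) (hy : y ∈ U) (i j : Fin n) : G y i j = G y j i := by
  simpa using (h.posDef y hy).isHermitian.apply j i

lemma det_pos (h : IsMetricOn G U) (hy : y ∈ U) : 0 < (G y).det := (h.posDef y hy).det_pos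

lemma inv_symm (h : IsMetricOn G U) (hy : y ∈ U) (i j : Fin n) : (G y)⁻¹ i j = (G y)⁻¹ j i := by
  simpa using (h.posDef y hy).inv.isHermitian.apply j i

lemma inv_mul (h : IsMetricOn G U) (hy : y ∈ U) : (G y)⁻¹ * G y = 1 :=
  Matrix.nonsing_inv_mul _ (h.det_pos hy).ne'.isUnit

lemma mul_inv (h : IsMetricOn G U) (hy : y ∈ U) : G y * (G y)⁻¹ = 1 :=
  Matrix.mul_nonsing_inv _ (h.det_pos hy).ne'.isUnit

lemma smooth_inv (h : IsMetricOn G U) (i j : Fin n) :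
    ContDiffOn ℝ ∞ (fun y => (G y)⁻¹ i j) U :=
  contDiffOn_inv h.smooth (fun _ hz => (h.det_pos hz).ne') i j

lemma smooth_chr (h : IsMetricOn G U) (k i j : Fin n) : ContDiffOn ℝ ∞ (chr G k i j) U :=
  contDiffOn_const.mul (ContDiffOn.sum fun l _ => (h.smooth_inv k l).mul
    (((contDiffOn_pd h.isOpen (h.smooth j l)).add (contDiffOn_pd h.isOpen (h.smooth i l))).sub
      (contDiffOn_pd h.isOpen (h.smooth i j))))

lemma smooth_gradV (h : IsMetricOn G U) (hu : ContDiffOn ℝ ∞ u U) (i : Fin n) :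
    ContDiffOn ℝ ∞ (gradV G u i) U :=
  ContDiffOn.sum fun j _ => (h.smooth_inv i j).mul (contDiffOn_pd h.isOpen hu)

lemma smooth_covA (h : IsMetricOn G U) (hu : ContDiffOn ℝ ∞ u U) (k i : Fin n) :
    ContDiffOn ℝ ∞ (covA G u k i) U :=
  (contDiffOn_pd h.isOpen (h.smooth_gradV hu i)).add
    (ContDiffOn.sum fun l _ => (h.smooth_chr i k l).mul (h.smooth_gradV hu l))

lemma smooth_hessE (h : IsMetricOn G U) (hu : ContDiffOn ℝ ∞ u U) (i j : Fin n) :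
    ContDiffOn ℝ ∞ (fun y => hessE G u y i j) U :=
  (contDiffOn_pd h.isOpen (contDiffOn_pd h.isOpen hu)).sub
    (ContDiffOn.sum fun k _ => (h.smooth_chr k i j).mul (contDiffOn_pd h.isOpen hu))

lemma smooth_lapE (h : IsMetricOn G U) (hu : ContDiffOn ℝ ∞ u U) :
    ContDiffOn ℝ ∞ (lapE G u) U :=
  ContDiffOn.sum fun i _ => ContDiffOn.sum fun j _ => (h.smooth_inv i j).mul (h.smooth_hessE hu i j)

lemma smooth_innE (h : IsMetricOn G U) (hu : ContDiffOn ℝ ∞ u U) (hv : ContDiffOn ℝ ∞ v U) :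
    ContDiffOn ℝ ∞ (innE G u v) U :=
  ContDiffOn.sum fun i _ => ContDiffOn.sum fun j _ =>
    ((h.smooth_inv i j).mul (contDiffOn_pd h.isOpen hu)).mul (contDiffOn_pd h.isOpen hv)

lemma chr_symm (h : IsMetricOn G U) (hy : y ∈ U) (k i j : Fin n) :
    chr G k i j y = chr G k j i y := by
  unfold chr
  congr 1
  refine Finset.sum_congr rfl fun l _ => ?_
  rw [pd_congr_of_eqOn (i := l) h.isOpen hy fun z hz => h.symm hz i j]
  ring

lemma hessE_symm (h : IsMetricOn G U) (hu : ContDiffOn ℝ ∞ u U) (hy : y ∈ U) (i j : Fin n) :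
    hessE G u y i j = hessE G u y j i := by
  unfold hessE
  rw [pd_comm h.isOpen hu hy]
  simp only [h.chr_symm hy _ i j]

/-- The Christoffel symbols with the upper index lowered. -/
lemma sum_mul_chr (h : IsMetricOn G U) (hy : y ∈ U) (m i j : Fin n) :
    ∑ k, G y m k * chr G k i j y = (1 / 2) * (pd i (fun z => G z j m) y
      + pd j (fun z => G z i m) y - pd m (fun z => G z i j) y) := by
  have h1 : ∀ l, ∑ k, G y m k * (G y)⁻¹ k l = if m = l then 1 else 0 := fun l => by
    rw [← Matrix.mul_apply, h.mul_inv hy, Matrix.one_apply]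
  simp only [chr, Finset.mul_sum]
  rw [Finset.sum_comm]
  have h2 : ∀ l, ∑ k, G y m k * (1 / 2 * ((G y)⁻¹ k l * (pd i (fun z => G z j l) y
      + pd j (fun z => G z i l) y - pd l (fun z => G z i j) y)))
      = (∑ k, G y m k * (G y)⁻¹ k l) * (1 / 2 * (pd i (fun z => G z j l) y
      + pd j (fun z => G z i l) y - pd l (fun z => G z i j) y)) := fun l => by
    rw [Finset.sum_mul]; exact Finset.sum_congr rfl fun k _ => by ring
  simp only [h2, h1, ite_mul, one_mul, zero_mul, Finset.sum_ite_eq, Finset.mem_univ, if_true]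

/-- The Levi-Civita connection is compatible with the metric. -/
lemma pd_metric (h : IsMetricOn G U) (hy : y ∈ U) (k i j : Fin n) :
    pd k (fun z => G z i j) y
      = ∑ l, G y i l * chr G l k j y + ∑ l, G y j l * chr G l k i y := by
  rw [h.sum_mul_chr hy, h.sum_mul_chr hy,
    pd_congr_of_eqOn (i := k) h.isOpen hy fun z hz => h.symm hz j i,
    pd_congr_of_eqOn (i := i) h.isOpen hy fun z hz => h.symm hz k j,
    pd_congr_of_eqOn (i := j) h.isOpen hy fun z hz => h.symm hz k i]
  ring

/-- The inverse metric is parallel. -/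
lemma pd_inv (h : IsMetricOn G U) (hy : y ∈ U) (k i j : Fin n) :
    pd k (fun z => (G z)⁻¹ i j) y
      = -(∑ l, chr G i k l y * (G y)⁻¹ l j + ∑ l, (G y)⁻¹ i l * chr G j k l y) := by
  set C : Matrix (Fin n) (Fin n) ℝ := Matrix.of fun i l => chr G i k l y with hC
  set D : Matrix (Fin n) (Fin n) ℝ := Matrix.of fun i j => pd k (fun z => G z i j) y with hD
  set N : Matrix (Fin n) (Fin n) ℝ := Matrix.of fun i j => pd k (fun z => (G z)⁻¹ i j) y with hN
  have h1 : D = G y * C + (G y * C).transpose := by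
    ext a b
    simp only [hD, hC, Matrix.of_apply, Matrix.add_apply, Matrix.mul_apply, Matrix.transpose_apply]
    exact h.pd_metric hy k a b
  have h2 : N * G y + (G y)⁻¹ * D = 0 := by
    ext a b
    simp only [Matrix.add_apply, Matrix.mul_apply, hN, hD, Matrix.of_apply, Matrix.zero_apply]
    rw [← Finset.sum_add_distrib]
    have e1 : pd k (fun z => ∑ c, (G z)⁻¹ a c * G z c b) y = 0 := by
      rw [← pd_const (i := k) (y := y) ((1 : Matrix (Fin n) (Fin n) ℝ) a b)]
      refine pd_congr_of_eqOn h.isOpen hy fun z hz => ?_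
      rw [← Matrix.mul_apply, h.inv_mul hz]
    rw [← e1]
    exact (pd_sum_mul (fun c => (h.smooth_inv a c).diffAt h.isOpen hy)
      fun c => (h.smooth c b).diffAt h.isOpen hy).symm
  have hGt : (G y).transpose = G y := by ext a b; exact h.symm hy b a
  have hGit : ((G y)⁻¹).transpose = (G y)⁻¹ := by ext a b; exact h.inv_symm hy b a
  have h3 : N = -(C * (G y)⁻¹ + (G y)⁻¹ * C.transpose) := by
    have e : N = N * G y * (G y)⁻¹ := by rw [Matrix.mul_assoc, h.mul_inv hy, Matrix.mul_one]
    rw [e, eq_neg_of_add_eq_zero_left h2, h1, Matrix.transpose_mul, hGt]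
    rw [Matrix.mul_add, ← Matrix.mul_assoc, h.inv_mul hy, Matrix.one_mul, Matrix.neg_mul,
      Matrix.add_mul, Matrix.mul_assoc (G y)⁻¹, Matrix.mul_assoc C.transpose, h.mul_inv hy,
      Matrix.mul_one]
  have h4 := congrFun (congrFun h3 i) j
  simpa [hN, hC, Matrix.mul_apply] using h4

/-- Raising an index of the Hessian gives the covariant derivative of the gradient. -/
lemma covA_eq (h : IsMetricOn G U) (hu : ContDiffOn ℝ ∞ u U) (hy : y ∈ U) (k i : Fin n) :
    covA G u k i y = ∑ j, (G y)⁻¹ i j * hessE G u y k j := by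
  have hd : ∀ j, DifferentiableAt ℝ (pd j u) y := fun j =>
    (contDiffOn_pd h.isOpen hu).diffAt h.isOpen hy
  unfold covA
  have e1 : pd k (gradV G u i) y = ∑ j, (pd k (fun z => (G z)⁻¹ i j) y * pd j u y
      + (G y)⁻¹ i j * pd k (pd j u) y) :=
    pd_sum_mul (fun j => (h.smooth_inv i j).diffAt h.isOpen hy) hd
  rw [e1]
  simp only [h.pd_inv hy, gradV, hessE, mul_sub, add_mul, neg_mul, Finset.sum_add_distrib,
    Finset.sum_sub_distrib, Finset.mul_sum, Finset.sum_mul, neg_add, Finset.sum_neg_distrib]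
  have e2 : ∑ j, ∑ l, chr G i k l y * (G y)⁻¹ l j * pd j u y
      = ∑ l, ∑ j, chr G i k l y * ((G y)⁻¹ l j * pd j u y) := by
    rw [Finset.sum_comm]; simp only [mul_assoc]
  have e3 : ∑ j, ∑ l, (G y)⁻¹ i l * chr G j k l y * pd j u y
      = ∑ j, ∑ l, (G y)⁻¹ i j * (chr G l k j y * pd l u y) := by
    rw [Finset.sum_comm]; simp only [mul_assoc]
  rw [e2, e3]; ring

lemma sum_gradV_mul (h : IsMetricOn G U) (hy : y ∈ U) (w : Fin n → ℝ) :
    ∑ i, ∑ j, (G y)⁻¹ i j * pd i u y * w j = ∑ j, gradV G u j y * w j := by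
  rw [Finset.sum_comm]
  refine Finset.sum_congr rfl fun j _ => ?_
  rw [gradV, Finset.sum_mul]
  exact Finset.sum_congr rfl fun i _ => by rw [h.inv_symm hy]

lemma innE_eq (G : Model n → Matrix (Fin n) (Fin n) ℝ) (u v : Model n → ℝ) (y : Model n) :
    innE G u v y = ∑ i, pd i u y * gradV G v i y := by
  unfold innE gradV
  refine Finset.sum_congr rfl fun i _ => ?_
  rw [Finset.mul_sum]; exact Finset.sum_congr rfl fun j _ => by ring

lemma innE_comm (h : IsMetricOn G U) (hy : y ∈ U) : innE G u v y = innE G v u y := by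
  unfold innE
  rw [Finset.sum_comm]
  refine Finset.sum_congr rfl fun i _ => Finset.sum_congr rfl fun j _ => ?_
  rw [h.inv_symm hy]; ring

/-- Differentiating `⟨∇u, ∇v⟩` gives `∇²u(·, ∇v) + ∇²v(·, ∇u)`. -/
lemma pd_innE (h : IsMetricOn G U) (hu : ContDiffOn ℝ ∞ u U) (hv : ContDiffOn ℝ ∞ v U)
    (hy : y ∈ U) (k : Fin n) :
    pd k (innE G u v) y = ∑ i, hessE G u y k i * gradV G v i y
      + ∑ i, hessE G v y k i * gradV G u i y := by
  have hd : ∀ j, DifferentiableAt ℝ (pd j u) y := fun j =>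
    (contDiffOn_pd h.isOpen hu).diffAt h.isOpen hy
  have hg : ∀ j, DifferentiableAt ℝ (gradV G v j) y := fun j =>
    (h.smooth_gradV hv j).diffAt h.isOpen hy
  have e0 : pd k (innE G u v) y = pd k (fun z => ∑ i, pd i u z * gradV G v i z) y := by
    congr 1; funext z; exact innE_eq G u v z
  rw [e0, pd_sum_mul hd hg]
  have e1 : ∀ i, pd k (pd i u) y * gradV G v i y + pd i u y * pd k (gradV G v i) y
      = (hessE G u y k i + ∑ m, chr G m k i y * pd m u y) * gradV G v i y
        + pd i u y * (∑ j, (G y)⁻¹ i j * hessE G v y k j - ∑ l, chr G i k l y * gradV G v l y) := by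
    intro i
    rw [← h.covA_eq hv hy]
    simp only [hessE, covA]; ring
  simp only [e1, add_mul, mul_sub, Finset.sum_add_distrib, Finset.sum_sub_distrib]
  have e2 : ∑ i, (∑ m, chr G m k i y * pd m u y) * gradV G v i y
      = ∑ i, pd i u y * ∑ l, chr G i k l y * gradV G v l y := by
    simp only [Finset.mul_sum, Finset.sum_mul]
    rw [Finset.sum_comm]
    exact Finset.sum_congr rfl fun i _ => Finset.sum_congr rfl fun j _ => by ring
  have e3 : ∑ i, pd i u y * ∑ j, (G y)⁻¹ i j * hessE G v y k j
      = ∑ i, hessE G v y k i * gradV G u i y := by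
    have := h.sum_gradV_mul (u := u) hy (fun j => hessE G v y k j)
    rw [Finset.sum_congr rfl fun i _ => mul_comm (hessE G v y k i) _, ← this]
    refine Finset.sum_congr rfl fun i _ => ?_
    rw [Finset.mul_sum]; exact Finset.sum_congr rfl fun j _ => by ring
  rw [e2, e3]; ring

/-- The Laplacian is the divergence of the gradient. -/
lemma lapE_eq (h : IsMetricOn G U) (hu : ContDiffOn ℝ ∞ u U) (hy : y ∈ U) :
    lapE G u y = ∑ k, (pd k (gradV G u k) y + ∑ l, chr G k k l y * gradV G u l y) := by
  change _ = ∑ k, covA G u k k y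
  simp only [h.covA_eq hu hy]
  unfold lapE
  exact Finset.sum_congr rfl fun i _ => Finset.sum_congr rfl fun j _ => rfl

end IsMetricOn

end Euclidean


section Euclidean

variable {n : ℕ} {G : Model n → Matrix (Fin n) (Fin n) ℝ} {U : Set (Model n)}
  {u v f : Model n → ℝ} {y : Model n}

namespace IsMetricOn

/-! ### The Bochner formula -/

/-- The contracted Ricci identity `∇ₖ∇ᵢXᵏ = ∂ᵢ(div X) + R_qi X^q` for `X = ∇u`. -/
lemma sum_nabla_covA (h : IsMetricOn G U) (hu : ContDiffOn ℝ ∞ u U) (hy : y ∈ U) (i : Fin n) :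
    ∑ k, (pd k (covA G u i k) y - ∑ p, chr G p k i y * covA G u p k y
      + ∑ p, chr G k k p y * covA G u i p y)
      = pd i (lapE G u) y + ∑ q, ricE G y q i * gradV G u q y := by
  have hX : ∀ l, ContDiffOn ℝ ∞ (gradV G u l) U := fun l => h.smooth_gradV hu l
  have dX : ∀ l, DifferentiableAt ℝ (gradV G u l) y := fun l => (hX l).diffAt h.isOpen hy
  have dX' : ∀ k l, DifferentiableAt ℝ (pd k (gradV G u l)) y := fun k l =>
    (contDiffOn_pd h.isOpen (hX l)).diffAt h.isOpen hy
  have dC : ∀ k i j, DifferentiableAt ℝ (chr G k i j) y := fun k i j =>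
    (h.smooth_chr k i j).diffAt h.isOpen hy
  have dA : ∀ k i, DifferentiableAt ℝ (covA G u k i) y := fun k i =>
    (h.smooth_covA hu k i).diffAt h.isOpen hy
  have dS : ∀ k i, DifferentiableAt ℝ (fun z => ∑ l, chr G i k l z * gradV G u l z) y :=
    fun k i => DifferentiableAt.fun_sum fun l _ => (dC i k l).mul (dX l)
  have e1 : ∀ m k i, pd m (covA G u k i) y = pd m (pd k (gradV G u i)) y
      + ∑ l, (pd m (chr G i k l) y * gradV G u l y + chr G i k l y * pd m (gradV G u l) y) := by
    intro m k i
    rw [← pd_sum_mul (fun l => dC i k l) dX]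
    exact pd_add (dX' k i) (dS k i)
  have e2 : pd i (lapE G u) y = ∑ k, pd i (covA G u k k) y := by
    rw [← pd_sum fun k _ => dA k k]
    exact pd_congr_of_eqOn h.isOpen hy fun z hz => h.lapE_eq hu hz
  have e3 : ∀ k, pd i (pd k (gradV G u k)) y = pd k (pd i (gradV G u k)) y := fun k =>
    pd_comm h.isOpen (hX k) hy
  have e4 : ∀ k q, pd k (chr G k q i) y = pd k (chr G k i q) y := fun k q =>
    pd_congr_of_eqOn h.isOpen hy fun z hz => h.chr_symm hz _ _ _
  have e5 : ∀ k q, pd i (chr G k q k) y = pd i (chr G k k q) y := fun k q =>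
    pd_congr_of_eqOn h.isOpen hy fun z hz => h.chr_symm hz _ _ _
  have e6 : ∑ k, ∑ p, chr G p k i y * pd p (gradV G u k) y
      = ∑ k, ∑ p, chr G k i p y * pd k (gradV G u p) y := by
    rw [Finset.sum_comm]
    refine Finset.sum_congr rfl fun k _ => Finset.sum_congr rfl fun p _ => ?_
    rw [h.chr_symm hy]
  -- the Ricci term, with the indices arranged as in the derivatives of `covA`
  have e7 : ∑ q, ricE G y q i * gradV G u q y = ∑ k, ∑ q, (pd k (chr G k i q) y
      - pd i (chr G k k q) y) * gradV G u q y
      + (∑ k, ∑ p, ∑ q, chr G k k p y * (chr G p i q y * gradV G u q y)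
      - ∑ k, ∑ p, ∑ q, chr G p k i y * (chr G k p q y * gradV G u q y)) := by
    simp only [ricE, Finset.sum_mul, Finset.sum_add_distrib, add_mul]
    congr 1
    · rw [Finset.sum_comm]
      refine Finset.sum_congr rfl fun k _ => Finset.sum_congr rfl fun p _ => ?_
      rw [e4, e5]
    · have e8 : ∑ k, ∑ p, ∑ q, chr G p k i y * (chr G k p q y * gradV G u q y)
          = ∑ k, ∑ p, ∑ q, chr G k i p y * (chr G p q k y * gradV G u q y) := by
        rw [Finset.sum_comm]
        refine Finset.sum_congr rfl fun k _ => Finset.sum_congr rfl fun p _ =>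
          Finset.sum_congr rfl fun q _ => ?_
        rw [h.chr_symm hy k i p, h.chr_symm hy p q k]
      rw [e8, Finset.sum_comm, ← Finset.sum_sub_distrib]
      refine Finset.sum_congr rfl fun k _ => ?_
      rw [Finset.sum_comm, ← Finset.sum_sub_distrib]
      refine Finset.sum_congr rfl fun p _ => ?_
      rw [← Finset.sum_sub_distrib]
      exact Finset.sum_congr rfl fun q _ => by rw [h.chr_symm hy p q i]; ring
  rw [e2, e7]
  simp only [e1, covA, mul_add, Finset.mul_sum, Finset.sum_add_distrib, Finset.sum_sub_distrib, e3,
    sub_mul, e6]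
  ring

/-- The Bochner formula. -/
lemma bochner (h : IsMetricOn G U) (hu : ContDiffOn ℝ ∞ u U) (hy : y ∈ U) :
    lapE G (innE G u u) y = 2 * hsqE G u y + 2 * innE G u (lapE G u) y
      + 2 * ∑ i, ∑ j, ricE G y i j * gradV G u i y * gradV G u j y := by
  have hX : ∀ l, ContDiffOn ℝ ∞ (gradV G u l) U := fun l => h.smooth_gradV hu l
  have dX : ∀ l, DifferentiableAt ℝ (gradV G u l) y := fun l => (hX l).diffAt h.isOpen hy
  have dA : ∀ k i, DifferentiableAt ℝ (covA G u k i) y := fun k i =>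
    (h.smooth_covA hu k i).diffAt h.isOpen hy
  have hP : ContDiffOn ℝ ∞ (innE G u u) U := h.smooth_innE hu hu
  -- the gradient of `|∇u|²` is `2 ∇_X X`, where `X = ∇u`
  have e1 : ∀ z ∈ U, ∀ k, gradV G (innE G u u) k z = 2 * ∑ i, covA G u i k z * gradV G u i z := by
    intro z hz k
    change ∑ j, (G z)⁻¹ k j * pd j (innE G u u) z = _
    simp only [h.pd_innE hu hu hz, h.covA_eq hu hz]
    simp only [← two_mul, Finset.mul_sum, Finset.sum_mul]
    rw [Finset.sum_comm]
    refine Finset.sum_congr rfl fun i _ => Finset.sum_congr rfl fun j _ => ?_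
    rw [h.hessE_symm hu hz i j]; ring
  have e2 : ∀ k, pd k (gradV G (innE G u u) k) y = 2 * ∑ i, (pd k (covA G u i k) y * gradV G u i y
      + covA G u i k y * pd k (gradV G u i) y) := by
    intro k
    rw [← pd_sum_mul (fun i => dA i k) dX, ← pd_const_mul]
    · exact pd_congr_of_eqOn h.isOpen hy fun z hz => e1 z hz k
    · exact DifferentiableAt.fun_sum fun i _ => (dA i k).mul (dX i)
  have e3 : ∀ k i, pd k (gradV G u i) y = covA G u k i y - ∑ l, chr G i k l y * gradV G u l y := by
    intro k i; unfold covA; ring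
  -- `|∇²u|² = ∇ᵢXᵏ ∇ₖXⁱ`, by the symmetry of the Hessian
  have e4 : hsqE G u y = ∑ k, ∑ i, covA G u i k y * covA G u k i y := by
    simp only [h.covA_eq hu hy, hsqE, Finset.sum_mul_sum]
    refine Eq.trans (Finset.sum_congr rfl fun i _ => ?_) Finset.sum_comm
    rw [Finset.sum_congr rfl fun j _ => Finset.sum_comm, Finset.sum_comm]
    refine Finset.sum_congr rfl fun l _ => Finset.sum_congr rfl fun j _ =>
      Finset.sum_congr rfl fun k _ => ?_
    rw [h.hessE_symm hu hy k l, h.inv_symm hy j l]; ring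
  have e5 : innE G u (lapE G u) y = ∑ i, pd i (lapE G u) y * gradV G u i y := by
    rw [h.innE_comm hy, innE_eq]
  have e6 : ∑ i, (pd i (lapE G u) y + ∑ q, ricE G y q i * gradV G u q y) * gradV G u i y
      = ∑ i, (∑ k, (pd k (covA G u i k) y - ∑ p, chr G p k i y * covA G u p k y
      + ∑ p, chr G k k p y * covA G u i p y)) * gradV G u i y :=
    Finset.sum_congr rfl fun i _ => by rw [h.sum_nabla_covA hu hy]
  have e7 : ∑ i, ∑ q, ricE G y q i * gradV G u q y * gradV G u i y
      = ∑ i, ∑ j, ricE G y i j * gradV G u i y * gradV G u j y := Finset.sum_comm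
  have e8 : ∑ k, ∑ i, covA G u i k y * ∑ l, chr G i k l y * gradV G u l y
      = ∑ i, ∑ k, ∑ p, chr G p k i y * covA G u p k y * gradV G u i y := by
    simp only [Finset.mul_sum]
    rw [Finset.sum_congr rfl fun k _ => Finset.sum_comm, Finset.sum_comm]
    exact Finset.sum_congr rfl fun i _ => Finset.sum_congr rfl fun k _ =>
      Finset.sum_congr rfl fun p _ => by ring
  have e9 : ∑ k, ∑ l, chr G k k l y * ∑ i, covA G u i l y * gradV G u i y
      = ∑ i, ∑ k, ∑ p, chr G k k p y * covA G u i p y * gradV G u i y := by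
    simp only [Finset.mul_sum]
    rw [Finset.sum_congr rfl fun k _ => Finset.sum_comm, Finset.sum_comm]
    exact Finset.sum_congr rfl fun i _ => Finset.sum_congr rfl fun k _ =>
      Finset.sum_congr rfl fun p _ => by ring
  have e10 : ∑ k, ∑ i, pd k (covA G u i k) y * gradV G u i y
      = ∑ i, ∑ k, pd k (covA G u i k) y * gradV G u i y := Finset.sum_comm
  simp only [add_mul, sub_mul, Finset.sum_mul, Finset.sum_add_distrib,
    Finset.sum_sub_distrib] at e6
  rw [h.lapE_eq hP hy, e4, e5]
  simp only [e1 y hy, e2, e3, mul_sub, mul_left_comm _ (2 : ℝ) _, ← Finset.mul_sum,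
    Finset.sum_add_distrib, Finset.sum_sub_distrib, mul_add]
  linarith

/-- The Bochner formula for the drift Laplacian `Δ - ⟨∇f, ∇·⟩`. The terms `∇²u(∇f, ∇u)` of
`⟨∇u, ∇⟨∇f, ∇u⟩⟩` and of `⟨∇f, ∇|∇u|²⟩` cancel. -/
lemma bochner_drift (h : IsMetricOn G U) (hu : ContDiffOn ℝ ∞ u U) (hf : ContDiffOn ℝ ∞ f U)
    (hy : y ∈ U) :
    lapE G (innE G u u) y - innE G f (innE G u u) y = 2 * hsqE G u y
      + 2 * innE G u (fun z => lapE G u z - innE G f u z) y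
      + 2 * (∑ i, ∑ j, ricE G y i j * gradV G u i y * gradV G u j y
        + ∑ i, ∑ j, hessE G f y i j * gradV G u i y * gradV G u j y) := by
  have dL : DifferentiableAt ℝ (lapE G u) y := (h.smooth_lapE hu).diffAt h.isOpen hy
  have dI : DifferentiableAt ℝ (innE G f u) y := (h.smooth_innE hf hu).diffAt h.isOpen hy
  have e1 : innE G u (fun z => lapE G u z - innE G f u z) y
      = innE G u (lapE G u) y - innE G u (innE G f u) y := by
    rw [h.innE_comm hy, innE_eq, h.innE_comm hy (v := lapE G u), innE_eq,
      h.innE_comm hy (v := innE G f u), innE_eq, ← Finset.sum_sub_distrib]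
    exact Finset.sum_congr rfl fun i _ => by rw [pd_sub dL dI, sub_mul]
  have e2 : innE G u (innE G f u) y = ∑ i, ∑ j, hessE G f y i j * gradV G u i y * gradV G u j y
      + ∑ i, ∑ j, hessE G u y i j * gradV G f j y * gradV G u i y := by
    rw [h.innE_comm hy, innE_eq, ← Finset.sum_add_distrib]
    refine Finset.sum_congr rfl fun i _ => ?_
    rw [h.pd_innE hf hu hy, add_mul, Finset.sum_mul, Finset.sum_mul]
    congr 1
    exact Finset.sum_congr rfl fun j _ => by ring
  have e3 : innE G f (innE G u u) y
      = 2 * ∑ i, ∑ j, hessE G u y i j * gradV G f j y * gradV G u i y := by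
    rw [h.innE_comm hy, innE_eq, Finset.sum_comm (f := fun i j => hessE G u y i j * _ * _),
      Finset.mul_sum]
    refine Finset.sum_congr rfl fun i _ => ?_
    rw [h.pd_innE hu hu hy, ← two_mul, mul_assoc, Finset.sum_mul]
    congr 1
    exact Finset.sum_congr rfl fun j _ => by rw [h.hessE_symm hu hy i j]; ring
  rw [h.bochner hu hy, e1, e2, e3]; ring

/-! ### The divergence form of the Laplacian -/

lemma smooth_sqrt_det (h : IsMetricOn G U) :
    ContDiffOn ℝ ∞ (fun z => Real.sqrt (G z).det) U :=
  (contDiffOn_det h.smooth).sqrt fun _ hz => (h.det_pos hz).ne'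

lemma pd_sqrt_det (h : IsMetricOn G U) (hy : y ∈ U) (k : Fin n) :
    pd k (fun z => Real.sqrt (G z).det) y
      = Real.sqrt (G y).det * ∑ l, chr G l l k y := by
  have hd := h.det_pos hy
  have e0 := hasFDerivAt_det fun i j => ((h.smooth i j).diffAt h.isOpen hy).hasFDerivAt
  have e1 : pd k (fun z => (G z).det) y = (G y).det * (2 * ∑ l, chr G l l k y) := by
    have e2 : pd k (fun z => (G z).det) y
        = ∑ i, ∑ j, (G y).adjugate i j * pd k (fun z => G z j i) y := by
      unfold pd; rw [e0.fderiv]; simp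
    have e3 : ∀ i j, (G y).adjugate i j = (G y).det * (G y)⁻¹ i j := by
      intro i j
      rw [Matrix.inv_def, Matrix.smul_apply, Ring.inverse_eq_inv', smul_eq_mul, ← mul_assoc,
        mul_inv_cancel₀ hd.ne', one_mul]
    have e4 : ∀ i l, ∑ j, (G y)⁻¹ i j * G y j l = if i = l then 1 else 0 := fun i l => by
      rw [← Matrix.mul_apply, h.inv_mul hy, Matrix.one_apply]
    have e5 : ∀ j l, ∑ i, (G y)⁻¹ i j * G y i l = if j = l then 1 else 0 := fun j l => by
      rw [← e4]; exact Finset.sum_congr rfl fun i _ => by rw [h.inv_symm hy]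
    have e6 : ∑ i, ∑ j, (G y)⁻¹ i j * ∑ l, G y j l * chr G l k i y = ∑ l, chr G l l k y := by
      have : ∀ i, ∑ j, (G y)⁻¹ i j * ∑ l, G y j l * chr G l k i y = chr G i i k y := by
        intro i
        simp only [Finset.mul_sum]
        rw [Finset.sum_comm]
        simp only [← mul_assoc, ← Finset.sum_mul, e4]
        simp [h.chr_symm hy i k i]
      exact Finset.sum_congr rfl fun i _ => this i
    have e7 : ∑ i, ∑ j, (G y)⁻¹ i j * ∑ l, G y i l * chr G l k j y = ∑ l, chr G l l k y := by
      rw [Finset.sum_comm, ← e6]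
      exact Finset.sum_congr rfl fun i _ => Finset.sum_congr rfl fun j _ => by
        rw [h.inv_symm hy]
    simp only [e2, e3, h.pd_metric hy, mul_assoc, ← Finset.mul_sum, mul_add,
      Finset.sum_add_distrib]
    rw [e6, e7]; ring
  rw [pd_comp (F := fun z => (G z).det) (Real.hasDerivAt_sqrt hd.ne') e0.differentiableAt, e1]
  have : (G y).det = Real.sqrt (G y).det * Real.sqrt (G y).det := (Real.mul_self_sqrt hd.le).symm
  have h0 : Real.sqrt (G y).det ≠ 0 := (Real.sqrt_pos.2 hd).ne'
  field_simp
  rw [Real.sq_sqrt hd.le]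

/-- The divergence form of the Laplacian. -/
lemma sqrt_det_mul_lapE (h : IsMetricOn G U) (hu : ContDiffOn ℝ ∞ u U) (hy : y ∈ U) :
    Real.sqrt (G y).det * lapE G u y
      = ∑ k, pd k (fun z => Real.sqrt (G z).det * gradV G u k z) y := by
  have : ∀ k, pd k (fun z => Real.sqrt (G z).det * gradV G u k z) y
      = Real.sqrt (G y).det * pd k (gradV G u k) y
        + ∑ l, Real.sqrt (G y).det * chr G l l k y * gradV G u k y := by
    intro k
    rw [pd_mul (h.smooth_sqrt_det.diffAt h.isOpen hy) ((h.smooth_gradV hu k).diffAt h.isOpen hy),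
      h.pd_sqrt_det hy, ← Finset.sum_mul, ← Finset.mul_sum]
    ring
  simp only [this, h.lapE_eq hu hy, Finset.mul_sum, mul_add, Finset.sum_add_distrib]
  congr 1
  rw [Finset.sum_comm]
  exact Finset.sum_congr rfl fun i _ => Finset.sum_congr rfl fun j _ => by ring

/-! ### Inequalities -/

/-- The inverse metric is a sum of squares. -/
lemma exists_frame (h : IsMetricOn G U) (hy : y ∈ U) :
    ∃ B : Fin n → Fin n → ℝ, ∀ i j, (G y)⁻¹ i j = ∑ a, B a i * B a j := by
  open scoped MatrixOrder in
  obtain ⟨B, hB⟩ := CStarAlgebra.nonneg_iff_eq_star_mul_self.mp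
    (h.posDef y hy).inv.posSemidef.nonneg
  refine ⟨B, fun i j => ?_⟩
  rw [hB, Matrix.mul_apply]
  simp [Matrix.star_apply]

lemma quad_frame {B : Fin n → Fin n → ℝ} (hB : ∀ i j, (G y)⁻¹ i j = ∑ a, B a i * B a j)
    (w z : Fin n → ℝ) :
    ∑ i, ∑ j, (G y)⁻¹ i j * w i * z j = ∑ a, (∑ i, B a i * w i) * (∑ j, B a j * z j) := by
  have h1 : ∀ i j, (G y)⁻¹ i j * w i * z j = ∑ a, (B a i * w i) * (B a j * z j) := fun i j => by
    rw [hB, Finset.sum_mul, Finset.sum_mul]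
    exact Finset.sum_congr rfl fun a _ => by ring
  simp only [h1, Finset.sum_mul_sum]
  rw [Finset.sum_congr rfl fun i _ => Finset.sum_comm, Finset.sum_comm]

lemma hsqE_frame (h : IsMetricOn G U) (hu : ContDiffOn ℝ ∞ u U) (hy : y ∈ U)
    {B : Fin n → Fin n → ℝ} (hB : ∀ i j, (G y)⁻¹ i j = ∑ a, B a i * B a j) :
    hsqE G u y = ∑ a, ∑ b, (∑ j, B b j * ∑ i, B a i * hessE G u y j i) ^ 2 := by
  have h1 : hsqE G u y = ∑ j, ∑ l, (G y)⁻¹ j l *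
      ∑ i, ∑ k, (G y)⁻¹ i k * hessE G u y j i * hessE G u y l k := by
    simp only [Finset.mul_sum, hsqE]
    rw [Finset.sum_comm]
    refine Finset.sum_congr rfl fun j _ => ?_
    rw [Finset.sum_congr rfl fun i _ => Finset.sum_comm, Finset.sum_comm]
    refine Finset.sum_congr rfl fun l _ => Finset.sum_congr rfl fun i _ =>
      Finset.sum_congr rfl fun k _ => ?_
    rw [h.hessE_symm hu hy i j, h.hessE_symm hu hy k l]; ring
  rw [h1]
  simp only [quad_frame hB, Finset.mul_sum]
  rw [Finset.sum_congr rfl fun i _ => Finset.sum_comm, Finset.sum_comm]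
  refine Finset.sum_congr rfl fun a _ => ?_
  have h2 := quad_frame hB (fun j => ∑ i, B a i * hessE G u y j i)
    (fun j => ∑ i, B a i * hessE G u y j i)
  simp only [← sq] at h2
  simp only [← Finset.mul_sum]
  rw [← h2]
  exact Finset.sum_congr rfl fun i _ => Finset.sum_congr rfl fun j _ => by ring

lemma hsqE_nonneg (h : IsMetricOn G U) (hu : ContDiffOn ℝ ∞ u U) (hy : y ∈ U) :
    0 ≤ hsqE G u y := by
  obtain ⟨B, hB⟩ := h.exists_frame hy
  rw [h.hsqE_frame hu hy hB]; positivity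

lemma innE_frame {B : Fin n → Fin n → ℝ} (hB : ∀ i j, (G y)⁻¹ i j = ∑ a, B a i * B a j) :
    innE G u v y = ∑ a, (∑ i, B a i * pd i u y) * (∑ j, B a j * pd j v y) :=
  quad_frame hB _ _

lemma innE_self_nonneg (h : IsMetricOn G U) (hy : y ∈ U) : 0 ≤ innE G u u y := by
  obtain ⟨B, hB⟩ := h.exists_frame hy
  rw [innE_frame hB]
  exact Finset.sum_nonneg fun a _ => mul_self_nonneg _

lemma innE_sq_le (h : IsMetricOn G U) (hy : y ∈ U) :
    innE G u v y ^ 2 ≤ innE G u u y * innE G v v y := by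
  obtain ⟨B, hB⟩ := h.exists_frame hy
  simp only [innE_frame hB, ← sq]
  exact Finset.sum_mul_sq_le_sq_mul_sq _ _ _

/-- `|∇|∇u|²|² ≤ 4 |∇u|² |∇²u|²`. -/
lemma innE_innE_le (h : IsMetricOn G U) (hu : ContDiffOn ℝ ∞ u U) (hy : y ∈ U) :
    innE G (innE G u u) (innE G u u) y ≤ 4 * innE G u u y * hsqE G u y := by
  obtain ⟨B, hB⟩ := h.exists_frame hy
  rw [h.hsqE_frame hu hy hB, innE_frame hB (u := u) (v := u), innE_frame hB]
  have h1 : ∀ b, ∑ k, B b k * pd k (innE G u u) y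
      = 2 * ∑ a, (∑ i, B a i * pd i u y) * ∑ j, B b j * ∑ i, B a i * hessE G u y j i := by
    intro b
    have h2 : ∀ k, pd k (innE G u u) y = 2 * ∑ a, (∑ i, B a i * pd i u y) *
        ∑ i, B a i * hessE G u y k i := by
      intro k
      rw [h.pd_innE hu hu hy, ← two_mul, ← quad_frame hB, h.sum_gradV_mul hy]
      simp only [mul_comm]
    simp only [h2, Finset.mul_sum]
    rw [Finset.sum_comm]
    refine Finset.sum_congr rfl fun a _ => Finset.sum_congr rfl fun k _ =>
      Finset.sum_congr rfl fun i _ => ?_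
    ring
  simp only [h1]
  have h3 : ∀ b, (2 * ∑ a, (∑ i, B a i * pd i u y) * ∑ j, B b j * ∑ i, B a i * hessE G u y j i) *
      (2 * ∑ a, (∑ i, B a i * pd i u y) * ∑ j, B b j * ∑ i, B a i * hessE G u y j i)
      ≤ 4 * ((∑ a, (∑ i, B a i * pd i u y) ^ 2) *
        ∑ a, (∑ j, B b j * ∑ i, B a i * hessE G u y j i) ^ 2) := by
    intro b
    have := Finset.sum_mul_sq_le_sq_mul_sq Finset.univ (fun a => ∑ i, B a i * pd i u y)
      (fun a => ∑ j, B b j * ∑ i, B a i * hessE G u y j i)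
    nlinarith [this]
  refine (Finset.sum_le_sum fun b _ => h3 b).trans (le_of_eq ?_)
  rw [← Finset.mul_sum, ← Finset.mul_sum, Finset.sum_comm, mul_assoc]
  simp only [sq]

/-- `(Δu)² ≤ n |∇²u|²`. -/
lemma lapE_sq_le (h : IsMetricOn G U) (hu : ContDiffOn ℝ ∞ u U) (hy : y ∈ U) :
    lapE G u y ^ 2 ≤ n * hsqE G u y := by
  obtain ⟨B, hB⟩ := h.exists_frame hy
  have h1 : lapE G u y = ∑ a, ∑ j, B a j * ∑ i, B a i * hessE G u y j i := by
    simp only [lapE, hB, Finset.sum_mul, Finset.mul_sum]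
    rw [Finset.sum_congr rfl fun i _ => Finset.sum_comm, Finset.sum_comm]
    exact Finset.sum_congr rfl fun a _ => Finset.sum_congr rfl fun i _ =>
      Finset.sum_congr rfl fun j _ => by ring
  rw [h.hsqE_frame hu hy hB, h1]
  refine sq_sum_le_card_mul_sum_sq.trans ?_
  simp only [Finset.card_univ, Fintype.card_fin]
  refine mul_le_mul_of_nonneg_left (Finset.sum_le_sum fun a _ => ?_) (by positivity)
  exact Finset.single_le_sum (f := fun b => (∑ j, B b j * ∑ i, B a i * hessE G u y j i) ^ 2)
    (fun b _ => sq_nonneg _) (Finset.mem_univ a)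

/-- The trace of a quadratic form that is bounded by `c` times the metric is at most `n c`. -/
lemma trace_le (h : IsMetricOn G U) (hy : y ∈ U) {T : Fin n → Fin n → ℝ} {c : ℝ}
    (hT : ∀ w : Fin n → ℝ, ∑ i, ∑ j, T i j * w i * w j ≤ c * ∑ i, ∑ j, G y i j * w i * w j) :
    ∑ i, ∑ j, (G y)⁻¹ i j * T i j ≤ n * c := by
  obtain ⟨B, hB⟩ := h.exists_frame hy
  have h1 : ∀ S : Fin n → Fin n → ℝ, ∑ i, ∑ j, (G y)⁻¹ i j * S i j
      = ∑ a, ∑ i, ∑ j, S i j * B a i * B a j := by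
    intro S
    simp only [hB, Finset.sum_mul]
    rw [Finset.sum_congr rfl fun i _ => Finset.sum_comm, Finset.sum_comm]
    exact Finset.sum_congr rfl fun a _ => Finset.sum_congr rfl fun i _ =>
      Finset.sum_congr rfl fun j _ => by ring
  have h2 : ∑ i, ∑ j, (G y)⁻¹ i j * G y i j = n := by
    have : ∀ i, ∑ j, (G y)⁻¹ i j * G y i j = 1 := fun i => by
      rw [Finset.sum_congr rfl fun j _ => by rw [h.symm hy i j], ← Matrix.mul_apply, h.inv_mul hy,
        Matrix.one_apply_eq]
    simp [this]
  calc _ = ∑ a, ∑ i, ∑ j, T i j * B a i * B a j := h1 T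
    _ ≤ ∑ a, c * ∑ i, ∑ j, G y i j * B a i * B a j := Finset.sum_le_sum fun a _ => hT _
    _ = c * ∑ i, ∑ j, (G y)⁻¹ i j * G y i j := by rw [← Finset.mul_sum, ← h1 fun i j => G y i j]
    _ = n * c := by rw [h2]; ring

/-- The gradient has norm `|∇u|`. -/
lemma sum_gradV_gradV (h : IsMetricOn G U) (hy : y ∈ U) :
    ∑ i, ∑ j, G y i j * gradV G u i y * gradV G u j y = innE G u u y := by
  rw [innE_eq]
  refine Finset.sum_congr rfl fun i _ => ?_
  have : ∑ j, G y i j * gradV G u j y = pd i u y := by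
    simp only [gradV, Finset.mul_sum]
    rw [Finset.sum_comm]
    simp only [← mul_assoc, ← Finset.sum_mul]
    have e4 : ∀ l, ∑ j, G y i j * (G y)⁻¹ j l = if i = l then 1 else 0 := fun l => by
      rw [← Matrix.mul_apply, h.mul_inv hy, Matrix.one_apply]
    simp [e4]
  rw [← this, Finset.sum_mul]
  exact Finset.sum_congr rfl fun j _ => by ring

end IsMetricOn
end Euclidean

section Charts

variable {n : ℕ} {M : Type*} [TopologicalSpace M] [ChartedSpace (Model n) M]

local notation "Φ" => extChartAt (𝓡 n)

/-! ### Changes of charts -/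

variable (n) in
/-- The change of coordinates from the chart around `c` to the chart around `c'`. -/
def chg (c c' : M)
    (y : Model n) : Model n := Φ c' ((Φ c).symm y)

variable (n) in
/-- The set on which the change of coordinates `chg n c c'` is meaningful. -/
def ovl (c c' : M) :
    Set (Model n) := (Φ c).target ∩ (Φ c).symm ⁻¹' (Φ c').source

variable (n) in
/-- The derivative of the inverse of the chart around `c`, as an endomorphism of the model space
(to which all tangent spaces are equal by definition). -/
def symmD (c : M)
    (y : Model n) : Model n →L[ℝ] Model n :=
  mfderiv 𝓘(ℝ, Model n) (𝓡 n) (Φ c).symm y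

variable (n) in
/-- The derivative of the chart around `c`, as an endomorphism of the model space. -/
def chartD (c : M)
    (x : M) : Model n →L[ℝ] Model n :=
  mfderiv (𝓡 n) 𝓘(ℝ, Model n) (Φ c) x

lemma isOpen_target (c : M) : IsOpen (Φ c).target := isOpen_extChartAt_target c

lemma isOpen_source (c : M) : IsOpen (Φ c).source := isOpen_extChartAt_source c

lemma isOpen_ovl (c c' : M) : IsOpen (ovl n c c') :=
  (continuousOn_extChartAt_symm c).isOpen_inter_preimage (isOpen_target c) (isOpen_source c')

lemma chart_mem_ovl {c c' x : M} (hx : x ∈ (Φ c).source) (hx' : x ∈ (Φ c').source) :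
    Φ c x ∈ ovl n c c' :=
  ⟨(Φ c).map_source hx, by rwa [mem_preimage, (Φ c).left_inv hx]⟩

lemma chg_chart {c x : M} (c' : M) (hx : x ∈ (Φ c).source) : chg n c c' (Φ c x) = Φ c' x := by
  rw [chg, (Φ c).left_inv hx]

lemma symm_chg {c c' : M} {y : Model n} (hy : y ∈ ovl n c c') :
    (Φ c').symm (chg n c c' y) = (Φ c).symm y := (Φ c').left_inv hy.2

lemma chg_mem {c c' : M} {y : Model n} (hy : y ∈ ovl n c c') : chg n c c' y ∈ ovl n c' c :=
  ⟨(Φ c').map_source hy.2, by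
    rw [mem_preimage, symm_chg hy]; exact (Φ c).map_target hy.1⟩

lemma chg_chg {c c' : M} {y : Model n} (hy : y ∈ ovl n c c') :
    chg n c' c (chg n c c' y) = y := by
  rw [chg, symm_chg hy, (Φ c).right_inv hy.1]

variable (n) in
/-- The Jacobian matrix of a change of coordinates. -/
def jac (c c' : M)
    (y : Model n) : Matrix (Fin n) (Fin n) ℝ :=
  Matrix.of fun j i => fderiv ℝ (chg n c c') y (EuclideanSpace.single i (1 : ℝ)) j

lemma det_fderiv_chg (c c' : M) (y : Model n) :
    (fderiv ℝ (chg n c c') y).det = (jac n c c' y).det := by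
  change LinearMap.det _ = _
  rw [← LinearMap.det_toMatrix (EuclideanSpace.basisFun (Fin n) ℝ).toBasis
    (fderiv ℝ (chg n c c') y : Model n →ₗ[ℝ] Model n)]
  congr 1

variable [IsManifold (𝓡 n) ∞ M]

lemma contDiffOn_chg (c c' : M) : ContDiffOn ℝ ∞ (chg n c c') (ovl n c c') := by
  have := contDiffOn_ext_coord_change (I := 𝓡 n) (n := ∞) c' c
  refine this.mono fun y hy => ?_
  simpa [ovl, PartialEquiv.trans_source] using hy

lemma mdifferentiableAt_symm {c : M} {y : Model n} (hy : y ∈ (Φ c).target) :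
    MDifferentiableAt 𝓘(ℝ, Model n) (𝓡 n) (Φ c).symm y :=
  ((contMDiffOn_extChartAt_symm (I := 𝓡 n) (n := ∞) c).contMDiffAt
    ((isOpen_target c).mem_nhds hy)).mdifferentiableAt (by simp)

lemma mdifferentiableAt_chart {c x : M} (hx : x ∈ (Φ c).source) :
    MDifferentiableAt (𝓡 n) 𝓘(ℝ, Model n) (Φ c) x :=
  (contMDiffAt_extChartAt' (I := 𝓡 n) (n := ∞) (by simpa using hx)).mdifferentiableAt (by simp)

lemma chartD_comp_symmD {c : M} {y : Model n} (hy : y ∈ (Φ c).target) :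
    (chartD n c ((Φ c).symm y)).comp (symmD n c y) = ContinuousLinearMap.id ℝ (Model n) := by
  have h1 := mfderiv_comp (I'' := 𝓘(ℝ, Model n)) y
    (mdifferentiableAt_chart ((Φ c).map_target hy)) (mdifferentiableAt_symm hy)
  have h2 : (Φ c ∘ (Φ c).symm : Model n → Model n) =ᶠ[𝓝 y] id :=
    eventually_of_mem ((isOpen_target c).mem_nhds hy) fun z hz => (Φ c).right_inv hz
  rw [h2.mfderiv_eq, mfderiv_id] at h1
  exact h1.symm

lemma symmD_chg {c c' : M} {y : Model n} (hy : y ∈ ovl n c c') :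
    symmD n c y = (symmD n c' (chg n c c' y)).comp (fderiv ℝ (chg n c c') y) := by
  have h1 : MDifferentiableAt 𝓘(ℝ, Model n) 𝓘(ℝ, Model n) (chg n c c') y :=
    (((contDiffOn_chg c c').contDiffAt ((isOpen_ovl c c').mem_nhds hy)).differentiableAt
      (by simp)).mdifferentiableAt
  have h2 := mfderiv_comp (I'' := 𝓡 n) y (mdifferentiableAt_symm (chg_mem hy).1) h1
  have h3 : ((Φ c').symm ∘ chg n c c' : Model n → M) =ᶠ[𝓝 y] (Φ c).symm :=
    eventually_of_mem ((isOpen_ovl c c').mem_nhds hy) fun z hz => symm_chg hz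
  rw [h3.mfderiv_eq, mfderiv_eq_fderiv] at h2
  exact h2

/-- The inner product `g` on the tangent space at `p`, as a bilinear form on the model space. -/
def mform (g : Metric n M) (p : M) : Model n →L[ℝ] Model n →L[ℝ] ℝ := g.inner p

lemma gMat_apply (g : Metric n M) (c : M) (y : Model n) (i j : Fin n) :
    gMat g c y i j = mform g ((Φ c).symm y) (symmD n c y (EuclideanSpace.single i 1))
      (symmD n c y (EuclideanSpace.single j 1)) := rfl

lemma mform_symm (g : Metric n M) (p : M) (v w : Model n) : mform g p v w = mform g p w v :=
  g.symm p v w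

lemma mform_pos (g : Metric n M) (p : M) {v : Model n} (hv : v ≠ 0) : 0 < mform g p v v :=
  g.pos p v hv

lemma eq_sum_single (v : Model n) : v = ∑ i, v i • EuclideanSpace.single i (1 : ℝ) := by
  ext j; simp [Finset.sum_apply, Pi.single_apply]

/-- The metric in the coordinates of the chart around `c`. -/
lemma mform_symmD (g : Metric n M) (c : M) (y : Model n) (v w : Model n) :
    mform g ((Φ c).symm y) (symmD n c y v) (symmD n c y w)
      = ∑ i, ∑ j, gMat g c y i j * v i * w j := by
  conv_lhs => rw [eq_sum_single v, eq_sum_single w]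
  simp only [map_sum, map_smul, _root_.sum_apply, _root_.smul_apply, smul_eq_mul, gMat_apply]
  simp only [Finset.mul_sum]
  rw [Finset.sum_comm]
  exact Finset.sum_congr rfl fun i _ => Finset.sum_congr rfl fun j _ => by ring

lemma gMat_posDef (g : Metric n M) {c : M} {y : Model n} (hy : y ∈ (Φ c).target) :
    (gMat g c y).PosDef := by
  refine Matrix.PosDef.of_dotProduct_mulVec_pos ?_ fun v hv => ?_
  · exact Matrix.IsHermitian.ext fun i j => mform_symm g _ _ _
  · have h1 := mform_symmD g c y (WithLp.toLp 2 v) (WithLp.toLp 2 v)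
    have h2 : symmD n c y (WithLp.toLp 2 v) ≠ 0 := by
      intro h0
      have := DFunLike.congr_fun (chartD_comp_symmD hy) (WithLp.toLp 2 v)
      rw [ContinuousLinearMap.comp_apply, h0, map_zero] at this
      exact hv (by simpa using this.symm)
    have h3 := mform_pos g ((Φ c).symm y) h2
    rw [h1] at h3
    refine h3.trans_eq ?_
    simp only [dotProduct, Matrix.mulVec, Finset.mul_sum]
    exact Finset.sum_congr rfl fun i _ => Finset.sum_congr rfl fun j _ => by simp; ring

lemma gMat_chg (g : Metric n M) {c c' : M} {y : Model n} (hy : y ∈ ovl n c c') :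
    gMat g c y = (jac n c c' y).transpose * gMat g c' (chg n c c' y) * jac n c c' y := by
  ext i j
  rw [gMat_apply, symmD_chg hy, ← symm_chg hy, ContinuousLinearMap.comp_apply,
    ContinuousLinearMap.comp_apply, mform_symmD]
  simp only [Matrix.mul_apply, Matrix.transpose_apply, jac, Matrix.of_apply, Finset.sum_mul]
  rw [Finset.sum_comm]
  exact Finset.sum_congr rfl fun k _ => Finset.sum_congr rfl fun l _ => by ring

lemma jac_det_ne (g : Metric n M) {c c' : M} {y : Model n} (hy : y ∈ ovl n c c') :
    (jac n c c' y).det ≠ 0 := by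
  intro h0
  have := (gMat_posDef g hy.1).det_pos
  rw [gMat_chg g hy, Matrix.det_mul, h0, mul_zero] at this
  exact lt_irrefl _ this

lemma sqrt_det_chg (g : Metric n M) {c c' : M} {y : Model n} (hy : y ∈ ovl n c c') :
    Real.sqrt (gMat g c y).det
      = |(jac n c c' y).det| * Real.sqrt (gMat g c' (chg n c c' y)).det := by
  rw [gMat_chg g hy, Matrix.det_mul, Matrix.det_mul, Matrix.det_transpose,
    mul_right_comm, Real.sqrt_mul (mul_self_nonneg _), Real.sqrt_mul_self_eq_abs]

end Charts

section Functions

variable {n : ℕ} {M : Type*} [TopologicalSpace M] [ChartedSpace (Model n) M]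

local notation "Φ" => extChartAt (𝓡 n)

/-! ### Smooth functions and their gradients -/

variable (n) in
/-- Smooth functions on `M`, through their expressions in the preferred charts. -/
def SM (u : M → ℝ) : Prop := ∀ c : M, ContDiffOn ℝ ∞ (localRep (n := n) u c) (Φ c).target

namespace SM

variable {u v : M → ℝ}

lemma sub (hu : SM n u) (hv : SM n v) : SM n (fun x => u x - v x) := fun c => (hu c).sub (hv c)

lemma mul (hu : SM n u) (hv : SM n v) : SM n (fun x => u x * v x) := fun c => (hu c).mul (hv c)

lemma comp {φ : ℝ → ℝ} (hφ : ContDiff ℝ ∞ φ) (hu : SM n u) : SM n (fun x => φ (u x)) :=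
  fun c => hφ.comp_contDiffOn (hu c)

lemma sum {ι : Type*} {s : Finset ι} {w : ι → M → ℝ} (hw : ∀ i ∈ s, SM n (w i)) :
    SM n (fun x => ∑ i ∈ s, w i x) := fun c => ContDiffOn.sum fun i hi => hw i hi c

lemma continuous (hu : SM n u) : Continuous u := by
  refine continuous_iff_continuousAt.2 fun x => ?_
  have h1 : ContinuousAt (localRep (n := n) u x) (Φ x x) :=
    (hu x).continuousOn.continuousAt ((isOpen_target x).mem_nhds (mem_extChartAt_target x))
  have h2 : ContinuousAt (fun z => localRep (n := n) u x (Φ x z)) x :=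
    ContinuousAt.comp (f := Φ x) h1 (continuousAt_extChartAt x)
  refine h2.congr (eventually_of_mem (extChartAt_source_mem_nhds (I := 𝓡 n) x) fun z hz => ?_)
  change u ((Φ x).symm (Φ x z)) = u z
  rw [(Φ x).left_inv hz]

lemma diffAt (hu : SM n u) {c : M} {y : Model n} (hy : y ∈ (Φ c).target) :
    DifferentiableAt ℝ (localRep (n := n) u c) y := (hu c).diffAt (isOpen_target c) hy

end SM

lemma mem_tgt (x : M) : Φ x x ∈ (Φ x).target := mem_extChartAt_target x

lemma localRep_chart (u : M → ℝ) {c x : M} (hx : x ∈ (Φ c).source) :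
    localRep u c (Φ c x) = u x := by rw [localRep, (Φ c).left_inv hx]

variable [IsManifold (𝓡 n) ∞ M]

lemma SM.of_contMDiff {u : M → ℝ} (hu : ContMDiff (𝓡 n) 𝓘(ℝ, ℝ) ∞ u) : SM n u := fun c => by
  have := hu.comp_contMDiffOn (contMDiffOn_extChartAt_symm (I := 𝓡 n) (n := ∞) c)
  exact contMDiffOn_iff_contDiffOn.1 this

lemma pd_localRep_chg {u : M → ℝ} {c c' : M} {y : Model n}
    (hu : DifferentiableAt ℝ (localRep (n := n) u c') (chg n c c' y))
    (hy : y ∈ ovl n c c') (i : Fin n) :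
    pd i (localRep u c) y
      = ∑ j, jac n c c' y j i * pd j (localRep u c') (chg n c c' y) := by
  have h1 : localRep u c =ᶠ[𝓝 y] localRep u c' ∘ chg n c c' :=
    eventually_of_mem ((isOpen_ovl c c').mem_nhds hy) fun z hz => by
      simp only [localRep, Function.comp, symm_chg hz]
  have h2 : DifferentiableAt ℝ (chg n c c') y :=
    ((contDiffOn_chg c c').contDiffAt ((isOpen_ovl c c').mem_nhds hy)).differentiableAt (by simp)
  rw [pd_congr h1, pd, fderiv_comp y hu h2, ContinuousLinearMap.comp_apply,
    eq_sum_single (fderiv ℝ (chg n c c') y (EuclideanSpace.single i 1))]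
  simp [pd, jac]

/-- The components of the metric are smooth functions of the coordinates. -/
def SmoothMetric (g : Metric n M) : Prop :=
  ∀ (c : M) (i j : Fin n), ContDiffOn ℝ ∞ (fun y => gMat g c y i j) (Φ c).target

variable {g : Metric n M}

lemma SmoothMetric.isMetricOn (hg : SmoothMetric g) (c : M) :
    IsMetricOn (gMat g c) (Φ c).target :=
  ⟨isOpen_target c, hg c, fun _ hy => gMat_posDef g hy⟩

/-- The inner product `⟨∇u, ∇v⟩`. -/
def inn (g : Metric n M) (u v : M → ℝ) (x : M) : ℝ :=
  innE (gMat g x) (localRep u x) (localRep v x) (Φ x x)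

lemma gradSq_eq (g : Metric n M) (u : M → ℝ) (x : M) : gradSq g u x = inn g u u x := rfl

lemma laplacian_eq (g : Metric n M) (u : M → ℝ) (x : M) :
    laplacian g u x = lapE (gMat g x) (localRep u x) (Φ x x) := rfl

lemma innE_chg {u v : M → ℝ} {c c' : M} {y : Model n} (hy : y ∈ ovl n c c')
    (hu : DifferentiableAt ℝ (localRep (n := n) u c') (chg n c c' y))
    (hv : DifferentiableAt ℝ (localRep (n := n) v c') (chg n c c' y)) :
    innE (gMat g c) (localRep u c) (localRep v c) y
      = innE (gMat g c') (localRep u c') (localRep v c') (chg n c c' y) := by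
  set J := jac n c c' y with hJ
  set G' := gMat g c' (chg n c c' y) with hG'
  have hJu : IsUnit J.det := (jac_det_ne g hy).isUnit
  set p : Fin n → ℝ := fun j => pd j (localRep u c') (chg n c c' y) with hp
  set q : Fin n → ℝ := fun j => pd j (localRep v c') (chg n c c' y) with hq
  have e1 : (fun i => pd i (localRep u c) y) = J.transpose.mulVec p := by
    funext i; rw [pd_localRep_chg hu hy]; rfl
  have e2 : (fun i => pd i (localRep v c) y) = J.transpose.mulVec q := by
    funext i; rw [pd_localRep_chg hv hy]; rfl
  have e3 : ∀ (A : Matrix (Fin n) (Fin n) ℝ) (a b : Fin n → ℝ),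
      ∑ i, ∑ j, A i j * a i * b j = a ⬝ᵥ A.mulVec b := by
    intro A a b
    simp only [dotProduct, Matrix.mulVec, Finset.mul_sum]
    exact Finset.sum_congr rfl fun i _ => Finset.sum_congr rfl fun j _ => by ring
  have e4 : innE (gMat g c) (localRep u c) (localRep v c) y
      = (J.transpose.mulVec p) ⬝ᵥ ((gMat g c y)⁻¹).mulVec (J.transpose.mulVec q) := by
    rw [← e1, ← e2, ← e3]; rfl
  have e5 : innE (gMat g c') (localRep u c') (localRep v c') (chg n c c' y)
      = p ⬝ᵥ (G'⁻¹).mulVec q := by rw [← e3]; rfl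
  rw [e4, e5, gMat_chg g hy, Matrix.mul_inv_rev, Matrix.mul_inv_rev, Matrix.mulVec_transpose,
    ← Matrix.dotProduct_mulVec, Matrix.mulVec_mulVec, Matrix.mulVec_mulVec, ← Matrix.mul_assoc,
    ← Matrix.mul_assoc, Matrix.mul_nonsing_inv _ hJu, Matrix.one_mul, Matrix.mul_assoc,
    Matrix.nonsing_inv_mul _ (by rwa [Matrix.det_transpose]), Matrix.mul_one]

/-- `⟨∇u, ∇v⟩` can be computed in any chart. -/
lemma inn_chart {u v : M → ℝ} (hu : SM n u) (hv : SM n v) {c x : M} (hx : x ∈ (Φ c).source) :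
    inn g u v x = innE (gMat g c) (localRep u c) (localRep v c) (Φ c x) := by
  have hy : Φ c x ∈ ovl n c x := chart_mem_ovl hx (mem_extChartAt_source x)
  rw [innE_chg hy (hu.diffAt (chg_mem hy).1) (hv.diffAt (chg_mem hy).1), chg_chart x hx]
  rfl

lemma localRep_inn {u v : M → ℝ} (hu : SM n u) (hv : SM n v) {c : M} {y : Model n}
    (hy : y ∈ (Φ c).target) :
    localRep (inn g u v) c y = innE (gMat g c) (localRep u c) (localRep v c) y := by
  rw [localRep, inn_chart hu hv ((Φ c).map_target hy), (Φ c).right_inv hy]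

lemma SM.inn (hg : SmoothMetric g) {u v : M → ℝ} (hu : SM n u) (hv : SM n v) :
    SM n (inn g u v) := fun c =>
  ((hg.isMetricOn c).smooth_innE (hu c) (hv c)).congr fun _ hy => localRep_inn hu hv hy

section Algebra

variable {u v w : M → ℝ} {x : M}

lemma inn_comm (hg : SmoothMetric g) : inn g u v x = inn g v u x :=
  (hg.isMetricOn x).innE_comm (mem_tgt x)

lemma inn_self_nonneg (hg : SmoothMetric g) : 0 ≤ inn g u u x :=
  (hg.isMetricOn x).innE_self_nonneg (mem_tgt x)

lemma inn_sq_le (hg : SmoothMetric g) : inn g u v x ^ 2 ≤ inn g u u x * inn g v v x :=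
  (hg.isMetricOn x).innE_sq_le (mem_tgt x)

lemma inn_mul_right_of_differentiableAt
    (hu : DifferentiableAt ℝ (localRep (n := n) u x) (Φ x x))
    (hv : DifferentiableAt ℝ (localRep (n := n) v x) (Φ x x)) :
    inn g w (fun z => u z * v z) x = u x * inn g w v x + v x * inn g w u x := by
  have h : ∀ i, pd i (localRep (n := n) (fun z => u z * v z) x) (Φ x x)
      = pd i (localRep u x) (Φ x x) * v x + u x * pd i (localRep v x) (Φ x x) := fun i => by
    rw [← localRep_chart (n := n) u (mem_extChartAt_source x),
      ← localRep_chart (n := n) v (mem_extChartAt_source x)]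
    exact pd_mul hu hv
  simp only [inn, innE, h, Finset.mul_sum, ← Finset.sum_add_distrib]
  exact Finset.sum_congr rfl fun i _ => Finset.sum_congr rfl fun j _ => by ring

lemma inn_mul_right (hu : SM n u) (hv : SM n v) :
    inn g w (fun z => u z * v z) x = u x * inn g w v x + v x * inn g w u x :=
  inn_mul_right_of_differentiableAt (hu.diffAt (mem_tgt x)) (hv.diffAt (mem_tgt x))

lemma inn_comp_right {φ : ℝ → ℝ} {φ' : ℝ} (hφ : HasDerivAt φ φ' (u x)) (hu : SM n u) :
    inn g w (fun z => φ (u z)) x = φ' * inn g w u x := by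
  have h : ∀ i, pd i (localRep (n := n) (fun z => φ (u z)) x) (Φ x x)
      = φ' * pd i (localRep u x) (Φ x x) := fun i => by
    rw [← localRep_chart (n := n) u (mem_extChartAt_source x)] at hφ
    exact pd_comp hφ (hu.diffAt (mem_tgt x))
  simp only [inn, innE, h, Finset.mul_sum]
  exact Finset.sum_congr rfl fun i _ => Finset.sum_congr rfl fun j _ => by ring

lemma inn_congr_right {v' : M → ℝ} (h : v =ᶠ[𝓝 x] v') : inn g w v x = inn g w v' x := by
  have h1 : localRep (n := n) v x =ᶠ[𝓝 (Φ x x)] localRep v' x := by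
    have := (continuousAt_extChartAt_symm (I := 𝓡 n) x).eventually
      (by rwa [extChartAt_to_inv])
    exact this
  have h' : ∀ i, pd i (localRep (n := n) v x) (Φ x x) = pd i (localRep v' x) (Φ x x) := fun i =>
    pd_congr h1
  simp only [inn, innE, h']

lemma inn_const_right (r : ℝ) : inn g w (fun _ => r) x = 0 := by
  have h : ∀ i, pd i (localRep (n := n) (fun _ : M => r) x) (Φ x x) = 0 := fun i => pd_const r
  simp only [inn, innE, h, mul_zero, Finset.sum_const_zero]

end Algebra

end Functions

section Volume

variable {n : ℕ} {M : Type*} [TopologicalSpace M] [ChartedSpace (Model n) M]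
  [IsManifold (𝓡 n) ∞ M] [MeasurableSpace M] [BorelSpace M] {g : Metric n M}

local notation "Φ" => extChartAt (𝓡 n)

/-! ### The Riemannian volume -/

omit [IsManifold (𝓡 n) ∞ M] in
lemma aemeasurable_symm (c : M) :
    AEMeasurable (Φ c).symm (volume.restrict (Φ c).target) :=
  (continuousOn_extChartAt_symm c).aemeasurable (isOpen_target c).measurableSet

omit [IsManifold (𝓡 n) ∞ M] in
lemma measurableSet_symm_preimage (c : M) {A : Set M} (hA : MeasurableSet A) :
    MeasurableSet ((Φ c).target ∩ (Φ c).symm ⁻¹' A) := by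
  have h1 : Measurable ((Φ c).target.domRestrict (Φ c).symm) :=
    (continuousOn_iff_continuous_domRestrict.1 (continuousOn_extChartAt_symm c)).measurable
  have h2 := (isOpen_target c).measurableSet.subtype_image (h1 hA)
  convert h2 using 1
  ext y
  constructor
  · rintro ⟨hy, hy'⟩
    exact ⟨⟨y, hy⟩, hy', rfl⟩
  · rintro ⟨⟨z, hz⟩, hz', rfl⟩
    exact ⟨hz, hz'⟩

omit [MeasurableSpace M] [BorelSpace M] in
lemma aemeasurable_density (hg : SmoothMetric g) (c : M) :
    AEMeasurable (fun y => ENNReal.ofReal (Real.sqrt (gMat g c y).det))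
      (volume.restrict (Φ c).target) :=
  ((hg.isMetricOn c).smooth_sqrt_det.continuousOn.aemeasurable
    (isOpen_target c).measurableSet).ennreal_ofReal

lemma chartVolume_apply (g : Metric n M) (c : M) {A : Set M} (hA : MeasurableSet A) :
    chartVolume g c A = ∫⁻ y in (Φ c).target ∩ (Φ c).symm ⁻¹' A,
      ENNReal.ofReal (Real.sqrt (gMat g c y).det) := by
  have h1 : AEMeasurable (Φ c).symm ((volume.restrict (Φ c).target).withDensity
      fun y => ENNReal.ofReal (Real.sqrt (gMat g c y).det)) :=
    (aemeasurable_symm c).mono_ac (withDensity_absolutelyContinuous _ _)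
  have h2 : (Φ c).symm ⁻¹' A ∩ (Φ c).target = (Φ c).target ∩ (Φ c).symm ⁻¹' A := inter_comm _ _
  rw [chartVolume, Measure.map_apply_of_aemeasurable h1 hA]
  have h3 : NullMeasurableSet ((Φ c).symm ⁻¹' A) (volume.restrict (Φ c).target) :=
    (aemeasurable_symm c).nullMeasurableSet_preimage hA
  rw [withDensity_apply₀ _ h3, Measure.restrict_restrict₀ h3, h2]

lemma chartVolume_inter_source (g : Metric n M) (c : M) {A : Set M} (hA : MeasurableSet A) :
    chartVolume g c (A ∩ (Φ c).source) = chartVolume g c A := by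
  rw [chartVolume_apply g c hA, chartVolume_apply g c (hA.inter (isOpen_source c).measurableSet)]
  congr 2
  ext y
  simp only [mem_inter_iff, mem_preimage]
  exact ⟨fun h => ⟨h.1, h.2.1⟩, fun h => ⟨h.1, h.2, (Φ c).map_target h.1⟩⟩

/-- The chart volumes agree on the overlaps of the charts. -/
lemma chartVolume_eq (g : Metric n M) (c c' : M) {A : Set M} (hA : MeasurableSet A)
    (hc : A ⊆ (Φ c).source) (hc' : A ⊆ (Φ c').source) :
    chartVolume g c A = chartVolume g c' A := by
  rw [chartVolume_apply g c hA, chartVolume_apply g c' hA]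
  have hsub : (Φ c).target ∩ (Φ c).symm ⁻¹' A ⊆ ovl n c c' := fun y hy => ⟨hy.1, hc' hy.2⟩
  have himg : (Φ c').target ∩ (Φ c').symm ⁻¹' A
      = chg n c c' '' ((Φ c).target ∩ (Φ c).symm ⁻¹' A) := by
    ext y; constructor
    · intro hy
      have hy' : y ∈ ovl n c' c := ⟨hy.1, hc hy.2⟩
      refine ⟨chg n c' c y, ⟨(chg_mem hy').1, ?_⟩, chg_chg hy'⟩
      rw [mem_preimage, symm_chg hy']; exact hy.2
    · rintro ⟨z, hz, rfl⟩
      refine ⟨(chg_mem (hsub hz)).1, ?_⟩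
      rw [mem_preimage, symm_chg (hsub hz)]; exact hz.2
  rw [himg, lintegral_image_eq_lintegral_abs_det_fderiv_mul volume
    (measurableSet_symm_preimage c hA) (f' := fderiv ℝ (chg n c c'))]
  · refine setLIntegral_congr_fun (measurableSet_symm_preimage c hA) fun y hy => ?_
    rw [sqrt_det_chg g (hsub hy), ENNReal.ofReal_mul (abs_nonneg _), det_fderiv_chg]
  · intro y hy
    exact (((contDiffOn_chg c c').contDiffAt
      ((isOpen_ovl c c').mem_nhds (hsub hy))).differentiableAt
        (by simp)).hasFDerivAt.hasFDerivWithinAt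
  · intro y hy z hz h
    rw [← chg_chg (hsub hy), ← chg_chg (hsub hz), h]

variable [SecondCountableTopology M]

/-- The volume restricts to the chart volume on each chart domain. -/
lemma vol_apply (g : Metric n M) (c : M) {A : Set M} (hA : MeasurableSet A)
    (hc : A ⊆ (Φ c).source) : vol g A = chartVolume g c A := by
  obtain ⟨S, hS, hcov⟩ := TopologicalSpace.countable_cover_nhds
    (fun x : M => extChartAt_source_mem_nhds (I := 𝓡 n) x)
  have hne : S.Nonempty := by
    by_contra h
    rw [not_nonempty_iff_eq_empty] at h
    simp only [h, mem_empty_iff_false, iUnion_of_empty, iUnion_empty] at hcov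
    exact (hcov ▸ mem_univ c : c ∈ (∅ : Set M))
  obtain ⟨e, rfl⟩ := hS.exists_eq_range hne
  set D : ℕ → Set M := disjointed fun k => (Φ (e k)).source with hD
  have hDm : ∀ k, MeasurableSet (D k) :=
    MeasurableSet.disjointed fun k => (isOpen_source (e k)).measurableSet
  have hDs : ∀ k, D k ⊆ (Φ (e k)).source := fun k => disjointed_subset _ k
  have hDu : ⋃ k, D k = univ := by rw [hD, iUnion_disjointed, ← hcov, biUnion_range]
  have hDd : Pairwise (Function.onFun Disjoint D) := disjoint_disjointed _
  set μ : Measure M := Measure.sum fun k => (chartVolume g (e k)).restrict (D k) with hμ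
  have hμ_apply : ∀ {B : Set M}, MeasurableSet B → μ B = ∑' k, chartVolume g (e k) (B ∩ D k) :=
    fun hB => by
      rw [hμ, Measure.sum_apply _ hB]
      exact tsum_congr fun k => Measure.restrict_apply hB
  have hsplit : ∀ c' {B : Set M}, MeasurableSet B →
      chartVolume g c' B = ∑' k, chartVolume g (e k) (B ∩ D k ∩ (Φ c').source) := by
    intro c' B hB
    have h1 : B = ⋃ k, B ∩ D k := by rw [← inter_iUnion, hDu, inter_univ]
    conv_lhs => rw [h1]
    rw [measure_iUnion (fun i j hij => (hDd hij).mono inter_subset_right inter_subset_right)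
      fun k => hB.inter (hDm k)]
    refine tsum_congr fun k => ?_
    rw [← chartVolume_inter_source g c' (hB.inter (hDm k))]
    exact chartVolume_eq g c' (e k) ((hB.inter (hDm k)).inter (isOpen_source c').measurableSet)
      inter_subset_right ((inter_subset_left.trans inter_subset_right).trans (hDs k))
  have hle : ∀ c', chartVolume g c' ≤ μ := fun c' => Measure.le_iff.2 fun B hB => by
    rw [hsplit c' hB, hμ_apply hB]
    exact ENNReal.tsum_le_tsum fun k => measure_mono inter_subset_left
  refine le_antisymm ?_ ((le_iSup (chartVolume g) c : chartVolume g c ≤ vol g) A)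
  calc vol g A ≤ μ A := (iSup_le hle : vol g ≤ μ) A
    _ = chartVolume g c A := by
      rw [hμ_apply hA, hsplit c hA]
      refine tsum_congr fun k => ?_
      rw [inter_eq_left.2 (inter_subset_left.trans hc)]

lemma vol_restrict (g : Metric n M) (c : M) :
    (vol g).restrict (Φ c).source = chartVolume g c := by
  ext A hA
  rw [Measure.restrict_apply hA,
    vol_apply g c (hA.inter (isOpen_source c).measurableSet) inter_subset_right,
    chartVolume_inter_source g c hA]

/-- Integrals over a chart domain. -/
lemma setIntegral_vol (hg : SmoothMetric g) (c : M) {h : M → ℝ}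
    (hh : AEStronglyMeasurable h ((vol g).restrict (Φ c).source)) :
    ∫ x in (Φ c).source, h x ∂(vol g)
      = ∫ y in (Φ c).target, Real.sqrt (gMat g c y).det * h ((Φ c).symm y) := by
  rw [vol_restrict] at hh ⊢
  rw [chartVolume, integral_map
    ((aemeasurable_symm c).mono_ac (withDensity_absolutelyContinuous _ _))
    hh, integral_withDensity_eq_integral_toReal_smul₀
      (aemeasurable_density hg c) (by simp)]
  simp only [smul_eq_mul, ENNReal.toReal_ofReal (Real.sqrt_nonneg _)]

lemma isLocallyFinite_vol (hg : SmoothMetric g) : IsLocallyFiniteMeasure (vol g) := by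
  refine ⟨fun x => ?_⟩
  have hK := (hg.isMetricOn x).smooth_sqrt_det.continuousOn.continuousAt
    ((isOpen_target x).mem_nhds (mem_tgt x))
  obtain ⟨ε, hε, hball⟩ : ∃ ε > 0, ∀ y ∈ _root_.Metric.ball (Φ x x) ε, y ∈ (Φ x).target ∧
      Real.sqrt (gMat g x y).det < Real.sqrt (gMat g x (Φ x x)).det + 1 := by
    have h1 := (hK.eventually (gt_mem_nhds (lt_add_one _))).and
      ((isOpen_target x).mem_nhds (mem_tgt x))
    obtain ⟨ε, hε, h⟩ := _root_.Metric.eventually_nhds_iff_ball.1 h1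
    exact ⟨ε, hε, fun y hy => ⟨(h y hy).2, (h y hy).1⟩⟩
  set s : Set M := (Φ x).source ∩ Φ x ⁻¹' _root_.Metric.ball (Φ x x) ε with hs
  have hso : IsOpen s := (continuousOn_extChartAt x).isOpen_inter_preimage (isOpen_source x)
    _root_.Metric.isOpen_ball
  refine ⟨s, hso.mem_nhds ⟨mem_extChartAt_source x, _root_.Metric.mem_ball_self hε⟩, ?_⟩
  rw [vol_apply g x hso.measurableSet inter_subset_left, chartVolume_apply g x hso.measurableSet]
  have hsub : (Φ x).target ∩ (Φ x).symm ⁻¹' s ⊆ _root_.Metric.ball (Φ x x) ε := by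
    rintro y ⟨hy, hy'⟩
    have := hy'.2
    rwa [mem_preimage, (Φ x).right_inv hy] at this
  calc _ ≤ ∫⁻ y in _root_.Metric.ball (Φ x x) ε, ENNReal.ofReal (Real.sqrt (gMat g x y).det) :=
        lintegral_mono_set hsub
    _ ≤ ∫⁻ y in _root_.Metric.ball (Φ x x) ε,
        ENNReal.ofReal (Real.sqrt (gMat g x (Φ x x)).det + 1) :=
      setLIntegral_mono measurable_const fun y hy => ENNReal.ofReal_le_ofReal (hball y hy).2.le
    _ < ⊤ := by
      rw [setLIntegral_const]
      exact ENNReal.mul_lt_top ENNReal.ofReal_lt_top measure_ball_lt_top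

lemma isOpenPos_vol (hg : SmoothMetric g) : Measure.IsOpenPosMeasure (vol g) := by
  refine ⟨fun s hs hne h0 => ?_⟩
  obtain ⟨x, hx⟩ := hne
  have hso : IsOpen (s ∩ (Φ x).source) := hs.inter (isOpen_source x)
  have h1 : vol g (s ∩ (Φ x).source) = 0 := measure_mono_null inter_subset_left h0
  have hopen : IsOpen ((Φ x).target ∩ (Φ x).symm ⁻¹' (s ∩ (Φ x).source)) :=
    (continuousOn_extChartAt_symm x).isOpen_inter_preimage (isOpen_target x) hso
  rw [vol_apply g x hso.measurableSet inter_subset_right, chartVolume_apply g x hso.measurableSet,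
    lintegral_eq_zero_iff' ((aemeasurable_density hg x).mono_measure
      (Measure.restrict_mono inter_subset_left le_rfl)),
    EventuallyEq, ae_restrict_iff' hopen.measurableSet] at h1
  have h2 : volume ((Φ x).target ∩ (Φ x).symm ⁻¹' (s ∩ (Φ x).source)) = 0 := by
    refine measure_mono_null (fun y hy => ?_) (ae_iff.1 h1)
    simp only [mem_ofPred_eq, not_forall]
    refine ⟨hy, ?_⟩
    have := Real.sqrt_pos.2 ((hg.isMetricOn x).det_pos hy.1)
    simpa using this
  exact (hopen.measure_pos volume ⟨Φ x x, mem_tgt x, by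
    simpa [extChartAt_to_inv] using hx⟩).ne' h2

end Volume

/-! ### Green's formula -/

lemma integral_pd_eq_zero {n : ℕ} {W : Model n → ℝ} (hW : ContDiff ℝ ∞ W)
    (hc : HasCompactSupport W) (i : Fin n) : ∫ y, pd i W y = 0 := by
  have hd : Differentiable ℝ W := hW.differentiable (by simp)
  have h2 : Integrable (fun y => fderiv ℝ W y (EuclideanSpace.single i (1 : ℝ))) :=
    ((hW.continuous_fderiv (by simp)).clm_apply continuous_const).integrable_of_hasCompactSupport
      ((hc.fderiv (𝕜 := ℝ)).comp_left (g := fun L : Model n →L[ℝ] ℝ =>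
        L (EuclideanSpace.single i (1 : ℝ))) rfl)
  have h := integral_mul_fderiv_eq_neg_fderiv_mul_of_integrable (μ := volume)
    (v := EuclideanSpace.single i (1 : ℝ)) (f := fun _ : Model n => (1 : ℝ)) (g := W)
    (by simp) (by simpa using h2)
    (by simpa using hW.continuous.integrable_of_hasCompactSupport hc)
    (fun _ _ => differentiableAt_const _) (fun x _ => hd x)
  simpa [pd] using h

/-- Green's formula for a metric on an open subset of `ℝⁿ`, for a function `p` that vanishes
outside a compact subset. -/
lemma IsMetricOn.green {n : ℕ} {G : Model n → Matrix (Fin n) (Fin n) ℝ} {U K : Set (Model n)}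
    (h : IsMetricOn G U) {p u : Model n → ℝ} (hp : ContDiffOn ℝ ∞ p U) (hu : ContDiffOn ℝ ∞ u U)
    (hK : IsCompact K) (hKU : K ⊆ U) (hpK : ∀ y ∈ U, y ∉ K → p y = 0) :
    ∫ y in U, Real.sqrt (G y).det * (p y * lapE G u y + innE G p u y) = 0 := by
  classical
  set W : Fin n → Model n → ℝ := fun k => U.indicator
    (fun y => p y * (Real.sqrt (G y).det * gradV G u k y)) with hW
  have hWK : ∀ k y, y ∉ K → W k y = 0 := fun k y hy => by
    by_cases hyU : y ∈ U
    · simp [hW, indicator_of_mem hyU, hpK y hyU hy]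
    · simp [hW, indicator_of_notMem hyU]
  have hWs : ∀ k, ContDiff ℝ ∞ (W k) := fun k => by
    rw [contDiff_iff_contDiffAt]
    intro y
    by_cases hy : y ∈ K
    · have h1 : ContDiffAt ℝ ∞ (fun y => p y * (Real.sqrt (G y).det * gradV G u k y)) y :=
        (hp.mul (h.smooth_sqrt_det.mul (h.smooth_gradV hu k))).contDiffAt
          (h.isOpen.mem_nhds (hKU hy))
      exact h1.congr_of_eventuallyEq (eventually_of_mem (h.isOpen.mem_nhds (hKU hy)) fun z hz =>
        indicator_of_mem hz _)
    · have h1 : ContDiffAt ℝ ∞ (fun _ : Model n => (0 : ℝ)) y := contDiffAt_const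
      exact h1.congr_of_eventuallyEq (eventually_of_mem (hK.isClosed.isOpen_compl.mem_nhds hy)
        fun z hz => hWK k z hz)
  have hWc : ∀ k, HasCompactSupport (W k) := fun k => HasCompactSupport.intro hK (hWK k)
  have hint : ∀ k, Integrable (pd k (W k)) := fun k =>
    (((hWs k).continuous_fderiv (by simp)).clm_apply
      continuous_const).integrable_of_hasCompactSupport
        (((hWc k).fderiv (𝕜 := ℝ)).comp_left (g := fun L : Model n →L[ℝ] ℝ =>
          L (EuclideanSpace.single k (1 : ℝ))) rfl)
  have hzero : ∫ y, ∑ k, pd k (W k) y = 0 := by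
    rw [integral_finsetSum _ fun k _ => hint k]
    exact Finset.sum_eq_zero fun k _ => integral_pd_eq_zero (hWs k) (hWc k) k
  have hU : ∀ y ∈ U, ∑ k, pd k (W k) y
      = Real.sqrt (G y).det * (p y * lapE G u y + innE G p u y) := by
    intro y hy
    have h1 : ∀ k, pd k (W k) y = pd k p y * (Real.sqrt (G y).det * gradV G u k y)
        + p y * pd k (fun z => Real.sqrt (G z).det * gradV G u k z) y := fun k => by
      rw [pd_congr_of_eqOn h.isOpen hy fun z hz => indicator_of_mem hz _]
      exact pd_mul (hp.diffAt h.isOpen hy)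
        ((h.smooth_sqrt_det.mul (h.smooth_gradV hu k)).diffAt h.isOpen hy)
    simp only [h1, Finset.sum_add_distrib, ← Finset.mul_sum]
    rw [← h.sqrt_det_mul_lapE hu hy, innE_eq]
    have h2 : ∑ k, pd k p y * (Real.sqrt (G y).det * gradV G u k y)
        = Real.sqrt (G y).det * ∑ k, pd k p y * gradV G u k y := by
      rw [Finset.mul_sum]; exact Finset.sum_congr rfl fun k _ => by ring
    rw [h2]; ring
  rw [setIntegral_congr_fun h.isOpen.measurableSet fun y hy => (hU y hy).symm,
    setIntegral_eq_integral_of_forall_compl_eq_zero, hzero]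
  intro y hy
  have hyK : y ∉ K := fun h' => hy (hKU h')
  refine Finset.sum_eq_zero fun k _ => ?_
  rw [pd_congr (G := fun _ => 0) (eventually_of_mem (hK.isClosed.isOpen_compl.mem_nhds hyK)
    fun z hz => hWK k z hz), pd_const]

section Manifold

variable {n : ℕ} {M : Type*} [TopologicalSpace M] [ChartedSpace (Model n) M]

local notation "Φ" => extChartAt (𝓡 n)

variable [IsManifold (𝓡 n) ∞ M] {g : Metric n M} {u p : M → ℝ}

/-- The Laplacian, computed in the chart around `c`. -/
def lapC (g : Metric n M) (c : M) (u : M → ℝ) (x : M) : ℝ :=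
  lapE (gMat g c) (localRep u c) (Φ c x)

lemma continuousOn_lapC (hg : SmoothMetric g) (hu : SM n u) (c : M) :
    ContinuousOn (lapC g c u) (Φ c).source :=
  ((hg.isMetricOn c).smooth_lapE (hu c)).continuousOn.comp (continuousOn_extChartAt c)
    fun _ hx => (Φ c).map_source hx

lemma inn_eq_zero_of_notMem_tsupport {w : M → ℝ} {x : M} (hx : x ∉ tsupport p) :
    inn g w p x = 0 := by
  rw [inn_congr_right (v' := fun _ => 0), inn_const_right]
  exact eventually_of_mem ((isClosed_tsupport p).isOpen_compl.mem_nhds hx) fun z hz =>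
    image_eq_zero_of_notMem_tsupport hz

lemma inn_sum_right {ι : Type*} {s : Finset ι} {w : ι → M → ℝ} (hw : ∀ i ∈ s, SM n (w i))
    {x : M} : inn g u (fun z => ∑ i ∈ s, w i z) x = ∑ i ∈ s, inn g u (w i) x := by
  have h : ∀ j, pd j (localRep (n := n) (fun z => ∑ i ∈ s, w i z) x) (Φ x x)
      = ∑ i ∈ s, pd j (localRep (w i) x) (Φ x x) := fun j =>
    pd_sum fun i hi => (hw i hi).diffAt (mem_tgt x)
  simp only [inn, innE, h, Finset.mul_sum]
  rw [Finset.sum_congr rfl fun i _ => Finset.sum_comm, Finset.sum_comm]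

lemma hasCompactSupport_inn {w : M → ℝ} (hpc : HasCompactSupport p) :
    HasCompactSupport (inn g w p) :=
  hpc.mono' fun z hz => by
    by_contra h
    exact hz (inn_eq_zero_of_notMem_tsupport h)

variable [MeasurableSpace M] [BorelSpace M] [SecondCountableTopology M]

lemma green_chart (hg : SmoothMetric g) (hu : SM n u) (hp : SM n p) (hpc : HasCompactSupport p)
    {c : M} (hpsub : tsupport p ⊆ (Φ c).source) :
    ∫ x, (p x * lapC g c u x + inn g u p x) ∂(vol g) = 0 := by
  have hcont : ContinuousOn (fun x => p x * lapC g c u x + inn g u p x) (Φ c).source :=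
    (hp.continuous.continuousOn.mul (continuousOn_lapC hg hu c)).add
      (SM.inn hg hu hp).continuous.continuousOn
  rw [← setIntegral_eq_integral_of_forall_compl_eq_zero (s := (Φ c).source),
    setIntegral_vol hg c (hcont.aestronglyMeasurable (isOpen_source c).measurableSet)]
  · have hKt : Φ c '' tsupport p ⊆ (Φ c).target := by
      rintro _ ⟨x, hx, rfl⟩; exact (Φ c).map_source (hpsub hx)
    rw [← (hg.isMetricOn c).green (hp c) (hu c)
      (hpc.isCompact.image_of_continuousOn ((continuousOn_extChartAt c).mono hpsub)) hKt]
    · refine setIntegral_congr_fun (isOpen_target c).measurableSet fun y hy => ?_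
      have h1 : localRep (inn g p u) c y = _ := localRep_inn hp hu hy
      simp only [localRep] at h1
      simp only [lapC, (Φ c).right_inv hy]
      rw [inn_comm hg, h1]; rfl
    · intro y hy hyK
      exact image_eq_zero_of_notMem_tsupport (f := p) fun hmem =>
        hyK ⟨_, hmem, (Φ c).right_inv hy⟩
  · intro x hx
    have hx' : x ∉ tsupport p := fun h => hx (hpsub h)
    rw [image_eq_zero_of_notMem_tsupport hx', inn_eq_zero_of_notMem_tsupport hx', zero_mul,
      zero_add]

omit [MeasurableSpace M] [BorelSpace M] [SecondCountableTopology M] in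
lemma continuous_mul_of_tsupport {p F : M → ℝ} {s : Set M} (hp : Continuous p) (hs : IsOpen s)
    (hsub : tsupport p ⊆ s) (hF : ContinuousOn F s) : Continuous fun x => p x * F x := by
  refine continuous_iff_continuousAt.2 fun x => ?_
  by_cases hx : x ∈ tsupport p
  · exact hp.continuousAt.mul (hF.continuousAt (hs.mem_nhds (hsub hx)))
  · refine continuousAt_const.congr (f := fun _ => (0 : ℝ))
      (eventually_of_mem ((isClosed_tsupport p).isOpen_compl.mem_nhds hx) fun z hz => ?_)
    simp only [image_eq_zero_of_notMem_tsupport hz, zero_mul]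

variable [T2Space M]

/-- The Laplacian does not depend on the chart, since it is determined by Green's formula. -/
lemma lapC_eq (hg : SmoothMetric g) (hu : SM n u) {c c' x : M} (hx : x ∈ (Φ c).source)
    (hx' : x ∈ (Φ c').source) : lapC g c u x = lapC g c' u x := by
  have := isLocallyFinite_vol hg
  have := isOpenPos_vol hg
  suffices key : ∀ c c' : M, x ∈ (Φ c).source → x ∈ (Φ c').source →
      ¬ lapC g c' u x < lapC g c u x from
    le_antisymm (not_lt.1 (key c c' hx hx')) (not_lt.1 (key c' c hx' hx))
  intro c c' hx hx' hlt
  set O := (Φ c).source ∩ (Φ c').source with hO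
  have hOo : IsOpen O := (isOpen_source c).inter (isOpen_source c')
  have hc1 := (continuousOn_lapC hg hu c).mono (inter_subset_left : O ⊆ _)
  have hc2 := (continuousOn_lapC hg hu c').mono (inter_subset_right : O ⊆ _)
  have hnhds : {z | z ∈ O ∧ lapC g c' u z < lapC g c u z} ∈ 𝓝 x := by
    have hxO : O ∈ 𝓝 x := hOo.mem_nhds ⟨hx, hx'⟩
    filter_upwards [hxO, (hc2.continuousAt hxO).eventually_lt (hc1.continuousAt hxO) hlt]
      with z hz hz' using ⟨hz, hz'⟩
  -- a bump function where the strict inequality holds gives two different values of `-∫ ⟨∇u, ∇ρ⟩`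
  obtain ⟨ρ, -, hρ⟩ := (SmoothBumpFunction.nhds_basis_tsupport (I := 𝓡 n) x).mem_iff.1 hnhds
  have hp : SM n (ρ : M → ℝ) := SM.of_contMDiff ρ.contMDiff
  have hpc : HasCompactSupport (ρ : M → ℝ) := ρ.hasCompactSupport
  have hsO : tsupport (ρ : M → ℝ) ⊆ O := fun z hz => (hρ hz).1
  have k1 : Continuous fun z => ρ z * lapC g c u z :=
    continuous_mul_of_tsupport hp.continuous hOo hsO hc1
  have k2 : Continuous fun z => ρ z * lapC g c' u z :=
    continuous_mul_of_tsupport hp.continuous hOo hsO hc2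
  have i1 := k1.integrable_of_hasCompactSupport (μ := vol g) hpc.mul_right
  have i2 := k2.integrable_of_hasCompactSupport (μ := vol g) hpc.mul_right
  have i3 : Integrable (fun z => inn g u ρ z) (vol g) :=
    (SM.inn hg hu hp).continuous.integrable_of_hasCompactSupport (hasCompactSupport_inn hpc)
  have g1 := green_chart hg hu hp hpc (c := c) (hsO.trans inter_subset_left)
  have g2 := green_chart hg hu hp hpc (c := c') (hsO.trans inter_subset_right)
  rw [integral_add i1 i3] at g1
  rw [integral_add i2 i3] at g2
  have hpos : 0 < ∫ z, (ρ z * lapC g c u z - ρ z * lapC g c' u z) ∂(vol g) := by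
    refine (k1.sub k2).integral_pos_of_hasCompactSupport_nonneg_nonzero (hpc.mul_right.sub
      hpc.mul_right) (fun z => ?_) (x := x) ?_
    · by_cases hz : z ∈ tsupport (ρ : M → ℝ)
      · have := (hρ hz).2.le
        have h0 := ρ.nonneg (x := z)
        simp only [Pi.zero_apply, sub_nonneg]
        exact mul_le_mul_of_nonneg_left this h0
      · simp [image_eq_zero_of_notMem_tsupport hz]
    · simp only [ρ.eq_one, one_mul]
      exact (sub_pos.2 hlt).ne'
  rw [integral_sub i1 i2] at hpos
  linarith

lemma laplacian_chart (hg : SmoothMetric g) (hu : SM n u) {c x : M} (hx : x ∈ (Φ c).source) :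
    laplacian g u x = lapC g c u x :=
  lapC_eq (c := x) hg hu (mem_extChartAt_source x) hx

lemma localRep_laplacian (hg : SmoothMetric g) (hu : SM n u) {c : M} {y : Model n}
    (hy : y ∈ (Φ c).target) :
    localRep (laplacian g u) c y = lapE (gMat g c) (localRep u c) y := by
  rw [localRep, laplacian_chart hg hu ((Φ c).map_target hy), lapC, (Φ c).right_inv hy]

lemma SM.laplacian (hg : SmoothMetric g) (hu : SM n u) : SM n (laplacian g u) := fun c =>
  ((hg.isMetricOn c).smooth_lapE (hu c)).congr fun _ hy => localRep_laplacian hg hu hy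

omit [MeasurableSpace M] [BorelSpace M] in
/-- A compactly supported smooth function is a finite sum of smooth functions with compact supports
in chart domains. -/
lemma exists_decomposition (hp : SM n p) (hpc : HasCompactSupport p) :
    ∃ (F : Finset M) (w : M → M → ℝ), (∀ c, SM n (w c)) ∧ (∀ c, HasCompactSupport (w c)) ∧
      (∀ c, tsupport (w c) ⊆ (Φ c).source) ∧ p = fun x => ∑ c ∈ F, w c x := by
  have : LocallyCompactSpace M := Manifold.locallyCompact_of_finiteDimensional (𝓡 n)
  obtain ⟨χ, hχ⟩ := SmoothPartitionOfUnity.exists_isSubordinate (𝓡 n) (isClosed_tsupport p)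
    (fun c : M => (Φ c).source) (fun c => isOpen_source c)
    fun x _ => mem_iUnion.2 ⟨x, mem_extChartAt_source x⟩
  have hfin := χ.locallyFinite.finite_nonempty_inter_compact hpc.isCompact
  refine ⟨hfin.toFinset, fun c x => χ c x * p x, fun c =>
    (SM.of_contMDiff (χ c).contMDiff).mul hp, fun c => hpc.mul_left,
    fun c => (closure_mono (Function.support_mul_subset_left _ _)).trans (hχ c), ?_⟩
  funext x
  rw [← Finset.sum_mul]
  by_cases hx : x ∈ tsupport p
  · rw [χ.sum_finsupport' _ hx, one_mul]
    intro c hc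
    rw [χ.mem_finsupport] at hc
    exact hfin.mem_toFinset.2 ⟨x, hc, hx⟩
  · rw [image_eq_zero_of_notMem_tsupport hx, mul_zero]

/-- Green's formula on `M`. -/
lemma green (hg : SmoothMetric g) (hu : SM n u) (hp : SM n p) (hpc : HasCompactSupport p) :
    ∫ x, p x * laplacian g u x ∂(vol g) = -∫ x, inn g u p x ∂(vol g) := by
  have := isLocallyFinite_vol hg
  have int1 : ∀ {q : M → ℝ}, SM n q → HasCompactSupport q →
      Integrable (fun z => q z * laplacian g u z) (vol g) := fun hq hqc =>
    (hq.mul (SM.laplacian hg hu)).continuous.integrable_of_hasCompactSupport hqc.mul_right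
  have int2 : ∀ {q : M → ℝ}, SM n q → HasCompactSupport q →
      Integrable (fun z => inn g u q z) (vol g) := fun hq hqc =>
    (SM.inn hg hu hq).continuous.integrable_of_hasCompactSupport (hasCompactSupport_inn hqc)
  obtain ⟨F, w, hw, hwc, hws, hpw⟩ := exists_decomposition hp hpc
  have h1 : ∀ c ∈ F, ∫ x, w c x * laplacian g u x ∂(vol g) = -∫ x, inn g u (w c) x ∂(vol g) := by
    intro c _
    have h2 := green_chart hg hu (hw c) (hwc c) (hws c)
    rw [eq_neg_iff_add_eq_zero, ← integral_add (int1 (hw c) (hwc c)) (int2 (hw c) (hwc c)), ← h2]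
    refine integral_congr_ae (Eventually.of_forall fun x => ?_)
    simp only
    by_cases hx : x ∈ tsupport (w c)
    · rw [laplacian_chart hg hu (hws c hx)]
    · rw [image_eq_zero_of_notMem_tsupport hx, zero_mul, zero_mul]
  rw [hpw]
  simp only [inn_sum_right fun i _ => hw i, Finset.sum_mul]
  rw [integral_finsetSum _ fun c _ => int1 (hw c) (hwc c),
    integral_finsetSum _ fun c _ => int2 (hw c) (hwc c), Finset.sum_congr rfl h1,
    Finset.sum_neg_distrib]

end Manifold

section Weighted

variable {n : ℕ} {M : Type*} [TopologicalSpace M] [ChartedSpace (Model n) M]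
  [IsManifold (𝓡 n) ∞ M] {g : Metric n M} {f u v w : M → ℝ} {A : ℝ} {x : M}

local notation "Φ" => extChartAt (𝓡 n)

/-! ### Tangent vectors in coordinates -/

lemma mform_symmD_self (g : Metric n M) (x : M) (v w : Model n) :
    mform g x (symmD n x (Φ x x) v) (symmD n x (Φ x x) w)
      = ∑ i, ∑ j, gMat g x (Φ x x) i j * v i * w j := by
  have := mform_symmD g x (Φ x x) v w
  rwa [extChartAt_to_inv] at this

lemma vcomp_symmD (x : M) (v : Model n) (i : Fin n) :
    vcomp x (symmD n x (Φ x x) v : TangentSpace (𝓡 n) x) i = v i := by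
  have h := DFunLike.congr_fun (chartD_comp_symmD (mem_tgt (n := n) x)) v
  rw [extChartAt_to_inv] at h
  exact congrArg (fun z : Model n => z i) h

/-- A bound of a quadratic form by the metric, in coordinates. -/
lemma coord_bound {T : Fin n → Fin n → ℝ} {c : ℝ}
    (h : ∀ v : TangentSpace (𝓡 n) x, ∑ i, ∑ j, T i j * vcomp x v i * vcomp x v j
      ≤ c * g.inner x v v) (W : Fin n → ℝ) :
    ∑ i, ∑ j, T i j * W i * W j ≤ c * ∑ i, ∑ j, gMat g x (Φ x x) i j * W i * W j := by
  have h1 := h (symmD n x (Φ x x) (WithLp.toLp 2 W))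
  simp only [vcomp_symmD] at h1
  refine h1.trans_eq ?_
  congr 1
  exact mform_symmD_self g x _ _

/-! ### Cutoff functions and the weighted volume -/

/-- A sequence of compactly supported smooth functions with values in `[0, 1]`, that are equal to
`1` on larger and larger sets, with uniformly bounded gradients. -/
structure IsCutoff (g : Metric n M) (η : ℕ → M → ℝ) (C : ℝ) : Prop where
  smooth : ∀ k, SM n (η k)
  compact : ∀ k, HasCompactSupport (η k)
  nonneg : ∀ k x, 0 ≤ η k x
  le_one : ∀ k x, η k x ≤ 1
  eventually_one : ∀ x, ∀ᶠ k in atTop, η k =ᶠ[𝓝 x] fun _ => 1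
  grad : ∀ k x, inn g (η k) (η k) x ≤ C

/-- The weighted volume `A e^{-f} dV`. -/
def wvol [MeasurableSpace M] (g : Metric n M) (f : M → ℝ) (A : ℝ) : Measure M :=
  (vol g).withDensity fun x => ENNReal.ofReal (A * Real.exp (-f x))

/-- The drift Laplacian `Δu - ⟨∇f, ∇u⟩`. -/
def dlap (g : Metric n M) (f u : M → ℝ) (x : M) : ℝ := laplacian g u x - inn g f u x

omit [IsManifold (𝓡 n) ∞ M] in
lemma SM.exp_neg (hf : SM n f) (A : ℝ) : SM n fun x => A * Real.exp (-f x) :=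
  SM.comp (φ := fun s => A * Real.exp (-s)) (by fun_prop) hf

lemma inn_exp_neg (hf : SM n f) (A : ℝ) :
    inn g w (fun z => A * Real.exp (-f z)) x = -(A * Real.exp (-f x)) * inn g w f x := by
  refine inn_comp_right (φ := fun s => A * Real.exp (-s)) ?_ hf
  simpa using ((hasDerivAt_neg (f x)).exp).const_mul A

variable {η : ℕ → M → ℝ} {C : ℝ}

lemma IsCutoff.C_nonneg (hη : IsCutoff g η C) (hg : SmoothMetric g) (x : M) : 0 ≤ C :=
  (inn_self_nonneg hg).trans (hη.grad 0 x)

lemma IsCutoff.abs_inn_le (hη : IsCutoff g η C) (hg : SmoothMetric g) {a : ℝ} {H : ℝ}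
    (hH : 0 ≤ H) (h : a ^ 2 * inn g v v x ≤ H ^ 2) (k : ℕ) :
    |a * inn g v (η k) x| ≤ Real.sqrt C * H := by
  have h1 := inn_sq_le hg (u := v) (v := η k) (x := x)
  have hC := hη.C_nonneg hg x
  refine abs_le_of_sq_le_sq ?_ (by positivity)
  rw [mul_pow, mul_pow, Real.sq_sqrt hC]
  calc a ^ 2 * inn g v (η k) x ^ 2 ≤ a ^ 2 * (inn g v v x * inn g (η k) (η k) x) :=
        mul_le_mul_of_nonneg_left h1 (sq_nonneg a)
    _ = (a ^ 2 * inn g v v x) * inn g (η k) (η k) x := by ring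
    _ ≤ H ^ 2 * C := mul_le_mul h (hη.grad k x) (inn_self_nonneg hg) (sq_nonneg H)
    _ = C * H ^ 2 := mul_comm _ _

variable [MeasurableSpace M] [BorelSpace M]

lemma integral_wvol (hf : Continuous f) (hA : 0 ≤ A) (h : M → ℝ) :
    ∫ x, h x ∂(wvol g f A) = ∫ x, A * Real.exp (-f x) * h x ∂(vol g) := by
  have hm : Measurable fun x => A * Real.exp (-f x) := by
    have := hf.measurable; fun_prop
  rw [wvol, integral_withDensity_eq_integral_toReal_smul hm.ennreal_ofReal (by simp)]
  refine integral_congr_ae (Eventually.of_forall fun x => ?_)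
  simp only [smul_eq_mul]
  rw [ENNReal.toReal_ofReal (by positivity)]

variable [SecondCountableTopology M]

lemma isLocallyFinite_wvol (hg : SmoothMetric g) (hf : Continuous f) :
    IsLocallyFiniteMeasure (wvol g f A) := by
  have := isLocallyFinite_vol hg
  exact IsLocallyFiniteMeasure.withDensity_ofReal (by fun_prop)

variable [T2Space M]

lemma SM.dlap (hg : SmoothMetric g) (hf : SM n f) (hu : SM n u) : SM n (dlap g f u) :=
  (SM.laplacian hg hu).sub (SM.inn hg hf hu)

/-- Green's formula for the weighted volume. -/
lemma green_weighted (hg : SmoothMetric g) (hf : SM n f) (hA : 0 ≤ A) (hu : SM n u) (hw : SM n w)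
    (hwc : HasCompactSupport w) :
    ∫ x, w x * dlap g f u x ∂(wvol g f A) = -∫ x, inn g u w x ∂(wvol g f A) := by
  have := isLocallyFinite_vol hg
  have hK := hf.exp_neg A
  rw [integral_wvol hf.continuous hA, integral_wvol hf.continuous hA]
  have h1 := green hg hu (hK.mul hw) (hwc.mul_left (f := fun x => A * Real.exp (-f x)))
  have h2 : ∀ x, inn g u (fun z => A * Real.exp (-f z) * w z) x
      = A * Real.exp (-f x) * inn g u w x - A * Real.exp (-f x) * (w x * inn g f u x) := by
    intro x
    rw [inn_mul_right hK hw, inn_exp_neg hf, inn_comm hg (u := u) (v := f)]; ring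
  have i1 : Integrable (fun x => A * Real.exp (-f x) * inn g u w x) (vol g) :=
    (hK.mul (SM.inn hg hu hw)).continuous.integrable_of_hasCompactSupport
      (hasCompactSupport_inn hwc).mul_left
  have i2 : Integrable (fun x => A * Real.exp (-f x) * (w x * inn g f u x)) (vol g) :=
    (hK.mul (hw.mul (SM.inn hg hf hu))).continuous.integrable_of_hasCompactSupport
      hwc.mul_right.mul_left
  have i3 : Integrable (fun x => A * Real.exp (-f x) * (w x * laplacian g u x)) (vol g) :=
    (hK.mul (hw.mul (SM.laplacian hg hu))).continuous.integrable_of_hasCompactSupport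
      hwc.mul_right.mul_left
  simp only [h2] at h1
  rw [integral_sub i1 i2] at h1
  simp only [dlap, mul_sub]
  rw [integral_sub i3 i2]
  simp only [mul_assoc] at h1 i3 ⊢
  linarith

/-! ### Passing to the limit in the cutoff -/

section Limits

variable {μ : Measure M}

omit [SecondCountableTopology M] [T2Space M] in
lemma IsCutoff.tendsto_integral (hη : IsCutoff g η C) {h : M → ℝ} (hh : Integrable h μ) :
    Tendsto (fun k => ∫ x, η k x * h x ∂μ) atTop (𝓝 (∫ x, h x ∂μ)) := by
  refine tendsto_integral_of_dominated_convergence (fun x => |h x|) (fun k =>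
    (hη.smooth k).continuous.measurable.aestronglyMeasurable.mul hh.aestronglyMeasurable) hh.abs
    (fun k => Eventually.of_forall fun x => ?_) (Eventually.of_forall fun x => ?_)
  · rw [Real.norm_eq_abs, abs_mul, abs_of_nonneg (hη.nonneg k x)]
    exact mul_le_of_le_one_left (abs_nonneg _) (hη.le_one k x)
  · refine tendsto_const_nhds.congr' ((hη.eventually_one x).mono fun k hk => ?_)
    simp [hk.self_of_nhds]

omit [SecondCountableTopology M] [T2Space M] in
/-- The terms with a derivative of the cutoff function vanish in the limit. -/
lemma IsCutoff.tendsto_inn (hη : IsCutoff g η C) (hg : SmoothMetric g) (hv : SM n v)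
    {a H : M → ℝ} (ha : Continuous a) (hHi : Integrable H μ) (hH0 : ∀ x, 0 ≤ H x)
    (hH : ∀ x, a x ^ 2 * inn g v v x ≤ H x ^ 2) :
    Tendsto (fun k => ∫ x, a x * inn g v (η k) x ∂μ) atTop (𝓝 0) := by
  have h0 : ∫ _, (0 : ℝ) ∂μ = 0 := by simp
  rw [← h0]
  refine tendsto_integral_of_dominated_convergence (fun x => Real.sqrt C * H x) (fun k =>
    (ha.mul (SM.inn hg hv (hη.smooth k)).continuous).measurable.aestronglyMeasurable)
    (hHi.const_mul _) (fun k => Eventually.of_forall fun x => ?_)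
    (Eventually.of_forall fun x => ?_)
  · exact hη.abs_inn_le hg (hH0 x) (hH x) k
  · refine tendsto_const_nhds.congr' ((hη.eventually_one x).mono fun k hk => ?_)
    simp [inn_congr_right hk, inn_const_right]

omit [SecondCountableTopology M] [T2Space M] in
/-- Fatou's lemma for cutoff functions. -/
lemma IsCutoff.integrable_of_bound (hη : IsCutoff g η C) {h : M → ℝ} (hc : Continuous h)
    (h0 : ∀ x, 0 ≤ h x) {B : ℝ} (hi : ∀ k, Integrable (fun x => η k x ^ 2 * h x) μ)
    (hB : ∀ k, ∫ x, η k x ^ 2 * h x ∂μ ≤ B) :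
    Integrable h μ ∧ ∫ x, h x ∂μ ≤ B := by
  have hB0 : 0 ≤ B := (integral_nonneg fun x => mul_nonneg (sq_nonneg _) (h0 x)).trans (hB 0)
  have key : ∫⁻ x, ENNReal.ofReal (h x) ∂μ ≤ ENNReal.ofReal B := by
    have h1 : ∀ x, ENNReal.ofReal (h x)
        = liminf (fun k => ENNReal.ofReal (η k x ^ 2 * h x)) atTop := by
      intro x
      refine (Tendsto.liminf_eq ?_).symm
      refine tendsto_const_nhds.congr' ((hη.eventually_one x).mono fun k hk => ?_)
      simp [hk.self_of_nhds]
    simp only [h1]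
    have hm : ∀ k, Measurable fun x => ENNReal.ofReal (η k x ^ 2 * h x) := fun k =>
      (((hη.smooth k).continuous.pow 2).mul hc).measurable.ennreal_ofReal
    refine (lintegral_liminf_le hm).trans ?_
    refine liminf_le_of_frequently_le' (Frequently.of_forall fun k => ?_)
    rw [← ofReal_integral_eq_lintegral_ofReal (hi k)
      (Eventually.of_forall fun x => mul_nonneg (sq_nonneg _) (h0 x))]
    exact ENNReal.ofReal_le_ofReal (hB k)
  have hint : Integrable h μ :=
    ⟨hc.measurable.aestronglyMeasurable, by
      rw [hasFiniteIntegral_iff_ofReal (Eventually.of_forall h0)]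
      exact key.trans_lt ENNReal.ofReal_lt_top⟩
  refine ⟨hint, ?_⟩
  rw [← ofReal_integral_eq_lintegral_ofReal hint (Eventually.of_forall h0)] at key
  exact (ENNReal.ofReal_le_ofReal_iff hB0).1 key

end Limits

/-! ### Weighted estimates -/

lemma abs_le_add_of_sq_le {a b s : ℝ} (ha : 0 ≤ a) (hb : 0 ≤ b) (h : s ^ 2 ≤ 4 * a * b) :
    |s| ≤ a / 4 + 4 * b :=
  abs_le_of_sq_le_sq (by nlinarith [sq_nonneg (a / 4 - 4 * b)]) (by positivity)

/-- If `Δf ≤ β`, then `v |∇f|²` is integrable for the measure `A e^{-f} dV` as soon as `v` and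
`|∇√v|²` are. The bound comes from integrating `v |∇f|² e^{-f} = -v ⟨∇f, ∇e^{-f}⟩` by parts. -/
lemma integrable_mul_gradSq (hg : SmoothMetric g) (hf : SM n f) (hA : 0 ≤ A)
    (hη : IsCutoff g η C) (hC : 0 ≤ C) (hv : SM n v) (hv0 : ∀ x, 0 ≤ v x) (hw0 : ∀ x, 0 ≤ w x)
    (hvw : ∀ x, inn g v v x ≤ 4 * v x * w x)
    (hvi : Integrable v (wvol g f A)) (hwi : Integrable w (wvol g f A))
    {β : ℝ} (hβ : 0 ≤ β) (hΔ : ∀ x, laplacian g f x ≤ β) :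
    Integrable (fun x => v x * inn g f f x) (wvol g f A) ∧
      ∫ x, v x * inn g f f x ∂(wvol g f A)
        ≤ (2 * β + 8 * C) * ∫ x, v x ∂(wvol g f A) + 8 * ∫ x, w x ∂(wvol g f A) := by
  have := isLocallyFinite_wvol (A := A) hg hf.continuous
  set μ := wvol g f A with hμ
  have cc : ∀ k, HasCompactSupport fun x => η k x ^ 2 := fun k =>
    (hη.compact k).comp_left (g := fun s : ℝ => s ^ 2) (by simp)
  have sη : ∀ k, SM n fun x => η k x ^ 2 := fun k =>
    SM.comp (φ := fun s => s ^ 2) (by fun_prop) (hη.smooth k)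
  have hF : SM n (inn g f f) := SM.inn hg hf hf
  have hF0 : ∀ x, 0 ≤ inn g f f x := fun x => inn_self_nonneg hg
  have intc : ∀ k {h : M → ℝ}, Continuous h → Integrable (fun x => η k x ^ 2 * h x) μ :=
    fun k h hh => ((sη k).continuous.mul hh).integrable_of_hasCompactSupport (cc k).mul_right
  refine hη.integrable_of_bound (hv.continuous.mul hF.continuous)
    (fun x => mul_nonneg (hv0 x) (hF0 x))
    (fun k => intc k (hv.continuous.mul hF.continuous)) fun k => ?_
  -- Green's formula for `f` and the test function `ηₖ² v`; the two terms that are linear in `∇f` are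
  -- absorbed, each in a quarter of `ηₖ² v |∇f|²`
  have hG := green_weighted (u := f) hg hf hA hf ((sη k).mul hv) (cc k).mul_right
  have hpt : ∀ x, 1 / 2 * (η k x ^ 2 * (v x * inn g f f x))
      + (η k x ^ 2 * v x * dlap g f f x + inn g f (fun x => η k x ^ 2 * v x) x)
      ≤ (β + 4 * C) * v x + 4 * w x := by
    intro x
    have hη2 : η k x ^ 2 ≤ 1 := pow_le_one₀ (hη.nonneg k x) (hη.le_one k x)
    have e1 : inn g f (fun x => η k x ^ 2 * v x) x
        = η k x ^ 2 * inn g f v x + v x * (2 * η k x * inn g f (η k) x) := by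
      rw [inn_mul_right (sη k) hv, inn_comp_right (φ := fun s => s ^ 2) (φ' := 2 * η k x) ?_
        (hη.smooth k)]
      simpa using hasDerivAt_pow 2 (η k x)
    have b1 : |inn g f v x| ≤ v x * inn g f f x / 4 + 4 * w x := by
      refine abs_le_add_of_sq_le (mul_nonneg (hv0 x) (hF0 x)) (hw0 x) ?_
      calc _ ≤ inn g f f x * inn g v v x := inn_sq_le hg
        _ ≤ inn g f f x * (4 * v x * w x) := mul_le_mul_of_nonneg_left (hvw x) (hF0 x)
        _ = _ := by ring
    have b2 : |v x * (2 * η k x * inn g f (η k) x)|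
        ≤ η k x ^ 2 * (v x * inn g f f x) / 4 + 4 * (v x * C) := by
      refine abs_le_add_of_sq_le (mul_nonneg (sq_nonneg _) (mul_nonneg (hv0 x) (hF0 x)))
        (mul_nonneg (hv0 x) hC) ?_
      have h1 : inn g f (η k) x ^ 2 ≤ inn g f f x * C :=
        (inn_sq_le hg).trans (mul_le_mul_of_nonneg_left (hη.grad k x) (hF0 x))
      calc _ = 4 * (v x ^ 2 * η k x ^ 2) * inn g f (η k) x ^ 2 := by ring
        _ ≤ 4 * (v x ^ 2 * η k x ^ 2) * (inn g f f x * C) :=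
          mul_le_mul_of_nonneg_left h1 (by positivity)
        _ = _ := by ring
    have b3 : η k x ^ 2 * inn g f v x ≤ η k x ^ 2 * (v x * inn g f f x) / 4 + 4 * w x := by
      have h1 := mul_le_mul_of_nonneg_left ((le_abs_self _).trans b1) (sq_nonneg (η k x))
      have h2 : η k x ^ 2 * (4 * w x) ≤ 4 * w x :=
        mul_le_of_le_one_left (by have := hw0 x; positivity) hη2
      calc _ ≤ _ := h1
        _ = η k x ^ 2 * (v x * inn g f f x) / 4 + η k x ^ 2 * (4 * w x) := by ring
        _ ≤ _ := by linarith
    have b4 : η k x ^ 2 * v x * laplacian g f x ≤ β * v x := by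
      have h1 : η k x ^ 2 * v x * laplacian g f x ≤ η k x ^ 2 * v x * β :=
        mul_le_mul_of_nonneg_left (hΔ x) (mul_nonneg (sq_nonneg _) (hv0 x))
      have h2 : η k x ^ 2 * (v x * β) ≤ v x * β :=
        mul_le_of_le_one_left (mul_nonneg (hv0 x) hβ) hη2
      linarith
    have e2 : η k x ^ 2 * v x * dlap g f f x
        = η k x ^ 2 * v x * laplacian g f x - η k x ^ 2 * (v x * inn g f f x) := by
      rw [dlap]; ring
    have b5 := le_abs_self (v x * (2 * η k x * inn g f (η k) x))
    rw [e1, e2]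
    linarith
  have i1 : Integrable (fun x => η k x ^ 2 * v x * dlap g f f x) μ :=
    (((sη k).mul hv).mul (SM.dlap hg hf hf)).continuous.integrable_of_hasCompactSupport
      (cc k).mul_right.mul_right
  have i2 : Integrable (fun x => inn g f (fun x => η k x ^ 2 * v x) x) μ :=
    (SM.inn hg hf ((sη k).mul hv)).continuous.integrable_of_hasCompactSupport
      (hasCompactSupport_inn (cc k).mul_right)
  have i3 : Integrable (fun x => η k x ^ 2 * (v x * inn g f f x)) μ :=
    intc k (hv.continuous.mul hF.continuous)
  have i3' := i3.const_mul (1 / 2)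
  have i12 : Integrable (fun x => η k x ^ 2 * v x * dlap g f f x
      + inn g f (fun x => η k x ^ 2 * v x) x) μ := i1.add i2
  have j1 := hvi.const_mul (β + 4 * C)
  have j2 := hwi.const_mul 4
  have hI := integral_mono (i3'.add i12) (j1.add j2) hpt
  simp only [Pi.add_apply] at hI
  rw [integral_add i3' i12, integral_add i1 i2, hG, integral_add j1 j2, integral_const_mul,
    integral_const_mul, integral_const_mul] at hI
  rw [← hμ] at hI
  change ∫ x, η k x ^ 2 * (v x * inn g f f x) ∂μ ≤ _
  linarith

omit [MeasurableSpace M] [BorelSpace M] [SecondCountableTopology M] [T2Space M] in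
lemma hessSq_nonneg (hg : SmoothMetric g) (hu : SM n u) : 0 ≤ hessSq g u x :=
  (hg.isMetricOn x).hsqE_nonneg (hu x) (mem_tgt x)

omit [MeasurableSpace M] [BorelSpace M] [SecondCountableTopology M] [T2Space M] in
lemma localRep_gradSq_eventuallyEq (hu : SM n u) :
    localRep (n := n) (inn g u u) x
      =ᶠ[𝓝 (Φ x x)] innE (gMat g x) (localRep u x) (localRep u x) :=
  eventually_of_mem ((isOpen_target x).mem_nhds (mem_tgt x)) fun _ hz => localRep_inn hu hu hz

omit [MeasurableSpace M] [BorelSpace M] [SecondCountableTopology M] [T2Space M] in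
/-- `|∇|∇u|²|² ≤ 4 |∇u|² |∇²u|²`. -/
lemma inn_gradSq_le (hg : SmoothMetric g) (hu : SM n u) :
    inn g (inn g u u) (inn g u u) x ≤ 4 * inn g u u x * hessSq g u x := by
  rw [inn_chart (SM.inn hg hu hu) (SM.inn hg hu hu) (mem_extChartAt_source x)]
  refine le_trans (le_of_eq ?_) ((hg.isMetricOn x).innE_innE_le (hu x) (mem_tgt x))
  simp only [innE, pd_congr (localRep_gradSq_eventuallyEq hu)]

/-- The quantities that enter the parabolic frequency at a fixed time: with
`L = Δ - ⟨∇f, ∇·⟩`, `Ric + ∇²f ≤ λ g` and `h = |∇²u|²`, the function `(Lu)²` is integrable,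
`∫ (Lu)² ≤ ∫ |∇²u|² + λ ∫ |∇u|²`, and `(∫ |∇u|²)² ≤ ∫ u² ∫ (Lu)²`. -/
lemma weighted_bochner (hg : SmoothMetric g) (hf : SM n f) (hA : 0 ≤ A)
    (hη : IsCutoff g η C) (hC : 0 ≤ C) (hu : SM n u) (hhc : Continuous fun x => hessSq g u x)
    (hui : Integrable (fun x => u x ^ 2) (wvol g f A))
    (hPi : Integrable (fun x => inn g u u x) (wvol g f A))
    (hhi : Integrable (fun x => hessSq g u x) (wvol g f A))
    {lam β : ℝ} (hβ : 0 ≤ β) (hΔ : ∀ x, laplacian g f x ≤ β)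
    (hBE : ∀ (x : M) (v : TangentSpace (𝓡 n) x),
      ricci g x v v + hess g f x v v ≤ lam * g.inner x v v) :
    ∃ Q : ℝ, Q ≤ ∫ x, hessSq g u x ∂(wvol g f A) + lam * ∫ x, inn g u u x ∂(wvol g f A) ∧
      (∫ x, inn g u u x ∂(wvol g f A)) ^ 2 ≤ (∫ x, u x ^ 2 ∂(wvol g f A)) * Q := by
  have := isLocallyFinite_wvol (A := A) hg hf.continuous
  set μ := wvol g f A with hμ
  have sP : SM n (inn g u u) := SM.inn hg hu hu
  have hP0 : ∀ x, 0 ≤ inn g u u x := fun x => inn_self_nonneg hg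
  have hh0 : ∀ x, 0 ≤ hessSq g u x := fun x => hessSq_nonneg hg hu
  have sL : SM n (dlap g f u) := SM.dlap hg hf hu
  have hPP := fun x => inn_gradSq_le hg hu (x := x)
  -- `(Lu)² ≤ 2 n |∇²u|² + 2 |∇f|² |∇u|²`
  have hL2 : Integrable (fun x => dlap g f u x ^ 2) μ := by
    have hPF := (integrable_mul_gradSq hg hf hA hη hC sP hP0 hh0 hPP hPi hhi hβ hΔ).1
    refine ((hhi.const_mul (2 * n)).add (hPF.const_mul 2)).mono'
      (sL.continuous.pow 2).measurable.aestronglyMeasurable (Eventually.of_forall fun x => ?_)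
    have h1 : laplacian g u x ^ 2 ≤ n * hessSq g u x :=
      (hg.isMetricOn x).lapE_sq_le (hu x) (mem_tgt x)
    have h2 := inn_sq_le hg (u := f) (v := u) (x := x)
    rw [Real.norm_eq_abs, abs_of_nonneg (sq_nonneg _)]
    simp only [Pi.add_apply, dlap]
    nlinarith [sq_nonneg (laplacian g u x + inn g f u x)]
  have huL : Integrable (fun x => u x * dlap g f u x) μ := by
    refine (hui.add hL2).mono' (hu.continuous.mul sL.continuous).measurable.aestronglyMeasurable
      (Eventually.of_forall fun x => ?_)
    rw [Real.norm_eq_abs, abs_mul]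
    simp only [Pi.add_apply]
    nlinarith [sq_nonneg (|u x| - |dlap g f u x|), sq_abs (u x), sq_abs (dlap g f u x)]
  have compI : ∀ k {h : M → ℝ}, Continuous h → Integrable (fun x => η k x * h x) μ :=
    fun k h hh => ((hη.smooth k).continuous.mul hh).integrable_of_hasCompactSupport
      (hη.compact k).mul_right
  have innI : ∀ k {v : M → ℝ} (a : M → ℝ), Continuous a → SM n v →
      Integrable (fun x => a x * inn g v (η k) x) μ :=
    fun k v a ha hv => (ha.mul (SM.inn hg hv (hη.smooth k)).continuous).integrable_of_hasCompactSupport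
      (hasCompactSupport_inn (hη.compact k)).mul_left
  -- `∫ u Lu = -∫ |∇u|²`
  have hE : ∫ x, u x * dlap g f u x ∂μ = -∫ x, inn g u u x ∂μ := by
    have l1 := hη.tendsto_integral huL
    have l2 := (hη.tendsto_integral hPi).neg.sub (hη.tendsto_inn hg hu (a := u) hu.continuous
      (hui.add hPi) (fun x => add_nonneg (sq_nonneg _) (hP0 x)) (fun x => by
        simp only [Pi.add_apply]
        nlinarith [sq_nonneg (u x), hP0 x, mul_nonneg (sq_nonneg (u x)) (hP0 x),
          sq_nonneg (u x ^ 2), sq_nonneg (inn g u u x)]))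
    rw [sub_zero] at l2
    refine tendsto_nhds_unique l1 (l2.congr fun k => ?_)
    have h1 := green_weighted (u := u) hg hf hA hu ((hη.smooth k).mul hu) (hη.compact k).mul_right
    simp only [mul_assoc] at h1
    rw [h1]
    have h2 : ∀ x, inn g u (fun z => η k z * u z) x
        = η k x * inn g u u x + u x * inn g u (η k) x := fun x =>
      inn_mul_right (hη.smooth k) hu
    simp only [h2]
    rw [integral_add (compI k sP.continuous) (innI k u hu.continuous hu)]
    ring
  refine ⟨∫ x, dlap g f u x ^ 2 ∂μ, ?_, ?_⟩
  -- Bochner's formula for `L`, integrated against `ηₖ`, as `k → ∞`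
  · have l1 := hη.tendsto_integral hhi
    have l2 := hη.tendsto_integral hL2
    have l3 := hη.tendsto_integral hPi
    have l4 := hη.tendsto_inn hg hu (a := dlap g f u) sL.continuous
      (hL2.add hPi) (fun x => add_nonneg (sq_nonneg _) (hP0 x)) (fun x => by
        simp only [Pi.add_apply]
        nlinarith [sq_nonneg (dlap g f u x), hP0 x, mul_nonneg (sq_nonneg (dlap g f u x)) (hP0 x),
          sq_nonneg (dlap g f u x ^ 2), sq_nonneg (inn g u u x)])
    have l5 := hη.tendsto_inn hg sP (a := fun _ => 1) continuous_const
      (hPi.add hhi) (fun x => add_nonneg (hP0 x) (hh0 x)) (fun x => by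
        simp only [Pi.add_apply]
        nlinarith [hPP x, sq_nonneg (inn g u u x - hessSq g u x)])
    have key : ∀ k, ∫ x, η k x * dlap g f u x ^ 2 ∂μ + ∫ x, dlap g f u x * inn g u (η k) x ∂μ
        - 1 / 2 * ∫ x, 1 * inn g (inn g u u) (η k) x ∂μ
        ≤ ∫ x, η k x * hessSq g u x ∂μ + lam * ∫ x, η k x * inn g u u x ∂μ := by
      intro k
      have h1 := green_weighted (u := u) hg hf hA hu ((hη.smooth k).mul sL) (hη.compact k).mul_right
      have h2 := green_weighted (u := inn g u u) hg hf hA sP (hη.smooth k) (hη.compact k)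
      have h3 : ∀ x, inn g u (fun z => η k z * dlap g f u z) x
          = η k x * inn g u (dlap g f u) x + dlap g f u x * inn g u (η k) x := fun x =>
        inn_mul_right (hη.smooth k) sL
      simp only [h3] at h1
      rw [integral_add (compI k (SM.inn hg hu sL).continuous) (innI k _ sL.continuous hu)] at h1
      have hpt : ∀ x, η k x * dlap g f (inn g u u) x ≤ 2 * (η k x * hessSq g u x)
          + 2 * (η k x * inn g u (dlap g f u) x) + 2 * lam * (η k x * inn g u u x) := by
        intro x
        have hB := (hg.isMetricOn x).bochner_drift (hu x) (hf x) (mem_tgt x)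
        have hR := coord_bound (x := x) (T := fun i j => ricE (gMat g x) (Φ x x) i j
            + hessE (gMat g x) (localRep f x) (Φ x x) i j) (c := lam) (fun v => by
          refine le_trans (le_of_eq ?_) (hBE x v)
          simp only [add_mul, Finset.sum_add_distrib]
          rfl) (fun i => gradV (gMat g x) (localRep u x) i (Φ x x))
        rw [(hg.isMetricOn x).sum_gradV_gradV (mem_tgt x)] at hR
        simp only [add_mul, Finset.sum_add_distrib] at hR
        have e1 := localRep_gradSq_eventuallyEq (g := g) (x := x) hu
        have e2 : localRep (n := n) (dlap g f u) x =ᶠ[𝓝 (Φ x x)] fun z =>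
            lapE (gMat g x) (localRep u x) z - innE (gMat g x) (localRep f x) (localRep u x) z :=
          eventually_of_mem ((isOpen_target x).mem_nhds (mem_tgt x)) fun z hz => by
            change localRep (dlap g f u) x z = lapE _ _ z - innE _ _ _ z
            rw [← localRep_laplacian hg hu hz, ← localRep_inn hf hu hz]; rfl
        have e3 : dlap g f (inn g u u) x
            = lapE (gMat g x) (innE (gMat g x) (localRep u x) (localRep u x)) (Φ x x)
              - innE (gMat g x) (localRep f x)
                (innE (gMat g x) (localRep u x) (localRep u x)) (Φ x x) := by
          have e4 : ∀ j, pd j (localRep (n := n) (inn g u u) x)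
              =ᶠ[𝓝 (Φ x x)] pd j (innE (gMat g x) (localRep u x) (localRep u x)) := fun j =>
            e1.eventually_nhds.mono fun z hz => pd_congr hz
          rw [dlap, laplacian_eq, inn]
          simp only [lapE, hessE, innE, pd_congr e1, pd_congr (e4 _)]
        have e5 : inn g u (dlap g f u) x = innE (gMat g x) (localRep u x) (fun z =>
            lapE (gMat g x) (localRep u x) z - innE (gMat g x) (localRep f x) (localRep u x) z)
            (Φ x x) := by
          rw [inn]; simp only [innE, pd_congr e2]
        rw [e3, hB, e5]
        have e6 : hessSq g u x = hsqE (gMat g x) (localRep u x) (Φ x x) := rfl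
        have e7 : inn g u u x = innE (gMat g x) (localRep u x) (localRep u x) (Φ x x) := rfl
        rw [e6, e7]
        nlinarith [mul_le_mul_of_nonneg_left hR (hη.nonneg k x)]
      have i1 := (compI k hhc).const_mul 2
      have i2 := (compI k (SM.inn hg hu sL).continuous).const_mul 2
      have i3 := (compI k sP.continuous).const_mul (2 * lam)
      have i12 : Integrable (fun x => 2 * (η k x * hessSq g u x)
          + 2 * (η k x * inn g u (dlap g f u) x)) μ := i1.add i2
      have hI := integral_mono (compI k (SM.dlap hg hf sP).continuous) (i12.add i3) hpt
      simp only [Pi.add_apply] at hI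
      rw [h2, integral_add i12 i3, integral_add i1 i2, integral_const_mul,
        integral_const_mul, integral_const_mul] at hI
      have h4 : ∫ x, η k x * dlap g f u x * dlap g f u x ∂μ = ∫ x, η k x * dlap g f u x ^ 2 ∂μ := by
        congr 1; funext x; ring
      rw [h4] at h1
      simp only [one_mul]
      linarith
    have := le_of_tendsto_of_tendsto' ((l2.add l4).sub (l5.const_mul (1 / 2)))
      (l1.add (l3.const_mul lam)) key
    simpa using this
  -- the Cauchy–Schwarz inequality: `∫ (u + s Lu)²` is a nonnegative quadratic polynomial in `s`
  · have hquad : ∀ s : ℝ, 0 ≤ (∫ x, dlap g f u x ^ 2 ∂μ) * (s * s)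
        + (2 * ∫ x, u x * dlap g f u x ∂μ) * s + ∫ x, u x ^ 2 ∂μ := by
      intro s
      have h1 : 0 ≤ ∫ x, (u x + s * dlap g f u x) ^ 2 ∂μ := integral_nonneg fun x => sq_nonneg _
      have h2 : ∀ x, (u x + s * dlap g f u x) ^ 2 = u x ^ 2 + (2 * s * (u x * dlap g f u x)
          + s * s * dlap g f u x ^ 2) := fun x => by ring
      simp only [h2] at h1
      have j1 := huL.const_mul (2 * s)
      have j2 := hL2.const_mul (s * s)
      have j3 : Integrable (fun x => 2 * s * (u x * dlap g f u x)
          + s * s * dlap g f u x ^ 2) μ := j1.add j2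
      rw [integral_add hui j3, integral_add j1 j2, integral_const_mul, integral_const_mul] at h1
      linarith
    have := discrim_le_zero hquad
    rw [discrim, hE] at this
    linarith

end Weighted

/-! ### Compactness of balls in complete length spaces -/

/-- The theorem of Hopf, Rinow and Cohn-Vossen: in a complete, locally compact length space, closed
balls are compact. The supremum `R` of the radii of compact balls around `x` is attained, since the
ball of radius `R` is totally bounded, and a neighbourhood of it is compact. -/
theorem isCompact_closedEBall_of_length {X : Type*} [PseudoEMetricSpace X] [CompleteSpace X]
    [LocallyCompactSpace X]
    (hlen : ∀ (x y : X) (r : ℝ≥0) (s : ℝ≥0∞), 0 < s → edist x y < r + s →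
      ∃ z, edist x z ≤ r ∧ edist z y < s) (x : X) (R : ℝ≥0) :
    IsCompact (_root_.Metric.closedEBall x R) := by
  by_contra hR
  set S : Set ℝ≥0 := {r | IsCompact (_root_.Metric.closedEBall x (r : ℝ≥0∞))} with hS
  have down : ∀ {r r' : ℝ≥0}, r' ∈ S → r ≤ r' → r ∈ S := fun {r r'} hr' h =>
    IsCompact.of_isClosed_subset hr' Metric.isClosed_closedEBall
      (Metric.closedEBall_subset_closedEBall (by exact_mod_cast h))
  have hbdd : BddAbove S := ⟨R, fun r hr => le_of_not_ge fun h => hR (down hr h)⟩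
  set T := sSup S with hT
  have hlt : ∀ r < T, r ∈ S := by
    intro r hr
    have hne : S.Nonempty := by
      by_contra h
      rw [not_nonempty_iff_eq_empty] at h
      rw [hT, h] at hr
      simp at hr
    obtain ⟨r', hr', h⟩ := exists_lt_of_lt_csSup hne hr
    exact down hr' h.le
  have hTS : T ∈ S := by
    refine isCompact_iff_totallyBounded_isComplete.2 ⟨?_, Metric.isClosed_closedEBall.isComplete⟩
    refine EMetric.totallyBounded_iff.2 fun ε hε => ?_
    obtain ⟨e, he0, he⟩ := ENNReal.lt_iff_exists_nnreal_btwn.1 hε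
    have he0' : 0 < e := by exact_mod_cast he0
    obtain h | h := le_or_gt T (e / 2)
    · refine ⟨{x}, finite_singleton x, fun z hz => ?_⟩
      have h1 : edist z x ≤ T := hz
      simp only [mem_singleton_iff, iUnion_iUnion_eq_left, Metric.mem_eball]
      have h2 : (T : ℝ≥0∞) ≤ ((e / 2 : ℝ≥0) : ℝ≥0∞) := by exact_mod_cast h
      have h3 : ((e / 2 : ℝ≥0) : ℝ≥0∞) < e := by exact_mod_cast half_lt_self he0'
      exact (h1.trans h2).trans_lt (h3.trans he)
    -- points of the ball are at distance less than `3e/4` from the compact ball of radius `T - e/2`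
    · have hr : T - e / 2 < T := tsub_lt_self (lt_of_le_of_lt (by positivity) h) (by positivity)
      obtain ⟨t, ht, hc⟩ := EMetric.totallyBounded_iff.1 (hlt _ hr).totallyBounded
        ((e / 4 : ℝ≥0) : ℝ≥0∞) (by exact_mod_cast (by positivity : 0 < e / 4))
      refine ⟨t, ht, fun z hz => ?_⟩
      have hz' : edist x z ≤ T := by rw [edist_comm]; exact hz
      have h4 : edist x z < ((T - e / 2 : ℝ≥0) : ℝ≥0∞) + ((3 / 4 * e : ℝ≥0) : ℝ≥0∞) := by
        refine hz'.trans_lt ?_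
        rw [← ENNReal.coe_add]
        refine ENNReal.coe_lt_coe.2 ?_
        have h5 : T = (T - e / 2) + e / 2 := (tsub_add_cancel_of_le h.le).symm
        nth_rewrite 1 [h5]
        have h6 : e / 2 < 3 / 4 * e := by
          rw [← NNReal.coe_lt_coe]; push_cast
          have : (0 : ℝ) < e := by exact_mod_cast he0'
          linarith
        gcongr
      obtain ⟨w, hw, hwz⟩ := hlen x z _ _
        (by exact_mod_cast (by positivity : 0 < 3 / 4 * e)) h4
      have hw' : w ∈ _root_.Metric.closedEBall x ((T - e / 2 : ℝ≥0) : ℝ≥0∞) := by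
        rw [Metric.mem_closedEBall, edist_comm]; exact hw
      obtain ⟨y, hy, hwy⟩ := mem_iUnion₂.1 (hc hw')
      refine mem_iUnion₂.2 ⟨y, hy, ?_⟩
      rw [Metric.mem_eball] at hwy ⊢
      calc edist z y ≤ edist z w + edist w y := edist_triangle _ _ _
        _ < ((3 / 4 * e : ℝ≥0) : ℝ≥0∞) + ((e / 4 : ℝ≥0) : ℝ≥0∞) :=
          ENNReal.add_lt_add (by rwa [edist_comm]) hwy
        _ = e := by
          rw [← ENNReal.coe_add]
          congr 1
          rw [← NNReal.coe_inj]; push_cast; ring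
        _ ≤ ε := he.le
  obtain ⟨K, hK, hTK⟩ := exists_compact_superset (show IsCompact _ from hTS)
  obtain ⟨δ, hδ, hthick⟩ := IsCompact.exists_thickening_subset_open hTS isOpen_interior hTK
  -- the ball of radius `T + δ/2` lies in the `δ`-neighbourhood of the ball of radius `T`
  have hmem : T + Real.toNNReal (δ / 2) ∈ S := by
    refine hK.of_isClosed_subset Metric.isClosed_closedEBall fun z hz => ?_
    rw [Metric.mem_closedEBall, edist_comm, ENNReal.coe_add] at hz
    have h1 : edist x z < T + ENNReal.ofReal δ := by
      refine hz.trans_lt (ENNReal.add_lt_add_left ENNReal.coe_ne_top ?_)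
      exact (ENNReal.ofReal_lt_ofReal_iff hδ).2 (half_lt_self hδ)
    obtain ⟨w, hw, hwz⟩ := hlen x z T _ (ENNReal.ofReal_pos.2 hδ) h1
    refine interior_subset (hthick ((Metric.mem_thickening_iff_exists_edist_lt _ _).2 ⟨w, ?_, ?_⟩))
    · rw [Metric.mem_closedEBall, edist_comm]; exact hw
    · rwa [edist_comm]
  have h1 : T + Real.toNNReal (δ / 2) ≤ T := le_csSup hbdd hmem
  have h2 : 0 < Real.toNNReal (δ / 2) := Real.toNNReal_pos.2 (half_pos hδ)
  exact absurd h1 (not_le.2 (lt_add_of_pos_right _ h2))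

section Distance

variable {n : ℕ} {M : Type*} [TopologicalSpace M] [ChartedSpace (Model n) M]
  [IsManifold (𝓡 n) ∞ M] [T2Space M]

/-- The extended pseudometric of the Riemannian distance of `g`. Its topology is the given topology
of `M`, definitionally. -/
@[reducible] def metricSpaceOf (g : Metric n M) : PseudoEMetricSpace M :=
  haveI : LocallyCompactSpace M := Manifold.locallyCompact_of_finiteDimensional (𝓡 n)
  letI : Bundle.RiemannianBundle (fun x : M => TangentSpace (𝓡 n) x) := ⟨g.toRiemannianMetric⟩
  haveI : IsContinuousRiemannianBundle (Model n) (fun x : M => TangentSpace (𝓡 n) x) :=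
    ⟨⟨g.inner, g.contMDiff.continuous, fun _ _ _ => rfl⟩⟩
  PseudoEMetricSpace.ofRiemannianMetric (𝓡 n) M

omit [T2Space M] in
lemma rdist_le_lintegral (g : Metric n M) {γ : ℝ → M} (hγ : ContMDiffOn 𝓘(ℝ, ℝ) (𝓡 n) 1 γ (Icc 0 1)) :
    rdist g (γ 0) (γ 1) ≤ ∫⁻ t in Ioo (0 : ℝ) 1, ENNReal.ofReal (Real.sqrt
      (g.inner (γ t) (mfderiv 𝓘(ℝ, ℝ) (𝓡 n) γ t (1 : ℝ)) (mfderiv 𝓘(ℝ, ℝ) (𝓡 n) γ t (1 : ℝ)))) := by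
  let : Bundle.RiemannianBundle (fun x : M => TangentSpace (𝓡 n) x) := ⟨g.toRiemannianMetric⟩
  have := riemannianEDist_le_pathELength hγ rfl rfl zero_le_one
  rw [pathELength_eq_lintegral_mfderiv_Ioo] at this
  refine this.trans_eq ?_
  refine lintegral_congr fun t => ?_
  rw [← ofReal_norm]
  rw [norm_eq_sqrt_real_inner]
  rfl

/-- The Riemannian distance is a length distance: an almost minimizing path contains a point at
distance `r` from `x`. -/
lemma exists_between_of_rdist_lt (g : Metric n M) (x y : M) (r : ℝ≥0) (s : ℝ≥0∞) (hs : 0 < s)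
    (h : rdist g x y < r + s) : ∃ z, rdist g x z ≤ r ∧ rdist g z y < s := by
  have : LocallyCompactSpace M := Manifold.locallyCompact_of_finiteDimensional (𝓡 n)
  let : Bundle.RiemannianBundle (fun x : M => TangentSpace (𝓡 n) x) := ⟨g.toRiemannianMetric⟩
  obtain h1 | h1 := le_or_gt (rdist g x y) r
  · refine ⟨y, h1, ?_⟩
    have : rdist g y y = 0 := riemannianEDist_self
    rwa [this]
  obtain ⟨γ, h0, h1', hγ, hl⟩ := exists_lt_of_riemannianEDist_lt (I := 𝓡 n) h
  have hc : ContinuousOn (fun t => rdist g x (γ t)) (Icc 0 1) := by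
    let := metricSpaceOf g
    exact (continuous_const.edist continuous_id).comp_continuousOn hγ.continuousOn
  have h3 := intermediate_value_Icc zero_le_one hc
  have h4 : (r : ℝ≥0∞) ∈ Icc (rdist g x (γ 0)) (rdist g x (γ 1)) := by
    rw [h0, h1']
    have : rdist g x x = 0 := riemannianEDist_self
    rw [this]
    exact ⟨zero_le, h1.le⟩
  obtain ⟨t, ht, htr⟩ := h3 h4
  refine ⟨γ t, htr.le, ?_⟩
  have h5 : rdist g x (γ t) ≤ pathELength (𝓡 n) γ 0 t :=
    riemannianEDist_le_pathELength (hγ.mono (Icc_subset_Icc_right ht.2)) h0 rfl ht.1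
  have h6 : rdist g (γ t) y ≤ pathELength (𝓡 n) γ t 1 :=
    riemannianEDist_le_pathELength (hγ.mono (Icc_subset_Icc_left ht.1)) rfl h1' ht.2
  refine h6.trans_lt ?_
  rw [← pathELength_add ht.1 ht.2] at hl
  have h7 := (add_le_add_left (htr.ge.trans h5) _).trans_lt hl
  exact lt_of_add_lt_add_left h7

lemma isCompact_rdist_le {g : Metric n M} (hg : IsCompleteMetric g) (x : M) (R : ℝ≥0) :
    IsCompact {z | rdist g x z ≤ R} := by
  have hlc : LocallyCompactSpace M := Manifold.locallyCompact_of_finiteDimensional (𝓡 n)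
  let := metricSpaceOf g
  have : CompleteSpace M := by
    refine EMetric.complete_of_cauchySeq_tendsto fun s hs => ?_
    obtain ⟨y, hy⟩ := hg s fun ε hε => EMetric.cauchySeq_iff.1 hs ε hε
    exact ⟨y, tendsto_iff_edist_tendsto_0.2 hy⟩
  have h1 := isCompact_closedEBall_of_length (X := M) (exists_between_of_rdist_lt g) x R
  have h2 : {z | rdist g x z ≤ R} = _root_.Metric.closedEBall x R := by
    ext z
    rw [Metric.mem_closedEBall, edist_comm]
    rfl
  rw [h2]
  exact h1

lemma continuous_rdist (g : Metric n M) (x : M) : Continuous fun z => rdist g x z := by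
  let := metricSpaceOf g
  have h2 : Continuous fun z => edist x z := continuous_const.edist continuous_id
  exact h2

lemma rdist_triangle (g : Metric n M) (x y z : M) : rdist g x z ≤ rdist g x y + rdist g y z := by
  let := metricSpaceOf g
  exact edist_triangle x y z

lemma rdist_comm (g : Metric n M) (x y : M) : rdist g x y = rdist g y x := by
  let := metricSpaceOf g
  exact edist_comm x y

lemma rdist_lt_top [ConnectedSpace M] (g : Metric n M) (x y : M) : rdist g x y < ⊤ := by
  let := metricSpaceOf g
  have h : IsClopen (_root_.Metric.eball x ⊤) := ⟨Metric.isClosed_eball_top, Metric.isOpen_eball⟩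
  have h1 := h.eq_univ ⟨x, by simp⟩
  have h2 : y ∈ _root_.Metric.eball x ⊤ := h1 ▸ mem_univ y
  rw [Metric.mem_eball, edist_comm] at h2
  exact h2

end Distance


/-! ### Smoothing of Lipschitz functions -/

/-- A smooth approximation, by convolution, of a function on a ball that is Lipschitz with respect
to a gauge `p`. Since `p` is invariant under translations, the approximation has the same Lipschitz
bound. -/
lemma exists_smooth_approx {n : ℕ} {h : Model n → ℝ} {y₀ : Model n} {r : ℝ}
    (hc : ContinuousOn h (_root_.Metric.closedBall y₀ r)) {p : Model n → ℝ}
    (hp : ∀ (s : ℝ) v, p (s • v) = |s| * p v) (hp0 : ∀ v, 0 ≤ p v)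
    (hL : ∀ y ∈ _root_.Metric.closedBall y₀ r, ∀ z ∈ _root_.Metric.closedBall y₀ r,
      |h z - h y| ≤ p (z - y)) (hr : 0 < r) {ε : ℝ} (hε : 0 < ε) :
    ∃ k : Model n → ℝ, ContDiff ℝ ∞ k ∧
      (∀ y ∈ _root_.Metric.ball y₀ (r / 2), |k y - h y| ≤ ε) ∧
      ∀ y ∈ _root_.Metric.ball y₀ (r / 2), ∀ v, |fderiv ℝ k y v| ≤ p v := by
  set B := _root_.Metric.closedBall y₀ r with hB
  have hBc : IsCompact B := isCompact_closedBall y₀ r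
  obtain ⟨d, hd, hunif⟩ := Metric.uniformContinuousOn_iff.1
    (hBc.uniformContinuousOn_of_continuous hc) ε hε
  set h' := B.indicator h with hh'
  have hloc : LocallyIntegrable h' :=
    ((hc.integrableOn_compact hBc).integrable_indicator hBc.measurableSet).locallyIntegrable
  set e := min d (r / 2) with he
  have he0 : 0 < e := lt_min hd (half_pos hr)
  let φ : ContDiffBump (0 : Model n) := ⟨e / 2, e, half_pos he0, half_lt_self he0⟩
  have hφc : HasCompactSupport (φ.normed volume) := φ.hasCompactSupport_normed
  set k := convolution (φ.normed volume) h' (ContinuousLinearMap.lsmul ℝ ℝ) volume with hk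
  have hks : ContDiff ℝ ∞ k :=
    hφc.contDiff_convolution_left _ (φ.contDiff_normed (n := ⊤)) hloc
  have inB : ∀ {y t : Model n}, y ∈ _root_.Metric.ball y₀ (r / 2) →
      t ∈ _root_.Metric.ball (0 : Model n) e → y - t ∈ B := by
    intro y t hy ht
    rw [hB, Metric.mem_closedBall, dist_eq_norm]
    rw [Metric.mem_ball, dist_eq_norm] at hy ht
    rw [sub_zero] at ht
    have h1 : y - t - y₀ = (y - y₀) - t := by abel
    have h2 := norm_sub_le (y - y₀) t
    have h3 : e ≤ r / 2 := min_le_right _ _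
    rw [h1]; linarith
  have kex : ∀ y, Integrable (fun t => φ.normed volume t • h' (y - t)) := fun y =>
    HasCompactSupport.convolutionExists_left (L := ContinuousLinearMap.lsmul ℝ ℝ) hφc
      φ.continuous_normed hloc y
  have kval : ∀ y, k y = ∫ t, φ.normed volume t • h' (y - t) := fun y => rfl
  have klip : ∀ y ∈ _root_.Metric.ball y₀ (r / 2), ∀ z ∈ _root_.Metric.ball y₀ (r / 2),
      |k z - k y| ≤ p (z - y) := by
    intro y hy z hz
    rw [kval, kval, ← integral_sub (kex z) (kex y), ← Real.norm_eq_abs]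
    have h1 : ∫ t, φ.normed volume t * p (z - y) = p (z - y) := by
      rw [integral_mul_const, φ.integral_normed, one_mul]
    rw [← h1]
    refine norm_integral_le_of_norm_le (φ.integrable_normed.mul_const _)
      (Eventually.of_forall fun t => ?_)
    rw [← smul_sub, norm_smul, Real.norm_eq_abs, abs_of_nonneg (φ.nonneg_normed t)]
    by_cases ht : t ∈ _root_.Metric.ball (0 : Model n) e
    · refine mul_le_mul_of_nonneg_left ?_ (φ.nonneg_normed t)
      rw [hh', indicator_of_mem (inB hz ht), indicator_of_mem (inB hy ht)]
      refine (hL _ (inB hy ht) _ (inB hz ht)).trans_eq ?_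
      congr 1; abel
    · have : φ.normed volume t = 0 := by
        rw [← Function.notMem_support, φ.support_normed_eq]; exact ht
      simp [this]
  refine ⟨k, hks, fun y hy => ?_, fun y hy v => ?_⟩
  · have hyB : y ∈ B := Metric.closedBall_subset_closedBall (by linarith)
      (Metric.ball_subset_closedBall hy)
    have h1 : dist (k y) (h' y) ≤ ε := by
      refine φ.dist_normed_convolution_le hloc.aestronglyMeasurable fun z hz => ?_
      have hz' : y - (y - z) ∈ B := inB hy (by
        rw [Metric.mem_ball, dist_eq_norm] at hz ⊢
        rwa [sub_zero, norm_sub_rev])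
      rw [sub_sub_cancel] at hz'
      rw [hh', indicator_of_mem hz', indicator_of_mem hyB]
      exact (hunif z hz' y hyB (hz.trans_le (min_le_left _ _))).le
    rwa [hh', indicator_of_mem hyB, Real.dist_eq] at h1
  · have h1 : HasDerivAt (fun s : ℝ => k (y + s • v)) (fderiv ℝ k y v) 0 := by
      have h2 : HasFDerivAt k (fderiv ℝ k y) (y + (0 : ℝ) • v) := by
        rw [zero_smul, add_zero]
        exact (hks.differentiable (by simp) y).hasFDerivAt
      have h3 : HasDerivAt (fun s : ℝ => y + s • v) v 0 := by
        simpa using ((hasDerivAt_id (0 : ℝ)).smul_const v).const_add y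
      exact h2.comp_hasDerivAt (0 : ℝ) h3
    refine h1.le_of_lip' (hp0 v) ?_
    have h4 : ∀ᶠ s : ℝ in 𝓝 0, y + s • v ∈ _root_.Metric.ball y₀ (r / 2) := by
      have : ContinuousAt (fun s : ℝ => y + s • v) 0 := by fun_prop
      refine this.eventually (Metric.isOpen_ball.mem_nhds ?_)
      simpa using hy
    filter_upwards [h4] with s hs
    have := klip y hy _ hs
    rw [add_sub_cancel_left, hp] at this
    simpa [mul_comm] using this

section Smoothing

variable {n : ℕ} {M : Type*} [TopologicalSpace M] [ChartedSpace (Model n) M]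
  [IsManifold (𝓡 n) ∞ M] {g : Metric n M}

local notation "Φ" => extChartAt (𝓡 n)

/-- The quadratic form of the metric in the chart around `c`, at the point with coordinates `y`. -/
def quad (g : Metric n M) (c : M) (y v : Model n) : ℝ := ∑ i, ∑ j, gMat g c y i j * v i * v j

lemma quad_smul (g : Metric n M) (c : M) (y v : Model n) (s : ℝ) :
    quad g c y (s • v) = s ^ 2 * quad g c y v := by
  simp only [quad, Finset.mul_sum]
  refine Finset.sum_congr rfl fun i _ => Finset.sum_congr rfl fun j _ => ?_
  simp; ring

lemma quad_pos (g : Metric n M) {c : M} {y v : Model n} (hy : y ∈ (Φ c).target) (hv : v ≠ 0) :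
    0 < quad g c y v := by
  rw [quad, ← mform_symmD]
  refine mform_pos g _ fun h0 => hv ?_
  have := DFunLike.congr_fun (chartD_comp_symmD hy) v
  rw [ContinuousLinearMap.comp_apply, h0, map_zero] at this
  exact this.symm

/-- In a small ball of a chart, the metric is comparable to the metric at the centre. -/
lemma exists_quad_le (hg : SmoothMetric g) {c : M} {y₀ : Model n} (hy₀ : y₀ ∈ (Φ c).target) :
    ∃ r > 0, _root_.Metric.closedBall y₀ r ⊆ (Φ c).target ∧
      ∀ y ∈ _root_.Metric.closedBall y₀ r, ∀ v,
        quad g c y v ≤ 2 * quad g c y₀ v ∧ quad g c y₀ v ≤ 2 * quad g c y v := by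
  have hcont : ContinuousOn (fun p : Model n × Model n => quad g c p.1 p.2)
      ((Φ c).target ×ˢ univ) := by
    refine continuousOn_finsetSum _ fun i _ => continuousOn_finsetSum _ fun j _ => ?_
    have h1 : ContinuousOn (fun p : Model n × Model n => gMat g c p.1 i j)
        ((Φ c).target ×ˢ univ) :=
      (hg c i j).continuousOn.comp continuousOn_fst fun p hp => hp.1
    exact (h1.mul (by fun_prop)).mul (by fun_prop)
  have hat : ∀ v, ContinuousAt (fun p : Model n × Model n => quad g c p.1 p.2) (y₀, v) := fun v =>
    hcont.continuousAt (((isOpen_target c).prod isOpen_univ).mem_nhds ⟨hy₀, mem_univ _⟩)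
  have hev : ∀ᶠ y in 𝓝 y₀, ∀ v ∈ _root_.Metric.sphere (0 : Model n) 1,
      quad g c y v < 2 * quad g c y₀ v ∧ quad g c y₀ v < 2 * quad g c y v := by
    refine (isCompact_sphere (0 : Model n) 1).eventually_forall_of_forall_eventually fun v hv => ?_
    have hv0 : v ≠ 0 := by
      rintro rfl
      simp at hv
    have hp := quad_pos g hy₀ hv0
    have h2 : ContinuousAt (fun p : Model n × Model n => quad g c y₀ p.2) (y₀, v) := by
      have : Continuous fun p : Model n × Model n => quad g c y₀ p.2 := by
        unfold quad; fun_prop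
      exact this.continuousAt
    exact ((hat v).eventually_lt (h2.const_mul 2) (by simp only; linarith)).and
      (h2.eventually_lt ((hat v).const_mul 2) (by simp only; linarith))
  obtain ⟨r, hr, h⟩ := Metric.nhds_basis_closedBall.mem_iff.1
    (inter_mem hev ((isOpen_target c).mem_nhds hy₀))
  refine ⟨r, hr, fun y hy => (h hy).2, fun y hy v => ?_⟩
  by_cases hv : v = 0
  · simp [hv, quad]
  have hvn : ‖v‖ ≠ 0 := norm_ne_zero_iff.2 hv
  have h1 := (h hy).1 (‖v‖⁻¹ • v) (by simp [norm_smul, hvn])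
  rw [quad_smul, quad_smul] at h1
  have h2 : 0 < (‖v‖⁻¹) ^ 2 := by positivity
  exact ⟨le_of_mul_le_mul_left (by linarith [h1.1]) h2,
    le_of_mul_le_mul_left (by linarith [h1.2]) h2⟩

/-- The Riemannian distance of two points in a small ball of a chart, estimated by the length of
the coordinate segment. -/
lemma rdist_symm_le {c : M} {y₀ : Model n} {r : ℝ}
    (hB : _root_.Metric.closedBall y₀ r ⊆ (Φ c).target)
    (hq : ∀ y ∈ _root_.Metric.closedBall y₀ r, ∀ v, quad g c y v ≤ 2 * quad g c y₀ v)
    {y z : Model n} (hy : y ∈ _root_.Metric.closedBall y₀ r)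
    (hz : z ∈ _root_.Metric.closedBall y₀ r) :
    rdist g ((Φ c).symm y) ((Φ c).symm z)
      ≤ ENNReal.ofReal (Real.sqrt (2 * quad g c y₀ (z - y))) := by
  set l : ℝ → Model n := fun t => y + t • (z - y) with hl
  have hlB : ∀ t ∈ Icc (0 : ℝ) 1, l t ∈ _root_.Metric.closedBall y₀ r := by
    intro t ht
    have := (convex_closedBall y₀ r).add_smul_sub_mem hy hz ht
    exact this
  have hlc : ContDiff ℝ ∞ l := by fun_prop
  have hγ : ContMDiffOn 𝓘(ℝ, ℝ) (𝓡 n) 1 (fun t => (Φ c).symm (l t)) (Icc 0 1) :=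
    (contMDiffOn_extChartAt_symm (I := 𝓡 n) (n := 1) c).comp
      ((hlc.of_le (by simp)).contMDiff.contMDiffOn) fun t ht => hB (hlB t ht)
  have h := rdist_le_lintegral g hγ
  have e0 : l 0 = y := by simp [hl]
  have e1 : l 1 = z := by simp [hl]
  simp only [e0, e1] at h
  refine h.trans ?_
  calc _ ≤ ∫⁻ _ in Ioo (0 : ℝ) 1, ENNReal.ofReal (Real.sqrt (2 * quad g c y₀ (z - y))) := by
        refine setLIntegral_mono' measurableSet_Ioo fun t ht => ?_
        have htI : t ∈ Icc (0 : ℝ) 1 := Ioo_subset_Icc_self ht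
        have h1 : mfderiv 𝓘(ℝ, ℝ) (𝓡 n) (fun t => (Φ c).symm (l t)) t (1 : ℝ)
            = symmD n c (l t) (z - y) := by
          have hd : HasMFDerivAt 𝓘(ℝ, ℝ) 𝓘(ℝ, Model n) l t (fderiv ℝ l t) :=
            ((hlc.differentiable (by simp)) t).hasFDerivAt.hasMFDerivAt
          have hs : HasMFDerivAt 𝓘(ℝ, Model n) (𝓡 n) (Φ c).symm (l t) (symmD n c (l t)) :=
            (mdifferentiableAt_symm (hB (hlB t htI))).hasMFDerivAt
          have h2 := (hs.comp t hd).mfderiv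
          have h3 : fderiv ℝ l t 1 = z - y := by
            have h4 : HasDerivAt l (z - y) t := by
              have := ((hasDerivAt_id t).smul_const (z - y)).const_add y
              rwa [one_smul] at this
            rw [h4.hasFDerivAt.fderiv]
            simp
          have h5 := DFunLike.congr_fun h2 (1 : ℝ)
          refine h5.trans ?_
          change symmD n c (l t) (fderiv ℝ l t 1) = _
          rw [h3]
        refine ENNReal.ofReal_le_ofReal (Real.sqrt_le_sqrt ?_)
        refine le_trans (le_of_eq ?_) (hq (l t) (hlB t htI) (z - y))
        rw [h1]
        exact mform_symmD g c (l t) (z - y) (z - y)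
    _ = _ := by simp

variable [T2Space M] [SecondCountableTopology M]

/-- A compactly supported function that is `1`-Lipschitz for the Riemannian distance is uniformly
close to a smooth function with bounded gradient. Local approximations are glued by a partition of
unity; the errors are small compared with the gradients of the partition. -/
theorem exists_smooth_of_lipschitz (hg : SmoothMetric g) {δ : M → ℝ} (hδc : Continuous δ)
    (hδs : HasCompactSupport δ)
    (hδ : ∀ x y, ENNReal.ofReal |δ y - δ x| ≤ rdist g x y) :
    ∃ s : M → ℝ, SM n s ∧ HasCompactSupport s ∧ (∀ x, |s x - δ x| ≤ 1 / 4) ∧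
      ∀ x, inn g s s x ≤ 9 := by
  have hlc : LocallyCompactSpace M := Manifold.locallyCompact_of_finiteDimensional (𝓡 n)
  choose r hr hrt hq using fun c : M => exists_quad_le hg (mem_tgt (n := n) c)
  set U : M → Set M := fun c =>
    (Φ c).source ∩ Φ c ⁻¹' _root_.Metric.ball (Φ c c) (r c / 2) with hU
  have hUo : ∀ c, IsOpen (U c) := fun c =>
    (continuousOn_extChartAt c).isOpen_inter_preimage (isOpen_source c) Metric.isOpen_ball
  have hUc : ∀ c, c ∈ U c := fun c =>
    ⟨mem_extChartAt_source c, Metric.mem_ball_self (half_pos (hr c))⟩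
  obtain ⟨t, ht⟩ := hδs.isCompact.elim_finite_subcover U hUo fun x _ => mem_iUnion.2 ⟨x, hUc x⟩
  obtain ⟨χ, hχ⟩ := SmoothPartitionOfUnity.exists_isSubordinate (𝓡 n) (isClosed_tsupport δ)
    (fun c : t => U c) (fun c => hUo c) fun x hx => by
      obtain ⟨c, hc, hx⟩ := mem_iUnion₂.1 (ht hx)
      exact mem_iUnion.2 ⟨⟨c, hc⟩, hx⟩
  have sχ : ∀ c, SM n (χ c) := fun c => SM.of_contMDiff (χ c).contMDiff
  have χ0 : ∀ c x, 0 ≤ χ c x := fun c x => χ.nonneg c x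
  have χs : ∀ x, ∑ c, χ c x ≤ 1 := fun x => by
    rw [← finsum_eq_sum_of_fintype]; exact χ.sum_le_one x
  have χ1 : ∀ x ∈ tsupport δ, ∑ c, χ c x = 1 := fun x hx => by
    rw [← finsum_eq_sum_of_fintype]; exact χ.sum_eq_one hx
  have χK : ∀ c, HasCompactSupport (χ c) := fun c => by
    have hK : IsCompact ((Φ (c : M)).symm '' _root_.Metric.closedBall (Φ (c : M) c) (r c)) :=
      (isCompact_closedBall _ _).image_of_continuousOn
        ((continuousOn_extChartAt_symm (c : M)).mono (hrt c))
    refine HasCompactSupport.of_support_subset_isCompact hK fun x hx => ?_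
    have hx' := hχ c (subset_tsupport _ hx)
    exact ⟨Φ (c : M) x, Metric.closedBall_subset_closedBall (by linarith [hr (c : M)])
      (Metric.ball_subset_closedBall hx'.2), (Φ (c : M)).left_inv hx'.1⟩
  have hDex : ∀ c, ∃ D : ℝ, 0 ≤ D ∧ ∀ x, inn g (χ c) (χ c) x ≤ D ^ 2 := fun c => by
    obtain ⟨D, hD⟩ := (SM.inn hg (sχ c) (sχ c)).continuous.bounded_above_of_compact_support
      (hasCompactSupport_inn (χK c))
    refine ⟨Real.sqrt |D|, Real.sqrt_nonneg _, fun x => ?_⟩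
    rw [Real.sq_sqrt (abs_nonneg D)]
    exact (le_abs_self _).trans ((hD x).trans (le_abs_self D))
  choose D hD0 hD using hDex
  set ε : ℝ := min (1 / 4) (1 / (1 + ∑ c, D c)) with hε
  have hDs : 0 ≤ ∑ c, D c := Finset.sum_nonneg fun c _ => hD0 c
  have hε0 : 0 < ε := lt_min (by norm_num) (by positivity)
  have hεD : ε * ∑ c, D c ≤ 1 := by
    have h1 : ε ≤ 1 / (1 + ∑ c, D c) := min_le_right _ _
    rw [le_div_iff₀ (by positivity)] at h1
    nlinarith
  -- the local approximations
  have hloc : ∀ c : M, ∃ k : Model n → ℝ, ContDiff ℝ ∞ k ∧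
      (∀ y ∈ _root_.Metric.ball (Φ c c) (r c / 2), |k y - localRep δ c y| ≤ ε) ∧
      ∀ y ∈ _root_.Metric.ball (Φ c c) (r c / 2), ∀ v,
        |fderiv ℝ k y v| ≤ Real.sqrt (2 * quad g c (Φ c c) v) := fun c => by
    refine exists_smooth_approx (hδc.comp_continuousOn
      ((continuousOn_extChartAt_symm c).mono (hrt c))) (fun s v => ?_) (fun v => Real.sqrt_nonneg _)
      (fun y hy z hz => ?_) (hr c) hε0
    · rw [quad_smul, ← Real.sqrt_sq_eq_abs, ← Real.sqrt_mul (sq_nonneg s)]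
      congr 1; ring
    · have h1 := (hδ ((Φ c).symm y) ((Φ c).symm z)).trans
        (rdist_symm_le (hrt c) (fun y hy v => (hq c y hy v).1) hy hz)
      exact (ENNReal.ofReal_le_ofReal_iff (Real.sqrt_nonneg _)).1 h1
  choose k hk hkδ hkd using hloc
  set F : M → M → ℝ := fun c x => k c (Φ c x) with hF
  have Fδ : ∀ c, ∀ x ∈ U c, |F c x - δ x| ≤ ε := fun c x hx => by
    have := hkδ c (Φ c x) hx.2
    rwa [localRep_chart δ hx.1] at this
  have sw : ∀ c, SM n fun x => χ c x * F c x := fun c =>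
    SM.of_contMDiff (χ.contMDiff_smul fun x hx =>
      (hk c).contMDiff.contMDiffAt.comp x (contMDiffAt_extChartAt' (by
        rw [← extChartAt_source (𝓡 n)]; exact (hχ c hx).1)))
  set s : M → ℝ := fun x => ∑ c, χ c x * F c x with hs
  have ss : SM n s := SM.sum fun c _ => sw c
  refine ⟨s, ss, ?_, fun x => ?_, fun x => ?_⟩
  · refine HasCompactSupport.of_support_subset_isCompact
      (isCompact_iUnion fun c => (χK c).isCompact) fun x hx => ?_
    obtain ⟨c, -, hc⟩ := Finset.exists_ne_zero_of_sum_ne_zero hx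
    exact mem_iUnion.2 ⟨c, subset_tsupport _ (left_ne_zero_of_mul hc)⟩
  · have h1 : s x - δ x = ∑ c, χ c x * (F c x - δ x) := by
      simp only [mul_sub, Finset.sum_sub_distrib, ← Finset.sum_mul]
      by_cases hx : x ∈ tsupport δ
      · rw [χ1 x hx, one_mul]
      · rw [image_eq_zero_of_notMem_tsupport hx, mul_zero]
    rw [h1]
    calc |∑ c, χ c x * (F c x - δ x)| ≤ ∑ c, |χ c x * (F c x - δ x)| :=
          Finset.abs_sum_le_sum_abs _ _
      _ ≤ ∑ c, χ c x * ε := by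
          refine Finset.sum_le_sum fun c _ => ?_
          rw [abs_mul, abs_of_nonneg (χ0 c x)]
          by_cases hx : x ∈ tsupport (χ c)
          · exact mul_le_mul_of_nonneg_left (Fδ c x (hχ c hx)) (χ0 c x)
          · rw [image_eq_zero_of_notMem_tsupport hx, zero_mul, zero_mul]
      _ ≤ 1 * ε := by
          rw [← Finset.sum_mul]; exact mul_le_mul_of_nonneg_right (χs x) hε0.le
      _ ≤ 1 / 4 := by rw [one_mul]; exact min_le_left _ _
  · set N := Real.sqrt (inn g s s x) with hN
    have hN2 : N ^ 2 = inn g s s x := Real.sq_sqrt (inn_self_nonneg hg)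
    have hN0 : 0 ≤ N := Real.sqrt_nonneg _
    have hcs : ∀ {v : M → ℝ} {B : ℝ}, 0 ≤ B → inn g v v x ≤ B ^ 2 → |inn g s v x| ≤ N * B := by
      intro v B hB h
      refine abs_le_of_sq_le_sq ?_ (mul_nonneg hN0 hB)
      rw [mul_pow, hN2]
      exact (inn_sq_le hg).trans (mul_le_mul_of_nonneg_left h (inn_self_nonneg hg))
    have e1 : inn g s s x = ∑ c, inn g s (fun z => χ c z * F c z) x := by
      rw [← inn_sum_right fun c _ => sw c]
    -- the gradient of `∑ χ` vanishes where `δ ≠ 0`, as `∑ χ` is maximal there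
    have e2 : (∑ c, inn g s (χ c) x) * δ x = 0 := by
      by_cases hx : x ∈ tsupport δ
      · rw [← inn_sum_right fun c _ => sχ c]
        have hmax : IsLocalMax (localRep (n := n) (fun z => ∑ c, χ c z) x) (Φ x x) :=
          Eventually.of_forall fun z => by
            change ∑ c, χ c _ ≤ ∑ c, χ c _
            rw [extChartAt_to_inv, χ1 x hx]; exact χs _
        have h0 : ∀ j, pd j (localRep (n := n) (fun z => ∑ c, χ c z) x) (Φ x x) = 0 := fun j => by
          rw [pd, hmax.fderiv_eq_zero]; rfl
        simp only [inn, innE, h0, mul_zero, Finset.sum_const_zero, zero_mul]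
      · rw [image_eq_zero_of_notMem_tsupport hx, mul_zero]
    -- `⟨∇s, ∇(χF)⟩ - δ ⟨∇s, ∇χ⟩ = χ ⟨∇s, ∇F⟩ + (F - δ) ⟨∇s, ∇χ⟩`, where `|∇F| ≤ 2` and `|F - δ| ≤ ε`
    have e3 : ∀ c, inn g s (fun z => χ c z * F c z) x - inn g s (χ c) x * δ x
        ≤ N * (2 * χ c x) + N * (ε * D c) := by
      intro c
      by_cases hx : x ∈ tsupport (χ c)
      · have hxU := hχ c hx
        have hov : Φ x x ∈ ovl n x (c : M) := chart_mem_ovl (mem_extChartAt_source x) hxU.1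
        have hlr : ∀ z ∈ (Φ (c : M)).target, localRep (n := n) (F c) (c : M) z = k c z :=
          fun z hz => by simp only [hF, localRep, (Φ (c : M)).right_inv hz]
        have hcx : chg n x (c : M) (Φ x x) = Φ (c : M) x := chg_chart _ (mem_extChartAt_source x)
        have htc : Φ (c : M) x ∈ (Φ (c : M)).target := (Φ (c : M)).map_source hxU.1
        have hev : localRep (n := n) (F c) (c : M) =ᶠ[𝓝 (Φ (c : M) x)] k c :=
          eventually_of_mem ((isOpen_target (c : M)).mem_nhds htc) hlr
        have hdk : DifferentiableAt ℝ (localRep (n := n) (F c) (c : M)) (Φ (c : M) x) :=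
          ((hk c).differentiable (by simp) _).congr_of_eventuallyEq hev
        have hdF : DifferentiableAt ℝ (localRep (n := n) (F c) x) (Φ x x) := by
          have hd : DifferentiableAt ℝ (chg n x (c : M)) (Φ x x) :=
            ((contDiffOn_chg x (c : M)).contDiffAt ((isOpen_ovl x (c : M)).mem_nhds
              hov)).differentiableAt (by simp)
          exact ((hk c).differentiable (by simp) _).comp (Φ x x) hd
        have hFF : inn g (F c) (F c) x ≤ 2 ^ 2 := by
          rw [inn, innE_chg hov (by rwa [hcx]) (by rwa [hcx]), hcx]
          set P := innE (gMat g (c : M)) (localRep (F c) (c : M)) (localRep (F c) (c : M))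
            (Φ (c : M) x) with hP
          have hP0 : 0 ≤ P := (hg.isMetricOn (c : M)).innE_self_nonneg htc
          set W : Model n := WithLp.toLp 2 fun i =>
            gradV (gMat g (c : M)) (localRep (F c) (c : M)) i (Φ (c : M) x) with hW
          have h1 : quad g (c : M) (Φ (c : M) x) W = P :=
            (hg.isMetricOn (c : M)).sum_gradV_gradV htc
          have h2 : fderiv ℝ (k c) (Φ (c : M) x) W = P := by
            rw [← hev.fderiv_eq]
            conv_lhs => rw [eq_sum_single W]
            rw [map_sum, hP]
            simp only [map_smul, smul_eq_mul]
            exact ((hg.isMetricOn (c : M)).sum_gradV_mul htc _).symm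
          have h3 := hkd c (Φ (c : M) x) hxU.2 W
          have h4 := (hq c (Φ (c : M) x) (Metric.closedBall_subset_closedBall
            (by linarith [hr (c : M)]) (Metric.ball_subset_closedBall hxU.2)) W).2
          rw [h2] at h3
          rw [h1] at h4
          have h5 := Real.sqrt_le_sqrt (show 2 * quad g (c : M) (Φ (c : M) c) W ≤ 4 * P by linarith)
          have h6 : P ^ 2 ≤ 4 * P := by
            have h7 := (le_abs_self P).trans (h3.trans h5)
            have h8 := pow_le_pow_left₀ hP0 h7 2
            rwa [Real.sq_sqrt (by positivity)] at h8
          nlinarith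
        rw [inn_mul_right_of_differentiableAt ((sχ c).diffAt (mem_tgt x)) hdF]
        have b1 := (le_abs_self _).trans (hcs (by norm_num) hFF)
        have b2 := hcs (hD0 c) (hD c x)
        have b3 : (F c x - δ x) * inn g s (χ c) x ≤ ε * (N * D c) := by
          refine (le_abs_self _).trans ?_
          rw [abs_mul]
          exact mul_le_mul (Fδ c x hxU) b2 (abs_nonneg _) hε0.le
        have b4 := mul_le_mul_of_nonneg_left b1 (χ0 c x)
        linarith
      · have h1 : (fun z => χ c z * F c z) =ᶠ[𝓝 x] fun _ => 0 := by
          filter_upwards [(isClosed_tsupport (χ c)).isOpen_compl.mem_nhds hx] with z hz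
          rw [image_eq_zero_of_notMem_tsupport hz, zero_mul]
        rw [inn_congr_right h1, inn_const_right, inn_eq_zero_of_notMem_tsupport hx, zero_mul,
          sub_zero]
        have := χ0 c x
        have := hD0 c
        positivity
    have e4 : N ^ 2 ≤ N * 2 + N * 1 := by
      have h1 : N ^ 2 = ∑ c, (inn g s (fun z => χ c z * F c z) x - inn g s (χ c) x * δ x) := by
        rw [Finset.sum_sub_distrib, ← Finset.sum_mul, e2, sub_zero, hN2, e1]
      rw [h1]
      refine (Finset.sum_le_sum fun c _ => e3 c).trans ?_
      rw [Finset.sum_add_distrib, ← Finset.mul_sum, ← Finset.mul_sum, ← Finset.mul_sum,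
        ← Finset.mul_sum]
      exact add_le_add (mul_le_mul_of_nonneg_left (by linarith [χs x]) hN0)
        (mul_le_mul_of_nonneg_left hεD hN0)
    rw [← hN2]
    nlinarith

end Smoothing


section Cutoffs

variable {n : ℕ} {M : Type*} [TopologicalSpace M] [ChartedSpace (Model n) M]
  [IsManifold (𝓡 n) ∞ M] {g g' : Metric n M} {C c : ℝ}

local notation "Φ" => extChartAt (𝓡 n)

/-! ### Cutoff functions on complete manifolds -/

/-- Cutoff functions remain cutoff functions for a larger metric. -/
lemma IsCutoff.of_inner_le {η : ℕ → M → ℝ} (hη : IsCutoff g η C) (hg : SmoothMetric g)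
    (hg' : SmoothMetric g') (hc : 0 < c)
    (h : ∀ (x : M) (v : TangentSpace (𝓡 n) x), g.inner x v v ≤ c * g'.inner x v v) :
    IsCutoff g' η (c * C) := by
  refine ⟨hη.smooth, hη.compact, hη.nonneg, hη.le_one, hη.eventually_one, fun k x => ?_⟩
  set X : Model n := WithLp.toLp 2 fun i => gradV (gMat g x) (localRep (η k) x) i (Φ x x) with hX
  set W : Model n := WithLp.toLp 2 fun i => gradV (gMat g' x) (localRep (η k) x) i (Φ x x) with hW
  set m : Model n → Model n → ℝ := fun v w => ∑ i, ∑ j, gMat g x (Φ x x) i j * v i * w j with hm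
  have hmf : ∀ v w, mform g x (symmD n x (Φ x x) v) (symmD n x (Φ x x) w) = m v w :=
    mform_symmD_self g x
  have hXX : m X X = inn g (η k) (η k) x := (hg.isMetricOn x).sum_gradV_gradV (mem_tgt x)
  have hXW : m X W = inn g' (η k) (η k) x := by
    have h1 : ∀ j, ∑ i, gMat g x (Φ x x) i j * X i = pd j (localRep (η k) x) (Φ x x) := fun j => by
      have h2 := (hg.isMetricOn x).sum_gradV_mul (u := localRep (η k) x) (mem_tgt x)
        (fun i => gMat g x (Φ x x) i j)
      have h3 := (hg.isMetricOn x).inv_mul (mem_tgt x)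
      calc _ = ∑ i, gradV (gMat g x) (localRep (η k) x) i (Φ x x) * gMat g x (Φ x x) i j :=
            Finset.sum_congr rfl fun i _ => mul_comm _ _
        _ = ∑ i, ∑ l, (gMat g x (Φ x x))⁻¹ i l * pd i (localRep (η k) x) (Φ x x)
              * gMat g x (Φ x x) l j := h2.symm
        _ = ∑ i, (1 : Matrix (Fin n) (Fin n) ℝ) i j * pd i (localRep (η k) x) (Φ x x) := by
            refine Finset.sum_congr rfl fun i _ => ?_
            rw [← h3, Matrix.mul_apply, Finset.sum_mul]
            exact Finset.sum_congr rfl fun l _ => by ring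
        _ = _ := by simp [Matrix.one_apply]
    calc m X W = ∑ j, W j * pd j (localRep (η k) x) (Φ x x) := by
          simp only [hm]
          rw [Finset.sum_comm]
          refine Finset.sum_congr rfl fun j _ => ?_
          rw [← Finset.sum_mul, h1, mul_comm]
      _ = _ := ((hg'.isMetricOn x).sum_gradV_mul (mem_tgt x) _).symm
  have hWW : m W W ≤ c * inn g' (η k) (η k) x := by
    have h1 : ∑ i, ∑ j, gMat g' x (Φ x x) i j * W i * W j = inn g' (η k) (η k) x :=
      (hg'.isMetricOn x).sum_gradV_gradV (mem_tgt x)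
    rw [← h1, ← hmf, ← mform_symmD_self g' x]
    exact h x _
  -- with `X = ∇η` and `W = ∇'η`, expand `0 ≤ |W - cX|²` and use `⟨X, W⟩ = dη(W) = |∇'η|'²`
  have h0 : 0 ≤ m (W - c • X) (W - c • X) := by
    rw [← hmf]
    by_cases hz : symmD n x (Φ x x) (W - c • X) = 0
    · rw [hz, map_zero]
    · exact (mform_pos g x hz).le
  have h1 : m (W - c • X) (W - c • X) = m W W - 2 * c * m X W + c ^ 2 * m X X := by
    rw [← hmf, ← hmf, ← hmf, ← hmf]
    simp only [map_sub, map_smul, _root_.sub_apply, _root_.smul_apply, smul_eq_mul]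
    rw [mform_symm g x (symmD n x (Φ x x) W) (symmD n x (Φ x x) X)]
    ring
  have h2 := hη.grad k x
  rw [h1, hXX, hXW] at h0
  have h3 : c * inn g' (η k) (η k) x ≤ c * (c * inn g (η k) (η k) x) := by nlinarith
  exact (le_of_mul_le_mul_left h3 hc).trans (mul_le_mul_of_nonneg_left h2 hc.le)

variable [T2Space M] [SecondCountableTopology M] [ConnectedSpace M]

/-- A complete manifold has a sequence of cutoff functions: the functions `max(0, k + 2 - d)`, where
`d` is the distance of a fixed point, are smoothed and composed with a smooth step function. -/
theorem exists_isCutoff (hg : SmoothMetric g) (hc : IsCompleteMetric g) :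
    ∃ (η : ℕ → M → ℝ) (C : ℝ), IsCutoff g η C := by
  obtain ⟨x₀⟩ : Nonempty M := inferInstance
  set d : M → ℝ := fun x => (rdist g x₀ x).toReal with hd
  have hdc : Continuous d := by
    refine continuous_iff_continuousAt.2 fun x => ?_
    exact (ENNReal.tendsto_toReal (rdist_lt_top g x₀ x).ne).comp (continuous_rdist g x₀).continuousAt
  have hdl : ∀ x y, d y - d x ≤ (rdist g x y).toReal := fun x y => by
    have h1 := ENNReal.toReal_mono (ENNReal.add_ne_top.2
      ⟨(rdist_lt_top g x₀ x).ne, (rdist_lt_top g x y).ne⟩) (rdist_triangle g x₀ x y)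
    rw [ENNReal.toReal_add (rdist_lt_top g x₀ x).ne (rdist_lt_top g x y).ne] at h1
    simp only [hd]; linarith
  set δ : ℕ → M → ℝ := fun k x => max 0 (k + 2 - d x) with hδ
  have hδl : ∀ k x y, ENNReal.ofReal |δ k y - δ k x| ≤ rdist g x y := fun k x y => by
    rw [← ENNReal.ofReal_toReal (rdist_lt_top g x y).ne]
    refine ENNReal.ofReal_le_ofReal ?_
    have h1 : |δ k y - δ k x| ≤ |(k + 2 - d y) - (k + 2 - d x)| := by
      have := abs_max_sub_max_le_abs (k + 2 - d y) (k + 2 - d x) 0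
      simpa only [hδ, max_comm (0 : ℝ)] using this
    refine h1.trans (abs_le.2 ⟨?_, ?_⟩)
    · linarith [hdl x y]
    · have := hdl y x
      rw [rdist_comm] at this
      linarith
  have hδK : ∀ k, HasCompactSupport (δ k) := fun k => by
    refine HasCompactSupport.of_support_subset_isCompact
      (isCompact_rdist_le hc x₀ (k + 2)) fun x hx => ?_
    by_contra h
    refine hx (max_eq_left ?_)
    have h1 : ((k + 2 : ℝ≥0) : ℝ≥0∞) < rdist g x₀ x := not_le.1 h
    have h2 := (ENNReal.toReal_lt_toReal ENNReal.coe_ne_top (rdist_lt_top g x₀ x).ne).2 h1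
    simp only [ENNReal.coe_toReal] at h2
    push_cast at h2
    simp only [hd]; linarith
  have hδc : ∀ k, Continuous (δ k) := fun k => by fun_prop
  choose s hs hsK hsδ hsg using fun k => exists_smooth_of_lipschitz hg (hδc k) (hδK k) (hδl k)
  -- the smoothings `s k` are at distance at most `1/4` from functions that are at least `2` on the
  -- ball of radius `k`; the step function `1 - β` is `0` near `0`, and `1` beyond `3/2`
  let β : ContDiffBump (0 : ℝ) := ⟨1 / 2, 3 / 2, by norm_num, by norm_num⟩
  set φ : ℝ → ℝ := fun r => 1 - β r with hφ
  have hφs : ContDiff ℝ ∞ φ := contDiff_const.sub β.contDiff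
  obtain ⟨D, hD⟩ := (β.contDiff (n := 1).continuous_deriv le_rfl).bounded_above_of_compact_support
    β.hasCompactSupport.deriv
  have hφ' : ∀ r, HasDerivAt φ (-deriv β r) r := fun r => by
    have := ((β.contDiff (n := 1)).differentiable (by simp) r).hasDerivAt.const_sub 1
    exact this
  refine ⟨fun k x => φ (s k x), D ^ 2 * 9, fun k => SM.comp hφs (hs k), fun k => ?_, fun k x => ?_,
    fun k x => ?_, fun x => ?_, fun k x => ?_⟩
  · refine (hsK k).comp_left (g := φ) ?_
    have : β 0 = 1 := β.one_of_mem_closedBall (by simp [β])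
    simp [hφ, this]
  · simp only [hφ]; linarith [β.le_one (x := s k x)]
  · simp only [hφ]; linarith [β.nonneg (x := s k x)]
  · obtain ⟨N, hN⟩ := exists_nat_gt (d x)
    filter_upwards [eventually_ge_atTop N] with k hk
    have hk' : (N : ℝ) ≤ k := by exact_mod_cast hk
    have hx : ∀ᶠ z in 𝓝 x, d z < k := hdc.continuousAt.eventually_lt_const (by linarith)
    filter_upwards [hx] with z hz
    have h1 : 2 ≤ δ k z := le_max_of_le_right (by linarith)
    have h2 := (abs_le.1 (hsδ k z)).1
    have h3 : β (s k z) = 0 := β.zero_of_le_dist (by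
      rw [Real.dist_eq, sub_zero]
      exact le_trans (by simp only [β]; linarith) (le_abs_self _))
    simp [hφ, h3]
  · have h1 : ∀ w : M → ℝ, inn g w (fun z => φ (s k z)) x = -deriv β (s k x) * inn g w (s k) x :=
      fun w => inn_comp_right (hφ' _) (hs k)
    rw [h1, inn_comm hg, h1, ← mul_assoc]
    have h2 : -deriv β (s k x) * -deriv β (s k x) ≤ D ^ 2 := by
      have h3 := abs_le.1 (hD (s k x))
      nlinarith
    exact mul_le_mul h2 (hsg k x) (inn_self_nonneg hg) (sq_nonneg D)

end Cutoffs

section Flow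

variable {n : ℕ} {M : Type*} [TopologicalSpace M] [ChartedSpace (Model n) M]
  [IsManifold (𝓡 n) ∞ M] {g : ℝ → Metric n M} {t₀ t₁ a b Λ : ℝ}

lemma IsRicciFlow.smoothMetric (hg : IsRicciFlow g t₀ t₁) {t : ℝ} (ht : t ∈ Ico t₀ t₁) :
    SmoothMetric (g t) := fun c i j =>
  (hg.smooth c i j).comp (contDiff_prodMk_right t).contDiffOn fun _ hy => ⟨ht, hy⟩

/-- Under an upper Ricci bound, the metrics of the flow are bounded below by the initial one. -/
lemma IsRicciFlow.inner_le (hg : IsRicciFlow g t₀ t₁) (h₀ : t₀ ≤ a) (h₁ : b < t₁)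
    (hΛ : ∀ t ∈ Icc a b, ∀ (x : M) (v : TangentSpace (𝓡 n) x),
      ricci (g t) x v v ≤ Λ * (g t).inner x v v) {t : ℝ} (ht : t ∈ Icc a b) (x : M)
    (v : TangentSpace (𝓡 n) x) :
    (g a).inner x v v ≤ Real.exp (2 * Λ * (t - a)) * (g t).inner x v v := by
  set F : ℝ → ℝ := fun s => Real.exp (2 * Λ * (s - a)) * (g s).inner x v v with hF
  have hsub : ∀ s ∈ Icc a b, s ∈ Ico t₀ t₁ := fun s hs => ⟨h₀.trans hs.1, hs.2.trans_lt h₁⟩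
  have hE : ∀ s, HasDerivAt (fun s => Real.exp (2 * Λ * (s - a)))
      (Real.exp (2 * Λ * (s - a)) * (2 * Λ)) s := fun s => by
    have := (((hasDerivAt_id s).sub_const a).const_mul (2 * Λ)).exp
    simpa using this
  have hder : ∀ s ∈ Icc a b, HasDerivWithinAt F (Real.exp (2 * Λ * (s - a)) * (2 * Λ)
      * (g s).inner x v v + Real.exp (2 * Λ * (s - a)) * (-2 * ricci (g s) x v v)) (Icc a b) s :=
    fun s hs => (hE s).hasDerivWithinAt.mul ((hg.flow s (hsub s hs) x v v).mono hsub)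
  have hmono : MonotoneOn F (Icc a b) := by
    refine monotoneOn_of_hasDerivWithinAt_nonneg (convex_Icc a b)
      (fun s hs => (hder s hs).continuousWithinAt)
      (fun s hs => (hder s (interior_subset hs)).mono interior_subset) fun s hs => ?_
    have h1 := hΛ s (interior_subset hs) x v
    have h2 := Real.exp_pos (2 * Λ * (s - a))
    nlinarith
  have h3 := hmono ⟨le_rfl, ht.1.trans ht.2⟩ ht ht.1
  simpa [hF] using h3

/-- Cutoff functions with gradients that are uniformly bounded along a Ricci flow with bounded Ricci
curvature. -/
theorem IsRicciFlow.exists_isCutoff [T2Space M] [SecondCountableTopology M] [ConnectedSpace M]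
    (hg : IsRicciFlow g t₀ t₁) (h₀ : t₀ ≤ a) (hab : a ≤ b) (h₁ : b < t₁)
    (hΛ : ∀ t ∈ Icc a b, ∀ (x : M) (v : TangentSpace (𝓡 n) x),
      ricci (g t) x v v ≤ Λ * (g t).inner x v v) :
    ∃ (η : ℕ → M → ℝ) (C : ℝ), ∀ t ∈ Icc a b, IsCutoff (g t) η C := by
  have hsub : ∀ s ∈ Icc a b, s ∈ Ico t₀ t₁ := fun s hs => ⟨h₀.trans hs.1, hs.2.trans_lt h₁⟩
  have ha : a ∈ Icc a b := ⟨le_rfl, hab⟩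
  obtain ⟨η, C, hη⟩ := RicciHeat.exists_isCutoff (hg.smoothMetric (hsub a ha))
    (hg.complete a (hsub a ha))
  refine ⟨η, Real.exp (2 * |Λ| * (b - a)) * C, fun t ht => ?_⟩
  refine hη.of_inner_le (hg.smoothMetric (hsub a ha)) (hg.smoothMetric (hsub t ht))
    (Real.exp_pos _) fun x v => (hg.inner_le h₀ h₁ hΛ ht x v).trans ?_
  have h1 : 0 ≤ (g t).inner x v v := by
    by_cases hv : v = 0
    · simp [hv]
    · exact ((g t).pos x v hv).le
  refine mul_le_mul_of_nonneg_right (Real.exp_le_exp.2 ?_) h1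
  have h2 : Λ * (t - a) ≤ |Λ| * (b - a) :=
    mul_le_mul (le_abs_self Λ) (by linarith [ht.2]) (by linarith [ht.1]) (abs_nonneg Λ)
  linarith

end Flow


/-! ### Mixed derivatives in space and time -/

section Mixed

variable {n : ℕ} {P : ℝ × Model n → ℝ} {I : Set ℝ} {U : Set (Model n)} {t : ℝ} {y : Model n}

lemma hasFDerivAt_slice (hI : IsOpen I) (hU : IsOpen U) (hP : ContDiffOn ℝ ∞ P (I ×ˢ U))
    (ht : t ∈ I) (hy : y ∈ U) : HasFDerivAt P (fderiv ℝ P (t, y)) (t, y) :=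
  ((hP.contDiffAt ((hI.prod hU).mem_nhds ⟨ht, hy⟩)).differentiableAt (by simp)).hasFDerivAt

lemma hasDerivAt_time (hI : IsOpen I) (hU : IsOpen U) (hP : ContDiffOn ℝ ∞ P (I ×ˢ U))
    (ht : t ∈ I) (hy : y ∈ U) : HasDerivAt (fun s => P (s, y)) (fderiv ℝ P (t, y) (1, 0)) t :=
  (hasFDerivAt_slice hI hU hP ht hy).comp_hasDerivAt t
    ((hasDerivAt_id t).prodMk (hasDerivAt_const t y))

lemma pd_slice (hI : IsOpen I) (hU : IsOpen U) (hP : ContDiffOn ℝ ∞ P (I ×ˢ U))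
    (ht : t ∈ I) (hy : y ∈ U) (i : Fin n) :
    pd i (fun z => P (t, z)) y = fderiv ℝ P (t, y) (0, EuclideanSpace.single i 1) := by
  have h := (hasFDerivAt_slice hI hU hP ht hy).comp y
    ((hasFDerivAt_const t y).prodMk (hasFDerivAt_id y))
  have h2 := h.fderiv
  simp only [Function.comp_def] at h2
  rw [pd, h2]
  simp

lemma contDiffOn_fderiv_apply (hI : IsOpen I) (hU : IsOpen U) (hP : ContDiffOn ℝ ∞ P (I ×ˢ U))
    (v : ℝ × Model n) : ContDiffOn ℝ ∞ (fun p => fderiv ℝ P p v) (I ×ˢ U) :=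
  (hP.fderiv_of_isOpen (m := ∞) (hI.prod hU) (by simp)).clm_apply contDiffOn_const

/-- Derivatives in space and in time commute. -/
lemma hasDerivAt_pd (hI : IsOpen I) (hU : IsOpen U) (hP : ContDiffOn ℝ ∞ P (I ×ˢ U))
    (ht : t ∈ I) (hy : y ∈ U) (i : Fin n) :
    HasDerivAt (fun s => pd i (fun z => P (s, z)) y)
      (pd i (fun z => fderiv ℝ P (t, z) (1, 0)) y) t := by
  have hv := fun v => contDiffOn_fderiv_apply hI hU hP v
  have h1 : HasDerivAt (fun s => pd i (fun z => P (s, z)) y)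
      (fderiv ℝ (fun p => fderiv ℝ P p (0, EuclideanSpace.single i 1)) (t, y) (1, 0)) t := by
    refine (hasDerivAt_time hI hU (hv (0, EuclideanSpace.single i 1)) ht hy).congr_of_eventuallyEq ?_
    filter_upwards [hI.mem_nhds ht] with s hs using pd_slice hI hU hP hs hy i
  rw [pd_slice (P := fun p => fderiv ℝ P p (1, 0)) hI hU (hv _) ht hy]
  convert h1 using 1
  have hc : ContDiffAt ℝ ∞ P (t, y) := hP.contDiffAt ((hI.prod hU).mem_nhds ⟨ht, hy⟩)
  have h2 : DifferentiableAt ℝ (fderiv ℝ P) (t, y) :=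
    (hc.fderiv_right (m := 1) (by rw [one_add_one_eq_two]; exact two_le_infty)).differentiableAt
      (by simp)
  have h3 : IsSymmSndFDerivAt ℝ P (t, y) := hc.isSymmSndFDerivAt (by simpa using two_le_infty)
  have key : ∀ v w : ℝ × Model n, fderiv ℝ (fun z => fderiv ℝ P z v) (t, y) w
      = fderiv ℝ (fderiv ℝ P) (t, y) w v := by
    intro v w
    rw [fderiv_clm_apply h2 (differentiableAt_const v)]
    simp
  rw [key, key]
  exact h3 _ _

end Mixed

section SpaceTime

variable {n : ℕ} {M : Type*} [TopologicalSpace M] [ChartedSpace (Model n) M]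

local notation "Φ" => extChartAt (𝓡 n)

/-! ### Smooth functions on space-time -/

variable (n) in
/-- Families of functions on `M` that are jointly smooth in time and space. -/
def STS (I : Set ℝ) (F : ℝ → M → ℝ) : Prop :=
  ∀ c : M, ContDiffOn ℝ ∞ (fun p : ℝ × Model n => F p.1 ((Φ c).symm p.2)) (I ×ˢ (Φ c).target)

variable {I : Set ℝ} {F H : ℝ → M → ℝ} {t : ℝ} {x : M}

namespace STS

lemma sm (hF : STS n I F) (ht : t ∈ I) : SM n (F t) := fun c =>
  (hF c).comp (contDiff_prodMk_right t).contDiffOn fun _ hy => ⟨ht, hy⟩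

lemma of_sm {u : M → ℝ} (hu : SM n u) : STS n I fun _ => u := fun c =>
  (hu c).comp contDiffOn_snd fun _ hp => hp.2

lemma mul (hF : STS n I F) (hH : STS n I H) : STS n I fun t x => F t x * H t x := fun c =>
  (hF c).mul (hH c)

lemma hasDerivAt (hI : IsOpen I) (hF : STS n I F) (ht : t ∈ I) (x : M) :
    HasDerivAt (fun s => F s x) (deriv (fun s => F s x) t) t := by
  have h := hasDerivAt_time hI (isOpen_target x) (hF x) ht (mem_tgt x)
  simp only [extChartAt_to_inv] at h
  exact h.differentiableAt.hasDerivAt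

lemma fderiv_time (hI : IsOpen I) (hF : STS n I F) (ht : t ∈ I) {c : M} {y : Model n}
    (hy : y ∈ (Φ c).target) :
    fderiv ℝ (fun p : ℝ × Model n => F p.1 ((Φ c).symm p.2)) (t, y) (1, 0)
      = deriv (fun s => F s ((Φ c).symm y)) t :=
  (hasDerivAt_time hI (isOpen_target c) (hF c) ht hy).deriv.symm

lemma deriv (hI : IsOpen I) (hF : STS n I F) : STS n I fun t x => deriv (fun s => F s x) t :=
  fun c => (contDiffOn_fderiv_apply hI (isOpen_target c) (hF c) (1, 0)).congr fun _ hp =>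
    (fderiv_time hI hF hp.1 hp.2).symm

lemma pd (hI : IsOpen I) (hF : STS n I F) (c : M) (i : Fin n) :
    ContDiffOn ℝ ∞ (fun p : ℝ × Model n => pd i (localRep (F p.1) c) p.2)
      (I ×ˢ (Φ c).target) :=
  (contDiffOn_fderiv_apply hI (isOpen_target c) (hF c) (0, EuclideanSpace.single i 1)).congr
    fun _ hp => pd_slice hI (isOpen_target c) (hF c) hp.1 hp.2 i

lemma hasDerivAt_pd (hI : IsOpen I) (hF : STS n I F) (ht : t ∈ I) {c : M} {y : Model n}
    (hy : y ∈ (Φ c).target) (i : Fin n) :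
    HasDerivAt (fun s => RicciHeat.pd i (localRep (F s) c) y)
      (RicciHeat.pd i (localRep (fun x => _root_.deriv (fun s => F s x) t) c) y) t := by
  have h := RicciHeat.hasDerivAt_pd hI (isOpen_target c) (hF c) ht hy i
  exact h.congr_deriv
    (pd_congr_of_eqOn (isOpen_target c) hy fun z hz => fderiv_time hI hF ht hz)

end STS

variable [IsManifold (𝓡 n) ∞ M] {g : ℝ → Metric n M}

/-- `(g t)` is a smooth Ricci flow for `t` in the open set `I`. -/
structure IsFlowOn (g : ℝ → Metric n M) (I : Set ℝ) : Prop where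
  isOpen : IsOpen I
  smooth : ∀ (c : M) (i j : Fin n), ContDiffOn ℝ ∞
    (fun p : ℝ × Model n => gMat (g p.1) c p.2 i j) (I ×ˢ (Φ c).target)
  flow : ∀ t ∈ I, ∀ (x : M) (v w : TangentSpace (𝓡 n) x),
    HasDerivAt (fun s => (g s).inner x v w) (-2 * ricci (g t) x v w) t

lemma IsRicciFlow.isFlowOn {t₀ t₁ a b : ℝ} (hg : IsRicciFlow g t₀ t₁) (h₀ : t₀ ≤ a) (h₁ : b ≤ t₁) :
    IsFlowOn g (Ioo a b) := by
  have hsub : Ioo a b ⊆ Ico t₀ t₁ := fun s hs => ⟨h₀.trans hs.1.le, hs.2.trans_le h₁⟩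
  exact ⟨isOpen_Ioo, fun c i j => (hg.smooth c i j).mono (prod_mono hsub subset_rfl),
    fun t ht x v w => (hg.flow t (hsub ht) x v w).hasDerivAt
      (mem_of_superset (isOpen_Ioo.mem_nhds ht) hsub)⟩

namespace IsFlowOn

lemma smoothMetric (hg : IsFlowOn g I) (ht : t ∈ I) : SmoothMetric (g t) := fun c i j =>
  (hg.smooth c i j).comp (contDiff_prodMk_right t).contDiffOn fun _ hy => ⟨ht, hy⟩

lemma det_pos (_hg : IsFlowOn g I) {c : M} {y : Model n} (hy : y ∈ (Φ c).target) :
    0 < (gMat (g t) c y).det := (gMat_posDef (g t) hy).det_pos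

lemma smooth_inv (hg : IsFlowOn g I) (c : M) (i j : Fin n) : ContDiffOn ℝ ∞
    (fun p : ℝ × Model n => (gMat (g p.1) c p.2)⁻¹ i j) (I ×ˢ (Φ c).target) :=
  contDiffOn_inv (A := fun p : ℝ × Model n => gMat (g p.1) c p.2) (hg.smooth c)
    (fun _ hp => (hg.det_pos hp.2).ne') i j

lemma smooth_sqrt_det (hg : IsFlowOn g I) (c : M) : ContDiffOn ℝ ∞
    (fun p : ℝ × Model n => Real.sqrt (gMat (g p.1) c p.2).det) (I ×ˢ (Φ c).target) :=
  (contDiffOn_det (A := fun p : ℝ × Model n => gMat (g p.1) c p.2) (hg.smooth c)).sqrt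
    fun _ hp => (hg.det_pos hp.2).ne'

lemma sts_inn (hg : IsFlowOn g I) (hF : STS n I F) : STS n I fun t => inn (g t) (F t) (F t) := by
  intro c
  have h : ContDiffOn ℝ ∞ (fun p : ℝ × Model n => ∑ i, ∑ j, (gMat (g p.1) c p.2)⁻¹ i j *
      pd i (localRep (F p.1) c) p.2 * pd j (localRep (F p.1) c) p.2) (I ×ˢ (Φ c).target) :=
    ContDiffOn.sum fun i _ => ContDiffOn.sum fun j _ =>
      ((hg.smooth_inv c i j).mul (hF.pd hg.isOpen c i)).mul (hF.pd hg.isOpen c j)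
  exact h.congr fun p hp => localRep_inn (hF.sm hp.1) (hF.sm hp.1) hp.2

/-- The Ricci flow equation in coordinates, at the centre of a chart. -/
lemma hasDerivAt_gMat (hg : IsFlowOn g I) (ht : t ∈ I) (x : M) (i j : Fin n) :
    HasDerivAt (fun s => gMat (g s) x (Φ x x) i j)
      (-2 * ricE (gMat (g t) x) (Φ x x) i j) t := by
  have h := hg.flow t ht x (symmD n x (Φ x x) (EuclideanSpace.single i 1))
    (symmD n x (Φ x x) (EuclideanSpace.single j 1))
  have h1 : ∀ s, gMat (g s) x (Φ x x) i j = mform (g s) x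
      (symmD n x (Φ x x) (EuclideanSpace.single i 1))
      (symmD n x (Φ x x) (EuclideanSpace.single j 1)) := fun s => by
    rw [gMat_apply, extChartAt_to_inv]
  have h2 : ricci (g t) x (symmD n x (Φ x x) (EuclideanSpace.single i 1))
      (symmD n x (Φ x x) (EuclideanSpace.single j 1)) = ricE (gMat (g t) x) (Φ x x) i j := by
    change ∑ k, ∑ l, ricciMat (g t) x (Φ x x) k l
      * vcomp x (symmD n x (Φ x x) (EuclideanSpace.single i 1)) k
      * vcomp x (symmD n x (Φ x x) (EuclideanSpace.single j 1)) l
      = ricciMat (g t) x (Φ x x) i j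
    simp only [vcomp_symmD]
    simp
  rw [h2] at h
  refine h.congr_of_eventuallyEq (Eventually.of_forall fun s => h1 s)

lemma differentiableAt_inv (hg : IsFlowOn g I) (ht : t ∈ I) (x : M) (i j : Fin n) :
    DifferentiableAt ℝ (fun s => (gMat (g s) x (Φ x x))⁻¹ i j) t :=
  (hasDerivAt_time hg.isOpen (isOpen_target x) (hg.smooth_inv x i j) ht
    (mem_tgt x)).differentiableAt

/-- The derivative of `|∇F|²` along the flow. The derivative of the inverse metric is avoided by
writing `|∇F|² = 2 ∂ᵢF Wⁱ - g_ij WⁱWʲ` with `W = ∇F`; the derivative of `W` cancels. -/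
lemma hasDerivAt_inn (hg : IsFlowOn g I) (hF : STS n I F) (ht : t ∈ I) (x : M) :
    HasDerivAt (fun s => inn (g s) (F s) (F s) x)
      (2 * ∑ i, ∑ j, ricE (gMat (g t) x) (Φ x x) i j
          * gradV (gMat (g t) x) (localRep (F t) x) i (Φ x x)
          * gradV (gMat (g t) x) (localRep (F t) x) j (Φ x x)
        + 2 * inn (g t) (F t) (fun x => deriv (fun s => F s x) t) x) t := by
  set p : Fin n → ℝ → ℝ := fun i s => pd i (localRep (F s) x) (Φ x x) with hp
  set p' : Fin n → ℝ := fun i =>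
    pd i (localRep (fun x => deriv (fun s => F s x) t) x) (Φ x x) with hp'
  set W : Fin n → ℝ → ℝ := fun i s => gradV (gMat (g s) x) (localRep (F s) x) i (Φ x x) with hW
  have dp : ∀ i, HasDerivAt (p i) (p' i) t := fun i => hF.hasDerivAt_pd hg.isOpen ht (mem_tgt x) i
  have dW : ∀ i, HasDerivAt (W i) (deriv (W i) t) t := fun i => by
    have : DifferentiableAt ℝ (fun s => ∑ j, (gMat (g s) x (Φ x x))⁻¹ i j * p j s) t :=
      DifferentiableAt.fun_sum fun j _ =>
        (hg.differentiableAt_inv ht x i j).mul (dp j).differentiableAt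
    exact this.hasDerivAt
  have hmet : ∀ s ∈ I, IsMetricOn (gMat (g s) x) (Φ x).target := fun s hs =>
    (hg.smoothMetric hs).isMetricOn x
  have e1 : ∀ s ∈ I, inn (g s) (F s) (F s) x = 2 * ∑ i, p i s * W i s
      - ∑ i, ∑ j, gMat (g s) x (Φ x x) i j * W i s * W j s := by
    intro s hs
    have h1 : inn (g s) (F s) (F s) x = ∑ i, W i s * p i s :=
      (hmet s hs).sum_gradV_mul (mem_tgt x) _
    have h2 : ∑ i, ∑ j, gMat (g s) x (Φ x x) i j * W i s * W j s = inn (g s) (F s) (F s) x :=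
      (hmet s hs).sum_gradV_gradV (mem_tgt x)
    rw [h2, h1, Finset.sum_congr rfl fun i _ => mul_comm (p i s) (W i s)]
    ring
  have e2 : ∀ i, ∑ j, gMat (g t) x (Φ x x) i j * W j t = p i t := by
    intro i
    have : ∀ j, gMat (g t) x (Φ x x) i j * W j t = ∑ l, gMat (g t) x (Φ x x) i j
        * (gMat (g t) x (Φ x x))⁻¹ j l * p l t := fun j => by
      simp only [hW, gradV, Finset.mul_sum]
      exact Finset.sum_congr rfl fun l _ => by ring
    simp only [this]
    rw [Finset.sum_comm]
    simp only [← Finset.sum_mul, ← Matrix.mul_apply, (hmet t ht).mul_inv (mem_tgt x),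
      Matrix.one_apply, ite_mul, one_mul, zero_mul, Finset.sum_ite_eq, Finset.mem_univ, if_true]
  have e3 : ∀ j, ∑ i, gMat (g t) x (Φ x x) i j * W i t = p j t := fun j => by
    rw [← e2 j]
    exact Finset.sum_congr rfl fun i _ => by rw [(hmet t ht).symm (mem_tgt x)]
  have d1 := ((HasDerivAt.fun_sum (u := Finset.univ) fun i _ => (dp i).fun_mul (dW i)).const_mul 2).sub
    (HasDerivAt.fun_sum (u := Finset.univ) fun i _ => HasDerivAt.fun_sum (u := Finset.univ) fun j _ =>
      ((hg.hasDerivAt_gMat ht x i j).fun_mul (dW i)).fun_mul (dW j))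
  have d2 : HasDerivAt (fun s => inn (g s) (F s) (F s) x) _ t :=
    d1.congr_of_eventuallyEq (by
      filter_upwards [hg.isOpen.mem_nhds ht] with s hs
      simpa using e1 s hs)
  convert d2 using 1
  have h1 : inn (g t) (F t) (fun x => deriv (fun s => F s x) t) x = ∑ i, W i t * p' i :=
    (hmet t ht).sum_gradV_mul (mem_tgt x) _
  have h2 : ∑ i, ∑ j, (((-2 * ricE (gMat (g t) x) (Φ x x) i j) * W i t
      + gMat (g t) x (Φ x x) i j * deriv (W i) t) * W j t
      + gMat (g t) x (Φ x x) i j * W i t * deriv (W j) t)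
      = -2 * (∑ i, ∑ j, ricE (gMat (g t) x) (Φ x x) i j * W i t * W j t)
        + 2 * ∑ i, p i t * deriv (W i) t := by
    have h3 : ∑ i, ∑ j, gMat (g t) x (Φ x x) i j * deriv (W i) t * W j t
        = ∑ i, p i t * deriv (W i) t := Finset.sum_congr rfl fun i _ => by
      rw [← e2 i, Finset.sum_mul]
      exact Finset.sum_congr rfl fun j _ => by ring
    have h4 : ∑ i, ∑ j, gMat (g t) x (Φ x x) i j * W i t * deriv (W j) t
        = ∑ i, p i t * deriv (W i) t := by
      rw [Finset.sum_comm]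
      exact Finset.sum_congr rfl fun j _ => by rw [← Finset.sum_mul, e3]
    have h5 : ∑ i, ∑ j, (-2 * ricE (gMat (g t) x) (Φ x x) i j) * W i t * W j t
        = -2 * (∑ i, ∑ j, ricE (gMat (g t) x) (Φ x x) i j * W i t * W j t) := by
      simp only [Finset.mul_sum]
      exact Finset.sum_congr rfl fun i _ => Finset.sum_congr rfl fun j _ => by ring
    simp only [add_mul, Finset.sum_add_distrib]
    rw [h3, h4, h5]; ring
  rw [h1]
  have h6 : ∑ i, (p' i * W i t + p i t * deriv (W i) t)
      = ∑ i, W i t * p' i + ∑ i, p i t * deriv (W i) t := by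
    rw [← Finset.sum_add_distrib]
    exact Finset.sum_congr rfl fun i _ => by ring
  rw [h6, h2]
  ring

end IsFlowOn

end SpaceTime


/-! ### Differentiation under the integral sign -/

section Parametric

variable {n : ℕ} {P : ℝ × Model n → ℝ} {I : Set ℝ} {U K : Set (Model n)} {t : ℝ}

lemma hasDerivAt_setIntegral (hI : IsOpen I) (hU : IsOpen U) (hP : ContDiffOn ℝ ∞ P (I ×ˢ U))
    (hK : IsCompact K) (hKU : K ⊆ U) (ht : t ∈ I) :
    HasDerivAt (fun s => ∫ y in K, P (s, y)) (∫ y in K, fderiv ℝ P (t, y) (1, 0)) t := by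
  obtain ⟨ε, hε, hεI⟩ := Metric.nhds_basis_closedBall.mem_iff.1 (hI.mem_nhds ht)
  have hP' := contDiffOn_fderiv_apply hI hU hP (1, 0)
  obtain ⟨B, hB⟩ := ((isCompact_closedBall t ε).prod hK).exists_bound_of_continuousOn
    (hP'.continuousOn.mono (prod_mono hεI hKU))
  have hslice : ∀ {Q : ℝ × Model n → ℝ}, ContDiffOn ℝ ∞ Q (I ×ˢ U) → ∀ s ∈ I,
      ContinuousOn (fun y => Q (s, y)) K := fun hQ s hs =>
    hQ.continuousOn.comp (by fun_prop) fun y hy => ⟨hs, hKU hy⟩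
  have hfin : IsFiniteMeasure (volume.restrict K) :=
    ⟨by rw [Measure.restrict_apply_univ]; exact hK.measure_lt_top⟩
  refine (hasDerivAt_integral_of_dominated_loc_of_deriv_le (bound := fun _ => B)
    (F' := fun s y => fderiv ℝ P (s, y) (1, 0)) (Metric.closedBall_mem_nhds t hε) ?_ ?_ ?_ ?_
    (integrable_const B) ?_).2
  · filter_upwards [hI.mem_nhds ht] with s hs
    exact (hslice hP s hs).aestronglyMeasurable hK.measurableSet
  · exact (hslice hP t ht).integrableOn_compact hK
  · exact (hslice hP' t ht).aestronglyMeasurable hK.measurableSet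
  · exact (ae_restrict_iff' hK.measurableSet).2 (Eventually.of_forall fun y hy s hs =>
      hB (s, y) ⟨hs, hy⟩)
  · exact (ae_restrict_iff' hK.measurableSet).2 (Eventually.of_forall fun y hy s hs =>
      hasDerivAt_time hI hU hP (hεI hs) (hKU hy))

lemma continuousOn_setIntegral {J : Set ℝ} (hJ : IsCompact J) (hK : IsCompact K)
    (hP : ContinuousOn P (J ×ˢ K)) : ContinuousOn (fun s => ∫ y in K, P (s, y)) J := by
  obtain ⟨B, hB⟩ := (hJ.prod hK).exists_bound_of_continuousOn hP
  have hfin : IsFiniteMeasure (volume.restrict K) :=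
    ⟨by rw [Measure.restrict_apply_univ]; exact hK.measure_lt_top⟩
  refine continuousOn_of_dominated (bound := fun _ => B) (fun s hs => ?_) (fun s hs => ?_)
    (integrable_const B) ?_
  · exact ContinuousOn.aestronglyMeasurable
      (hP.comp (by fun_prop) fun y hy => ⟨hs, hy⟩) hK.measurableSet
  · exact (ae_restrict_iff' hK.measurableSet).2 (Eventually.of_forall fun y hy => hB (s, y) ⟨hs, hy⟩)
  · exact (ae_restrict_iff' hK.measurableSet).2 (Eventually.of_forall fun y hy =>
      hP.comp (by fun_prop) fun s hs => ⟨hs, hy⟩)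

end Parametric

section VolumeEvolution

variable {n : ℕ} {M : Type*} [TopologicalSpace M] [ChartedSpace (Model n) M]
  [IsManifold (𝓡 n) ∞ M] {g : ℝ → Metric n M} {I : Set ℝ} {F : ℝ → M → ℝ} {η : M → ℝ}
  {t : ℝ} {x : M}

local notation "Φ" => extChartAt (𝓡 n)

/-! ### The evolution of integrals along a Ricci flow -/

namespace IsFlowOn

/-- `∂ₜ dV = -R dV`, at the centre of a chart. -/
lemma hasDerivAt_sqrt_det_self (hg : IsFlowOn g I) (ht : t ∈ I) (x : M) :
    HasDerivAt (fun s => Real.sqrt (gMat (g s) x (Φ x x)).det)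
      (-scalar (g t) x * Real.sqrt (gMat (g t) x (Φ x x)).det) t := by
  have hd := hg.det_pos (t := t) (mem_tgt x)
  have e0 := (hasFDerivAt_det (A := fun s => gMat (g s) x (Φ x x)) (y := t)
    fun i j => (hg.hasDerivAt_gMat ht x i j).hasFDerivAt).hasDerivAt
  have e3 : ∀ i j, (gMat (g t) x (Φ x x)).adjugate i j
      = (gMat (g t) x (Φ x x)).det * (gMat (g t) x (Φ x x))⁻¹ i j := by
    intro i j
    rw [Matrix.inv_def, Matrix.smul_apply, Ring.inverse_eq_inv', smul_eq_mul, ← mul_assoc,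
      mul_inv_cancel₀ hd.ne', one_mul]
  have e1 : HasDerivAt (fun s => (gMat (g s) x (Φ x x)).det)
      (-2 * scalar (g t) x * (gMat (g t) x (Φ x x)).det) t := by
    convert e0 using 1
    simp only [_root_.sum_apply, _root_.smul_apply, smul_eq_mul, e3,
      ContinuousLinearMap.toSpanSingleton_apply, one_mul]
    have : scalar (g t) x = ∑ i, ∑ j, (gMat (g t) x (Φ x x))⁻¹ i j
        * ricE (gMat (g t) x) (Φ x x) j i := by
      rw [Finset.sum_comm]
      exact Finset.sum_congr rfl fun i _ => Finset.sum_congr rfl fun j _ => by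
        rw [((hg.smoothMetric ht).isMetricOn x).inv_symm (mem_tgt x)]; rfl
    rw [this]
    simp only [Finset.mul_sum, Finset.sum_mul]
    exact Finset.sum_congr rfl fun i _ => Finset.sum_congr rfl fun j _ => by ring
  convert e1.sqrt hd.ne' using 1
  have h2 : Real.sqrt (gMat (g t) x (Φ x x)).det ≠ 0 := (Real.sqrt_pos.2 hd).ne'
  field_simp
  rw [Real.sq_sqrt hd.le]

/-- `∂ₜ dV = -R dV` in an arbitrary chart: the volume densities of two charts differ by a factor
that does not depend on time. -/
lemma hasDerivAt_sqrt_det (hg : IsFlowOn g I) (ht : t ∈ I) {c : M} {y : Model n}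
    (hy : y ∈ (Φ c).target) :
    HasDerivAt (fun s => Real.sqrt (gMat (g s) c y).det)
      (-scalar (g t) ((Φ c).symm y) * Real.sqrt (gMat (g t) c y).det) t := by
  set x := (Φ c).symm y with hx
  have hov : y ∈ ovl n c x := ⟨hy, mem_extChartAt_source x⟩
  have h := (hg.hasDerivAt_sqrt_det_self ht x).const_mul |(jac n c x y).det|
  have h1 : ∀ s, Real.sqrt (gMat (g s) c y).det
      = |(jac n c x y).det| * Real.sqrt (gMat (g s) x (Φ x x)).det := fun s => sqrt_det_chg _ hov
  refine (h.congr_of_eventuallyEq (Eventually.of_forall h1)).congr_deriv ?_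
  rw [h1]
  ring

lemma sm_scalar (hg : IsFlowOn g I) (ht : t ∈ I) : SM n (scalar (g t)) := by
  intro c
  have h := contDiffOn_fderiv_apply hg.isOpen (isOpen_target c) (hg.smooth_sqrt_det c) (1, 0)
  have h1 : ContDiffOn ℝ ∞ (fun y => -(fderiv ℝ (fun p : ℝ × Model n =>
      Real.sqrt (gMat (g p.1) c p.2).det) (t, y) (1, 0) / Real.sqrt (gMat (g t) c y).det))
      (Φ c).target := by
    refine ContDiffOn.neg (ContDiffOn.div ?_ ((hg.smoothMetric ht).isMetricOn c).smooth_sqrt_det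
      fun y hy => (Real.sqrt_pos.2 (hg.det_pos hy)).ne')
    exact h.comp (contDiff_prodMk_right t).contDiffOn fun y hy => ⟨ht, hy⟩
  refine h1.congr fun y hy => ?_
  rw [(hasDerivAt_time hg.isOpen (isOpen_target c) (hg.smooth_sqrt_det c) ht hy).unique
    (hg.hasDerivAt_sqrt_det ht hy), mul_div_assoc,
    div_self (Real.sqrt_pos.2 (hg.det_pos hy)).ne', mul_one, neg_neg]
  rfl

end IsFlowOn

/-- `g` is a Ricci flow and `A e^{-f}` is a solution of the conjugate heat equation, on the open
time set `I`. -/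
structure IsConjugateFlow (g : ℝ → Metric n M) (f : ℝ → M → ℝ) (A : ℝ → ℝ) (I : Set ℝ) : Prop where
  flow : IsFlowOn g I
  smooth : STS n I f
  smooth_coeff : ContDiffOn ℝ ∞ A I
  nonneg : ∀ t ∈ I, 0 ≤ A t
  conjugate_heat : ∀ t ∈ I, ∀ x : M, HasDerivAt (fun s => A s * Real.exp (-f s x))
    (-laplacian (g t) (fun x => A t * Real.exp (-f t x)) x
      + scalar (g t) x * (A t * Real.exp (-f t x))) t

variable {f v : ℝ → M → ℝ} {A : ℝ → ℝ}

lemma IsConjugateFlow.sts_kernel (h : IsConjugateFlow g f A I) :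
    STS n I fun t x => A t * Real.exp (-f t x) := fun c =>
  (h.smooth_coeff.comp contDiffOn_fst fun _ hp => hp.1).mul (h.smooth c).neg.exp

variable [MeasurableSpace M] [BorelSpace M] [SecondCountableTopology M] [T2Space M]

/-- A compactly supported integral is a finite sum of integrals in charts. -/
lemma exists_integral_vol_eq_sum (hη : SM n η) (hηc : HasCompactSupport η) :
    ∃ (S : Finset M) (w : M → M → ℝ), (∀ c, SM n (w c)) ∧ (∀ c, IsCompact (Φ c '' tsupport (w c))) ∧
      (∀ c, Φ c '' tsupport (w c) ⊆ (Φ c).target) ∧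
      ∀ g : Metric n M, SmoothMetric g → ∀ h : M → ℝ, Continuous h →
        ∫ x, η x * h x ∂(vol g) = ∑ c ∈ S, ∫ y in Φ c '' tsupport (w c),
          Real.sqrt (gMat g c y).det * (w c ((Φ c).symm y) * h ((Φ c).symm y)) := by
  obtain ⟨S, w, hw, hwc, hws, hpw⟩ := exists_decomposition hη hηc
  have hK : ∀ c, IsCompact (Φ c '' tsupport (w c)) := fun c =>
    (hwc c).isCompact.image_of_continuousOn ((continuousOn_extChartAt c).mono (hws c))
  have hKt : ∀ c, Φ c '' tsupport (w c) ⊆ (Φ c).target := by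
    rintro c _ ⟨x, hx, rfl⟩; exact (Φ c).map_source (hws c hx)
  refine ⟨S, w, hw, hK, hKt, fun g hg h hh => ?_⟩
  have := isLocallyFinite_vol hg
  rw [hpw]
  simp only [Finset.sum_mul]
  have hi : ∀ c ∈ S, Integrable (fun x => w c x * h x) (vol g) := fun c _ =>
    ((hw c).continuous.mul hh).integrable_of_hasCompactSupport (hwc c).mul_right
  rw [integral_finsetSum _ hi]
  refine Finset.sum_congr rfl fun c _ => ?_
  rw [← setIntegral_eq_integral_of_forall_compl_eq_zero (s := (Φ c).source) fun x hx => by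
      rw [image_eq_zero_of_notMem_tsupport fun hm => hx (hws c hm), zero_mul],
    setIntegral_vol hg c (h := fun x => w c x * h x)
      ((hw c).continuous.mul hh).aestronglyMeasurable]
  refine setIntegral_eq_of_subset_of_forall_sdiff_eq_zero (isOpen_target c).measurableSet (hKt c)
    fun y hy => ?_
  have h0 : w c ((Φ c).symm y) = 0 := image_eq_zero_of_notMem_tsupport fun hmem =>
    hy.2 ⟨_, hmem, (Φ c).right_inv hy.1⟩
  change _ * (w c ((Φ c).symm y) * h ((Φ c).symm y)) = 0
  rw [h0, zero_mul, mul_zero]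

/-- `d/dt ∫ ηF dV = ∫ η (∂ₜF - RF) dV`. -/
lemma IsFlowOn.hasDerivAt_integral_vol (hg : IsFlowOn g I) (hF : STS n I F) (hη : SM n η)
    (hηc : HasCompactSupport η) (ht : t ∈ I) :
    HasDerivAt (fun s => ∫ x, η x * F s x ∂(vol (g s)))
      (∫ x, η x * (deriv (fun s => F s x) t - scalar (g t) x * F t x) ∂(vol (g t))) t := by
  obtain ⟨S, w, hw, hK, hKt, hint⟩ := exists_integral_vol_eq_sum hη hηc
  have hI := hg.isOpen
  have hFd := (hF.deriv hI).sm ht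
  have hS := hg.sm_scalar ht
  rw [hint _ (hg.smoothMetric ht) _ (hFd.sub (hS.mul (hF.sm ht))).continuous]
  have h1 : (fun s => ∫ x, η x * F s x ∂(vol (g s))) =ᶠ[𝓝 t] fun s => ∑ c ∈ S,
      ∫ y in Φ c '' tsupport (w c), Real.sqrt (gMat (g s) c y).det
        * (w c ((Φ c).symm y) * F s ((Φ c).symm y)) := by
    filter_upwards [hI.mem_nhds ht] with s hs
    exact hint _ (hg.smoothMetric hs) _ (hF.sm hs).continuous
  refine HasDerivAt.congr_of_eventuallyEq ?_ h1
  refine HasDerivAt.fun_sum fun c _ => ?_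
  have hP : ContDiffOn ℝ ∞ (fun p : ℝ × Model n => Real.sqrt (gMat (g p.1) c p.2).det
      * (w c ((Φ c).symm p.2) * F p.1 ((Φ c).symm p.2))) (I ×ˢ (Φ c).target) :=
    (hg.smooth_sqrt_det c).mul (((STS.of_sm (I := I) (hw c)) c).mul (hF c))
  have h2 := hasDerivAt_setIntegral hI (isOpen_target c) hP (hK c) (hKt c) ht
  refine h2.congr_deriv (setIntegral_congr_fun (hK c).measurableSet fun y hy => ?_)
  have hy' := hKt c hy
  refine (hasDerivAt_time hI (isOpen_target c) hP ht hy').unique ?_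
  have h3 := (hg.hasDerivAt_sqrt_det ht hy').fun_mul
    ((hF.hasDerivAt hI ht ((Φ c).symm y)).const_mul (w c ((Φ c).symm y)))
  refine h3.congr_deriv ?_
  ring

lemma continuousOn_integral_vol {J : Set ℝ} (hJ : IsCompact J)
    (hgs : ∀ s ∈ J, SmoothMetric (g s))
    (hg : ∀ (c : M) (i j : Fin n), ContinuousOn (fun p : ℝ × Model n => gMat (g p.1) c p.2 i j)
      (J ×ˢ (Φ c).target))
    (hF : ∀ c : M, ContinuousOn (fun p : ℝ × Model n => F p.1 ((Φ c).symm p.2))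
      (J ×ˢ (Φ c).target)) (hFc : ∀ s ∈ J, Continuous (F s))
    (hη : SM n η) (hηc : HasCompactSupport η) :
    ContinuousOn (fun s => ∫ x, η x * F s x ∂(vol (g s))) J := by
  obtain ⟨S, w, hw, hK, hKt, hint⟩ := exists_integral_vol_eq_sum hη hηc
  refine ContinuousOn.congr ?_ fun s hs => hint _ (hgs s hs) _ (hFc s hs)
  refine continuousOn_finsetSum _ fun c _ => ?_
  have hd : ContinuousOn (fun p : ℝ × Model n => Real.sqrt (gMat (g p.1) c p.2).det)
      (J ×ˢ (Φ c).target) := by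
    refine ContinuousOn.sqrt ?_
    refine fun p hp => ContinuousAt.comp_continuousWithinAt (g := Matrix.det)
      (f := fun p : ℝ × Model n => gMat (g p.1) c p.2) (by fun_prop) ?_
    exact tendsto_pi_nhds.2 fun i => tendsto_pi_nhds.2 fun j => hg c i j p hp
  have hwc : ContinuousOn (fun p : ℝ × Model n => w c ((Φ c).symm p.2)) (J ×ˢ (Φ c).target) :=
    ((STS.of_sm (I := J) (hw c)) c).continuousOn
  exact continuousOn_setIntegral (P := fun p : ℝ × Model n => Real.sqrt (gMat (g p.1) c p.2).det
    * (w c ((Φ c).symm p.2) * F p.1 ((Φ c).symm p.2))) hJ (hK c)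
    ((hd.mul (hwc.mul (hF c))).mono (prod_mono subset_rfl (hKt c)))

/-! ### The evolution of weighted integrals -/

/-- The time derivative of `∫ ηv dν`, where `dν = A e^{-f} dV`. The heat operator is moved to `v`,
at the cost of terms with a derivative of `η`. -/
lemma IsConjugateFlow.hasDerivAt_integral (h : IsConjugateFlow g f A I) (hv : STS n I v)
    (hη : SM n η) (hηc : HasCompactSupport η) (ht : t ∈ I) :
    HasDerivAt (fun s => ∫ x, η x * v s x ∂(wvol (g s) (f s) (A s)))
      (∫ x, η x * (deriv (fun s => v s x) t - laplacian (g t) (v t) x) ∂(wvol (g t) (f t) (A t))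
        - ∫ x, inn (g t) (v t) η x ∂(wvol (g t) (f t) (A t))
        - ∫ x, v t x * inn (g t) (f t) η x ∂(wvol (g t) (f t) (A t))) t := by
  have hg := h.flow
  have hgt := hg.smoothMetric ht
  have hft := h.smooth.sm ht
  have hvt := hv.sm ht
  have hA := h.nonneg t ht
  have hloc := isLocallyFinite_wvol (A := A t) hgt hft.continuous
  have hloc' := isLocallyFinite_vol hgt
  have hd := hg.hasDerivAt_integral_vol (h.sts_kernel.mul hv) hη hηc ht
  have e0 : (fun s => ∫ x, η x * v s x ∂(wvol (g s) (f s) (A s))) =ᶠ[𝓝 t]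
      fun s => ∫ x, η x * (A s * Real.exp (-f s x) * v s x) ∂(vol (g s)) := by
    filter_upwards [hg.isOpen.mem_nhds ht] with s hs
    rw [integral_wvol (h.smooth.sm hs).continuous (h.nonneg s hs)]
    congr 1; funext x; ring
  refine (hd.congr_of_eventuallyEq e0).congr_deriv ?_
  have hvd := (hv.deriv hg.isOpen).sm ht
  have hK := hft.exp_neg (A t)
  -- the time derivative of the integrand
  have e1 : ∀ x, deriv (fun s => A s * Real.exp (-f s x) * v s x) t
      - scalar (g t) x * (A t * Real.exp (-f t x) * v t x)
      = A t * Real.exp (-f t x) * deriv (fun s => v s x) t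
        - v t x * laplacian (g t) (fun x => A t * Real.exp (-f t x)) x := fun x => by
    rw [((h.conjugate_heat t ht x).fun_mul (hv.hasDerivAt hg.isOpen ht x)).deriv]
    ring
  simp only [e1, mul_sub]
  have i1 : Integrable (fun x => η x * (A t * Real.exp (-f t x) * deriv (fun s => v s x) t))
      (vol (g t)) := (hη.mul (hK.mul hvd)).continuous.integrable_of_hasCompactSupport hηc.mul_right
  have i2 : Integrable (fun x => η x * (v t x *
      laplacian (g t) (fun x => A t * Real.exp (-f t x)) x)) (vol (g t)) :=
    (hη.mul (hvt.mul (SM.laplacian hgt hK))).continuous.integrable_of_hasCompactSupport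
      hηc.mul_right
  have j1 : Integrable (fun x => η x * deriv (fun s => v s x) t) (wvol (g t) (f t) (A t)) :=
    (hη.mul hvd).continuous.integrable_of_hasCompactSupport hηc.mul_right
  have j2 : Integrable (fun x => η x * laplacian (g t) (v t) x) (wvol (g t) (f t) (A t)) :=
    (hη.mul (SM.laplacian hgt hvt)).continuous.integrable_of_hasCompactSupport hηc.mul_right
  have j3 : Integrable (fun x => η x * inn (g t) (f t) (v t) x) (wvol (g t) (f t) (A t)) :=
    (hη.mul (SM.inn hgt hft hvt)).continuous.integrable_of_hasCompactSupport hηc.mul_right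
  have j4 : Integrable (fun x => v t x * inn (g t) (f t) η x) (wvol (g t) (f t) (A t)) :=
    (hvt.mul (SM.inn hgt hft hη)).continuous.integrable_of_hasCompactSupport
      (hasCompactSupport_inn hηc).mul_left
  -- the Laplacian of the kernel, integrated by parts
  have e2 : ∫ x, η x * (v t x * laplacian (g t) (fun x => A t * Real.exp (-f t x)) x) ∂(vol (g t))
      = ∫ x, (η x * inn (g t) (f t) (v t) x + v t x * inn (g t) (f t) η x)
        ∂(wvol (g t) (f t) (A t)) := by
    have h1 := green hgt hK (hη.mul hvt) hηc.mul_right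
    rw [integral_wvol hft.continuous hA]
    simp only [← mul_assoc]
    rw [h1, ← integral_neg]
    congr 1; funext x
    rw [inn_comm hgt, inn_exp_neg hft, inn_comm hgt, inn_mul_right hη hvt]
    ring
  have e3 := green_weighted (A := A t) hgt hft hA hvt hη hηc
  simp only [dlap, mul_sub] at e3
  rw [integral_sub j2 j3] at e3
  rw [integral_sub i1 i2, e2, integral_add j3 j4, integral_sub j1 j2]
  have e4 : ∫ x, η x * (A t * Real.exp (-f t x) * deriv (fun s => v s x) t) ∂(vol (g t))
      = ∫ x, η x * deriv (fun s => v s x) t ∂(wvol (g t) (f t) (A t)) := by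
    rw [integral_wvol hft.continuous hA]
    congr 1; funext x; ring
  rw [e4]
  linarith

end VolumeEvolution


/-! ### A differential inequality for absolutely continuous functions -/

section Frequency

/-- The composition of a `C¹` function with an absolutely continuous function. -/
lemma absolutelyContinuous_comp {f φ : ℝ → ℝ} {a b c d : ℝ}
    (hf : AbsolutelyContinuousOnInterval f a b) (hφ : ContDiffOn ℝ 1 φ (Icc c d))
    (hm : ∀ x ∈ uIcc a b, f x ∈ Icc c d) :
    AbsolutelyContinuousOnInterval (fun x => φ (f x)) a b := by
  obtain ⟨K, hK⟩ := hφ.exists_lipschitzOnWith (by decide) (convex_Icc c d) isCompact_Icc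
  rw [absolutelyContinuousOnInterval_iff] at hf ⊢
  intro ε hε
  obtain ⟨δ, hδ, h⟩ := hf (ε / (K + 1)) (by positivity)
  refine ⟨δ, hδ, fun F hF hlt => ?_⟩
  calc ∑ i ∈ Finset.range F.1, dist (φ (f (F.2 i).1)) (φ (f (F.2 i).2))
      ≤ ∑ i ∈ Finset.range F.1, (K + 1) * dist (f (F.2 i).1) (f (F.2 i).2) := by
        refine Finset.sum_le_sum fun i hi => ?_
        refine (hK.dist_le_mul _ (hm _ (hF.1 i hi).1) _ (hm _ (hF.1 i hi).2)).trans ?_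
        exact mul_le_mul_of_nonneg_right (by linarith) dist_nonneg
    _ = (K + 1) * ∑ i ∈ Finset.range F.1, dist (f (F.2 i).1) (f (F.2 i).2) := by
        rw [Finset.mul_sum]
    _ < (K + 1) * (ε / (K + 1)) := mul_lt_mul_of_pos_left (h F hF hlt) (by positivity)
    _ = ε := by field_simp

/-- An absolutely continuous function whose derivative is almost everywhere nonnegative
increases. -/
lemma le_of_ae_deriv_nonneg {f : ℝ → ℝ} {a b : ℝ} (hab : a ≤ b)
    (hf : AbsolutelyContinuousOnInterval f a b)
    (h : ∀ᵐ x, x ∈ Ioo a b → 0 ≤ deriv f x) : f a ≤ f b := by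
  have h1 := hf.integral_deriv_eq_sub
  have h2 : 0 ≤ ∫ x in a..b, deriv f x := by
    refine intervalIntegral.integral_nonneg_of_ae_restrict hab ?_
    rw [EventuallyLE, ← restrict_Ioo_eq_restrict_Icc, ae_restrict_iff' measurableSet_Ioo]
    exact h
  linarith

/-- An equality `F = F r + ∫ h` gives absolute continuity, and the derivative almost everywhere. -/
lemma absolutelyContinuous_of_sub_eq {F h : ℝ → ℝ} {r s : ℝ} (hrs : r ≤ s)
    (hi : IntervalIntegrable h volume r s)
    (hF : ∀ t ∈ Icc r s, F t - F r = ∫ x in r..t, h x) :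
    AbsolutelyContinuousOnInterval F r s ∧ ∀ᵐ t, t ∈ Ioo r s → HasDerivAt F (h t) t := by
  have hr : r ∈ uIcc r s := left_mem_uIcc
  have h1 : ∀ t ∈ Icc r s, F t = F r + ∫ x in r..t, h x := fun t ht => by
    rw [← hF t ht]; ring
  constructor
  · have h2 : AbsolutelyContinuousOnInterval (fun t => F r + ∫ x in r..t, h x) r s :=
      (ContDiffOn.absolutelyContinuousOnInterval (f := fun _ : ℝ => F r) contDiffOn_const).fun_add
        (hi.absolutelyContinuousOnInterval_intervalIntegral hr)
    rw [absolutelyContinuousOnInterval_iff] at h2 ⊢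
    intro ε hε
    obtain ⟨δ, hδ, h3⟩ := h2 ε hε
    refine ⟨δ, hδ, fun E hE hlt => ?_⟩
    refine lt_of_eq_of_lt (Finset.sum_congr rfl fun i hi => ?_) (h3 E hE hlt)
    have h4 := hE.1 i hi
    rw [uIcc_of_le hrs] at h4
    rw [h1 _ h4.1, h1 _ h4.2]
  · filter_upwards [hi.ae_hasDerivAt_integral] with t ht hts
    have h2 := (ht (uIcc_of_le hrs ▸ Ioo_subset_Icc_self hts) r hr).const_add (F r)
    refine h2.congr_of_eventuallyEq ?_
    filter_upwards [isOpen_Ioo.mem_nhds hts] with x hx using h1 x (Ioo_subset_Icc_self hx)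

variable {I E H Q lam : ℝ → ℝ} {r b : ℝ}

/-- The frequency `E / I` grows at most exponentially as long as `I` does not vanish. -/
lemma frequency_le {s : ℝ} (hrs : r ≤ s) (hE : IntervalIntegrable E volume r s)
    (hI : ∀ t ∈ Icc r s, I t - I r = ∫ x in r..t, -2 * E x)
    (hH : IntervalIntegrable H volume r s)
    (hEH : ∀ t ∈ Icc r s, E t - E r = ∫ x in r..t, -2 * H x)
    (hlam : IntervalIntegrable lam volume r s)
    (hE0 : ∀ t ∈ Icc r s, 0 ≤ E t) (hI0 : ∀ t ∈ Icc r s, 0 < I t)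
    (hQ : ∀ t ∈ Icc r s, Q t ≤ H t + lam t * E t ∧ E t ^ 2 ≤ I t * Q t) :
    E s ≤ E r / I r * Real.exp (∫ x in r..s, 2 * |lam x|) * I s := by
  obtain ⟨aI, dI⟩ := absolutelyContinuous_of_sub_eq hrs (hE.const_mul (-2)) hI
  obtain ⟨aE, dE⟩ := absolutelyContinuous_of_sub_eq hrs (hH.const_mul (-2)) hEH
  have hl := hlam.abs.const_mul 2
  obtain ⟨aL, dL⟩ := absolutelyContinuous_of_sub_eq (F := fun t => ∫ x in r..t, 2 * |lam x|)
    hrs hl fun t _ => by simp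
  set L : ℝ → ℝ := fun t => ∫ x in r..t, 2 * |lam x| with hL
  have hcI := aI.continuousOn
  have hcL := aL.continuousOn
  rw [uIcc_of_le hrs] at hcI hcL
  -- `I` and `L` take values in compact intervals, where `1/x` and `exp (-x)` are Lipschitz
  obtain ⟨m, hm, hmin⟩ := isCompact_Icc.exists_isMinOn (nonempty_Icc.2 hrs) hcI
  obtain ⟨M, hM, hmax⟩ := isCompact_Icc.exists_isMaxOn (nonempty_Icc.2 hrs) hcI
  obtain ⟨m', hm', hmin'⟩ := isCompact_Icc.exists_isMinOn (nonempty_Icc.2 hrs) hcL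
  obtain ⟨M', hM', hmax'⟩ := isCompact_Icc.exists_isMaxOn (nonempty_Icc.2 hrs) hcL
  have a1 : AbsolutelyContinuousOnInterval (fun t => (I t)⁻¹) r s := by
    refine absolutelyContinuous_comp (φ := fun x => x⁻¹) (c := I m) (d := I M) aI ?_ fun t ht => ?_
    · exact contDiffOn_id.inv fun x hx => ((hI0 m hm).trans_le hx.1).ne'
    · rw [uIcc_of_le hrs] at ht
      exact ⟨hmin ht, hmax ht⟩
  have a2 : AbsolutelyContinuousOnInterval (fun t => Real.exp (-L t)) r s := by
    refine absolutelyContinuous_comp (φ := fun x => Real.exp (-x)) (c := L m') (d := L M') aL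
      (by fun_prop) fun t ht => ?_
    rw [uIcc_of_le hrs] at ht
    exact ⟨hmin' ht, hmax' ht⟩
  -- `-(E / I) exp (-L)` increases
  have key := le_of_ae_deriv_nonneg hrs ((aE.fun_mul a1).fun_mul a2).fun_neg (by
    filter_upwards [dI, dE, dL] with t h1 h2 h3 ht
    have ht' := Ioo_subset_Icc_self ht
    have hIt := hI0 t ht'
    have d := (((h2 ht).fun_mul ((h1 ht).fun_inv hIt.ne')).fun_mul ((h3 ht).fun_neg.exp)).fun_neg
    rw [d.deriv]
    obtain ⟨q1, q2⟩ := hQ t ht'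
    have e1 : lam t * E t ≤ |lam t| * E t := mul_le_mul_of_nonneg_right (le_abs_self _) (hE0 t ht')
    have e2 : E t ^ 2 / I t ≤ Q t := by rw [div_le_iff₀ hIt]; linarith
    have e3 : 0 ≤ Real.exp (-L t) * (I t)⁻¹ * (2 * (H t + |lam t| * E t - E t ^ 2 / I t)) := by
      have := Real.exp_pos (-L t)
      have : 0 ≤ H t + |lam t| * E t - E t ^ 2 / I t := by linarith
      positivity
    refine e3.trans_eq ?_
    field_simp
    ring)
  have hIr := hI0 r (left_mem_Icc.2 hrs)
  have hIs := hI0 s (right_mem_Icc.2 hrs)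
  have hLr : L r = 0 := by simp [hL]
  have k2 : E s * (I s)⁻¹ * Real.exp (-L s) ≤ E r * (I r)⁻¹ := by
    rw [hLr, neg_zero, Real.exp_zero, mul_one] at key
    linarith
  calc E s = E s * (I s)⁻¹ * Real.exp (-L s) * (Real.exp (L s) * I s) := by
        rw [Real.exp_neg]; field_simp
    _ ≤ E r * (I r)⁻¹ * (Real.exp (L s) * I s) :=
        mul_le_mul_of_nonneg_right k2 (by positivity)
    _ = _ := by rw [div_eq_mul_inv]; ring

/-- Backward uniqueness for the energy: a bounded frequency prevents `I` from reaching `0`. -/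
lemma energy_eq_zero (hrb : r ≤ b) (hE : IntervalIntegrable E volume r b)
    (hI : ∀ t ∈ Icc r b, I t - I r = ∫ x in r..t, -2 * E x)
    (hH : ∀ s ∈ Ico r b, IntervalIntegrable H volume r s)
    (hEH : ∀ t ∈ Ico r b, E t - E r = ∫ x in r..t, -2 * H x)
    (hlam : IntervalIntegrable lam volume r b)
    (hE0 : ∀ t ∈ Ico r b, 0 ≤ E t) (hI0 : ∀ t ∈ Icc r b, 0 ≤ I t)
    (hQ : ∀ t ∈ Ico r b, Q t ≤ H t + lam t * E t ∧ E t ^ 2 ≤ I t * Q t) (hIb : I b = 0) :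
    I r = 0 := by
  by_contra hne
  have hIr : 0 < I r := lt_of_le_of_ne (hI0 r (left_mem_Icc.2 hrb)) (Ne.symm hne)
  have hcI := (absolutelyContinuous_of_sub_eq hrb (hE.const_mul (-2)) hI).1.continuousOn
  rw [uIcc_of_le hrb] at hcI
  -- the first zero of `I`
  have hZc : IsCompact (Icc r b ∩ I ⁻¹' {0}) :=
    isCompact_Icc.of_isClosed_subset (hcI.preimage_isClosed_of_isClosed isClosed_Icc
      isClosed_singleton) inter_subset_left
  obtain ⟨σ, ⟨hσ, hσ0⟩, hσmin⟩ := hZc.exists_isLeast ⟨b, right_mem_Icc.2 hrb, hIb⟩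
  have hpos : ∀ t ∈ Ico r σ, 0 < I t := fun t ht => by
    have ht' : t ∈ Icc r b := ⟨ht.1, ht.2.le.trans hσ.2⟩
    refine lt_of_le_of_ne (hI0 t ht') fun h0 => ?_
    exact ht.2.not_ge (hσmin ⟨ht', h0.symm⟩)
  set C := E r / I r * Real.exp (∫ x in r..b, 2 * |lam x|) with hC
  have hN : ∀ s ∈ Ico r σ, E s ≤ C * I s := by
    intro s hs
    have hsb : s < b := hs.2.trans_le hσ.2
    have hsub : uIcc r s ⊆ uIcc r b := by
      rw [uIcc_of_le hs.1, uIcc_of_le hrb]; exact Icc_subset_Icc_right hsb.le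
    have hin : ∀ t ∈ Icc r s, t ∈ Ico r b := fun t ht => ⟨ht.1, ht.2.trans_lt hsb⟩
    have h1 := frequency_le (Q := Q) hs.1 (hE.mono_set hsub)
      (fun t ht => hI t (Ico_subset_Icc_self (hin t ht))) (hH s ⟨hs.1, hsb⟩)
      (fun t ht => hEH t (hin t ht)) (hlam.mono_set hsub) (fun t ht => hE0 t (hin t ht))
      (fun t ht => hpos t ⟨ht.1, ht.2.trans_lt hs.2⟩) (fun t ht => hQ t (hin t ht))
    refine h1.trans (mul_le_mul_of_nonneg_right (mul_le_mul_of_nonneg_left (Real.exp_le_exp.2 ?_)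
      (div_nonneg (hE0 r ⟨le_rfl, hs.1.trans_lt hsb⟩) hIr.le)) (hpos s hs).le)
    exact intervalIntegral.integral_mono_interval le_rfl hs.1 hsb.le
      (Eventually.of_forall fun x => by positivity) (hlam.abs.const_mul 2)
  have hsub : uIcc r σ ⊆ uIcc r b := by
    rw [uIcc_of_le hσ.1, uIcc_of_le hrb]; exact Icc_subset_Icc_right hσ.2
  obtain ⟨aI, dI⟩ := absolutelyContinuous_of_sub_eq hσ.1 ((hE.mono_set hsub).const_mul (-2))
    fun t ht => hI t ⟨ht.1, ht.2.trans hσ.2⟩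
  have a2 : AbsolutelyContinuousOnInterval (fun t => Real.exp (2 * C * t)) r σ :=
    ContDiffOn.absolutelyContinuousOnInterval (by fun_prop)
  -- `I exp (2Ct)` increases, up to and including the first zero
  have key := le_of_ae_deriv_nonneg hσ.1 (aI.fun_mul a2) (by
    filter_upwards [dI] with t h1 ht
    have d := (h1 ht).fun_mul (((hasDerivAt_id t).const_mul (2 * C)).exp)
    simp only [id] at d
    rw [d.deriv]
    have h2 := hN t (Ioo_subset_Ico_self ht)
    have h3 := Real.exp_pos (2 * C * t)
    nlinarith)
  have hσ0' : I σ = 0 := hσ0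
  rw [hσ0', zero_mul] at key
  have := mul_pos hIr (Real.exp_pos (2 * C * r))
  linarith

end Frequency

section Evolution

variable {n : ℕ} {M : Type*} [TopologicalSpace M] [ChartedSpace (Model n) M]
  [IsManifold (𝓡 n) ∞ M] [MeasurableSpace M] [BorelSpace M] [SecondCountableTopology M] [T2Space M]
  {g : ℝ → Metric n M} {f v w : ℝ → M → ℝ} {A : ℝ → ℝ} {η : ℕ → M → ℝ} {C B r s : ℝ} {β : ℝ → ℝ}

/-! ### The evolution of weighted integrals, without cutoff -/

/-- If `(∂ₜ - Δ) v = -2w` and `|∇v|² ≤ 4vw`, then `∫ v dν` decreases at the rate `2 ∫ w dν`.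
The boundary terms of the cutoff functions are controlled by `∫ v`, `∫ w` and `∫ v |∇f|²`. -/
lemma IsConjugateFlow.integral_evolution (h : IsConjugateFlow g f A (Ioo r s)) (hrs : r ≤ s)
    (hη : ∀ t ∈ Icc r s, IsCutoff (g t) η C) (hC : 0 ≤ C)
    (hv : STS n (Ioo r s) v)
    (hv0 : ∀ t ∈ Ioo r s, ∀ x, 0 ≤ v t x) (hw0 : ∀ t ∈ Ioo r s, ∀ x, 0 ≤ w t x)
    (hvw : ∀ t ∈ Ioo r s, ∀ x, inn (g t) (v t) (v t) x ≤ 4 * v t x * w t x)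
    (heq : ∀ t ∈ Ioo r s, ∀ x,
      deriv (fun s => v s x) t = laplacian (g t) (v t) x - 2 * w t x)
    (hvi : ∀ t ∈ Icc r s, Integrable (v t) (wvol (g t) (f t) (A t)))
    (hwi : ∀ t ∈ Ioo r s, Integrable (w t) (wvol (g t) (f t) (A t)))
    (hvB : ∀ t ∈ Ioo r s, ∫ x, v t x ∂(wvol (g t) (f t) (A t)) ≤ B)
    (hwB : ∀ t ∈ Ioo r s, ∫ x, w t x ∂(wvol (g t) (f t) (A t)) ≤ B)
    (hβ : IntervalIntegrable β volume r s) (hβ0 : ∀ t ∈ Ioo r s, 0 ≤ β t)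
    (hΔ : ∀ t ∈ Ioo r s, ∀ x, laplacian (g t) (f t) x ≤ β t)
    (hJ : ∀ k, ContinuousOn (fun t => ∫ x, η k x * v t x ∂(wvol (g t) (f t) (A t))) (Icc r s)) :
    IntervalIntegrable (fun t => ∫ x, w t x ∂(wvol (g t) (f t) (A t))) volume r s ∧
      ∫ x, v s x ∂(wvol (g s) (f s) (A s)) - ∫ x, v r x ∂(wvol (g r) (f r) (A r))
        = ∫ t in r..s, -2 * ∫ x, w t x ∂(wvol (g t) (f t) (A t)) := by
  set μ : ℝ → Measure M := fun t => wvol (g t) (f t) (A t) with hμ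
  set J : ℕ → ℝ → ℝ := fun k t => ∫ x, η k x * v t x ∂(μ t) with hJdef
  set D : ℕ → ℝ → ℝ := fun k t => -2 * ∫ x, η k x * w t x ∂(μ t)
    - ∫ x, 1 * inn (g t) (v t) (η k) x ∂(μ t)
    - ∫ x, v t x * inn (g t) (f t) (η k) x ∂(μ t) with hD
  have hae : ∀ᵐ t : ℝ, t ∈ uIoc r s → t ∈ Ioo r s := by
    have hne : ∀ᵐ t : ℝ, t ≠ s := by simp [ae_iff, measure_singleton]
    filter_upwards [hne] with t ht hts
    rw [uIoc_of_le hrs] at hts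
    exact ⟨hts.1, lt_of_le_of_ne hts.2 ht⟩
  -- the evolution with a cutoff function
  have hJD : ∀ k, ∀ t ∈ Ioo r s, HasDerivAt (J k) (D k t) t := by
    intro k t ht
    have hk := hη t (Ioo_subset_Icc_self ht)
    refine (h.hasDerivAt_integral hv (hk.smooth k) (hk.compact k) ht).congr_deriv ?_
    simp only [hD, heq t ht, one_mul]
    congr 2
    rw [← integral_const_mul]
    congr 1; funext x; ring
  have hF : ∀ t ∈ Ioo r s, Integrable (fun x => v t x * inn (g t) (f t) (f t) x) (μ t) ∧
      ∫ x, v t x * inn (g t) (f t) (f t) x ∂(μ t) ≤ (2 * β t + 8 * C) * B + 8 * B := by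
    intro t ht
    have ht' := Ioo_subset_Icc_self ht
    obtain ⟨h1, h2⟩ := integrable_mul_gradSq (h.flow.smoothMetric ht) (h.smooth.sm ht)
      (h.nonneg t ht) (hη t ht') hC (hv.sm ht) (hv0 t ht) (hw0 t ht) (hvw t ht) (hvi t ht')
      (hwi t ht) (hβ0 t ht) (hΔ t ht)
    refine ⟨h1, h2.trans ?_⟩
    have := hβ0 t ht
    exact add_le_add (mul_le_mul_of_nonneg_left (hvB t ht) (by positivity))
      (mul_le_mul_of_nonneg_left (hwB t ht) (by norm_num))
  -- the functions that dominate the two boundary terms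
  have hH1 : ∀ t ∈ Ioo r s, ∀ x, (1 : ℝ) ^ 2 * inn (g t) (v t) (v t) x ≤ (v t x + w t x) ^ 2 :=
    fun t ht x => by nlinarith [hvw t ht x, sq_nonneg (v t x - w t x)]
  have hH2 : ∀ t ∈ Ioo r s, ∀ x, v t x ^ 2 * inn (g t) (f t) (f t) x
      ≤ (v t x + v t x * inn (g t) (f t) (f t) x) ^ 2 := fun t ht x => by
    have h1 : 0 ≤ inn (g t) (f t) (f t) x := inn_self_nonneg (h.flow.smoothMetric ht)
    nlinarith [sq_nonneg (v t x), mul_nonneg (sq_nonneg (v t x)) h1,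
      sq_nonneg (v t x * inn (g t) (f t) (f t) x)]
  have hD_lim : ∀ t ∈ Ioo r s,
      Tendsto (fun k => D k t) atTop (𝓝 (-2 * ∫ x, w t x ∂(μ t))) := by
    intro t ht
    have ht' := Ioo_subset_Icc_self ht
    have hgt := h.flow.smoothMetric ht
    have l1 := ((hη t ht').tendsto_integral (hwi t ht)).const_mul (-2)
    have l2 := (hη t ht').tendsto_inn hgt (hv.sm ht) (a := fun _ => 1) continuous_const
      ((hvi t ht').add (hwi t ht)) (fun x => add_nonneg (hv0 t ht x) (hw0 t ht x)) (hH1 t ht)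
    have l3 := (hη t ht').tendsto_inn hgt (h.smooth.sm ht) (a := v t) (hv.sm ht).continuous
      ((hvi t ht').add (hF t ht).1) (fun x => add_nonneg (hv0 t ht x)
        (mul_nonneg (hv0 t ht x) (inn_self_nonneg hgt))) (hH2 t ht)
    simpa only [sub_zero] using (l1.sub l2).sub l3
  -- a bound of `D k` that does not depend on `k` and that is integrable in time
  set b : ℝ → ℝ := fun t => 2 * B + Real.sqrt C * (2 * B)
    + Real.sqrt C * (B + ((2 * β t + 8 * C) * B + 8 * B)) with hb
  have hD_bound : ∀ k, ∀ t ∈ Ioo r s, |D k t| ≤ b t := by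
    intro k t ht
    have ht' := Ioo_subset_Icc_self ht
    have hgt := h.flow.smoothMetric ht
    have hk := hη t ht'
    have b1 : |-2 * ∫ x, η k x * w t x ∂(μ t)| ≤ 2 * B := by
      have h0 : 0 ≤ ∫ x, η k x * w t x ∂(μ t) :=
        integral_nonneg fun x => mul_nonneg (hk.nonneg k x) (hw0 t ht x)
      have h1 : ∫ x, η k x * w t x ∂(μ t) ≤ ∫ x, w t x ∂(μ t) :=
        integral_mono_of_nonneg
          (Eventually.of_forall fun x => mul_nonneg (hk.nonneg k x) (hw0 t ht x)) (hwi t ht)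
          (Eventually.of_forall fun x => mul_le_of_le_one_left (hw0 t ht x) (hk.le_one k x))
      rw [abs_mul, abs_of_nonneg h0]
      have := hwB t ht
      norm_num
      linarith
    have bd : ∀ {v' a H : M → ℝ} {B' : ℝ}, Integrable H (μ t) → (∀ x, 0 ≤ H x) →
        (∀ x, a x ^ 2 * inn (g t) v' v' x ≤ H x ^ 2) → ∫ x, H x ∂(μ t) ≤ B' →
        |∫ x, a x * inn (g t) v' (η k) x ∂(μ t)| ≤ Real.sqrt C * B' := by
      intro v' a H B' hHi hH0 hH hHB
      have h1 := norm_integral_le_of_norm_le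
        (f := fun x => a x * inn (g t) v' (η k) x) (hHi.const_mul (Real.sqrt C))
        (Eventually.of_forall fun x => hk.abs_inn_le hgt (hH0 x) (hH x) k)
      rw [integral_const_mul] at h1
      exact h1.trans (mul_le_mul_of_nonneg_left hHB (Real.sqrt_nonneg C))
    have b2 := bd (v' := v t) (a := fun _ => 1) (B' := 2 * B) ((hvi t ht').add (hwi t ht))
      (fun x => add_nonneg (hv0 t ht x) (hw0 t ht x)) (hH1 t ht) (by
        have h1 := integral_add (hvi t ht') (hwi t ht)
        have h2 := hvB t ht
        have h3 := hwB t ht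
        simp only [Pi.add_apply]
        linarith)
    have b3 := bd (v' := f t) (a := v t) (B' := B + ((2 * β t + 8 * C) * B + 8 * B))
      ((hvi t ht').add (hF t ht).1) (fun x => add_nonneg (hv0 t ht x)
        (mul_nonneg (hv0 t ht x) (inn_self_nonneg hgt))) (hH2 t ht) (by
        have h1 := integral_add (hvi t ht') (hF t ht).1
        have h2 := hvB t ht
        have h3 := (hF t ht).2
        simp only [Pi.add_apply]
        linarith)
    calc |D k t| ≤ _ := (abs_sub _ _).trans (add_le_add_left (abs_sub _ _) _)
      _ ≤ b t := add_le_add (add_le_add b1 b2) b3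
  have hbi : IntervalIntegrable b volume r s := by
    have h1 : IntervalIntegrable (fun t => B + ((2 * β t + 8 * C) * B + 8 * B)) volume r s :=
      intervalIntegrable_const.add ((((hβ.const_mul 2).add intervalIntegrable_const).mul_const
        B).add intervalIntegrable_const)
    exact intervalIntegrable_const.add (h1.const_mul (Real.sqrt C))
  -- `D k` is measurable since it is a derivative
  have hDm : ∀ k, AEStronglyMeasurable (D k) (volume.restrict (uIoc r s)) := by
    intro k
    refine (measurable_deriv (J k)).aestronglyMeasurable.congr ?_
    rw [EventuallyEq, ae_restrict_iff' measurableSet_uIoc]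
    filter_upwards [hae] with t ht hts using (hJD k t (ht hts)).deriv
  have hDi : ∀ k, IntervalIntegrable (D k) volume r s := fun k =>
    hbi.mono_fun' (hDm k) (by
      rw [EventuallyLE, ae_restrict_iff' measurableSet_uIoc]
      filter_upwards [hae] with t ht hts using hD_bound k t (ht hts))
  have hlim : ∀ᵐ t : ℝ, t ∈ uIoc r s →
      Tendsto (fun k => D k t) atTop (𝓝 (-2 * ∫ x, w t x ∂(μ t))) := by
    filter_upwards [hae] with t ht hts using hD_lim t (ht hts)
  have L1 := intervalIntegral.tendsto_integral_filter_of_dominated_convergence b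
    (Eventually.of_forall hDm) (Eventually.of_forall fun k => by
      filter_upwards [hae] with t ht hts using hD_bound k t (ht hts)) hbi hlim
  have L2 : Tendsto (fun k => ∫ t in r..s, D k t) atTop
      (𝓝 (∫ x, v s x ∂(μ s) - ∫ x, v r x ∂(μ r))) := by
    have e : ∀ k, ∫ t in r..s, D k t = J k s - J k r := fun k =>
      intervalIntegral.integral_eq_sub_of_hasDerivAt_of_le hrs (hJ k) (hJD k) (hDi k)
    simp only [e]
    have hrm := left_mem_Icc.2 hrs
    have hsm := right_mem_Icc.2 hrs
    exact ((hη s hsm).tendsto_integral (hvi s hsm)).sub ((hη r hrm).tendsto_integral (hvi r hrm))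
  refine ⟨?_, tendsto_nhds_unique L2 L1⟩
  have hWm : AEStronglyMeasurable (fun t => -2 * ∫ x, w t x ∂(μ t))
      (volume.restrict (uIoc r s)) :=
    aestronglyMeasurable_of_tendsto_ae atTop hDm
      ((ae_restrict_iff' measurableSet_uIoc).2 hlim)
  have hWi : IntervalIntegrable (fun t => -2 * ∫ x, w t x ∂(μ t)) volume r s :=
    hbi.mono_fun' hWm (by
      rw [EventuallyLE, ae_restrict_iff' measurableSet_uIoc]
      filter_upwards [hae] with t ht hts
      exact le_of_tendsto (hD_lim t (ht hts)).abs
        (Eventually.of_forall fun k => hD_bound k t (ht hts)))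
  have := hWi.const_mul (-(1 / 2))
  refine this.congr fun t _ => ?_
  simp only [hμ]
  ring

end Evolution

section HeatFlow

variable {n : ℕ} {M : Type*} [TopologicalSpace M] [ChartedSpace (Model n) M]

local notation "Φ" => extChartAt (𝓡 n)

/-! ### The heat equation along the flow -/

lemma STS.mono {I J : Set ℝ} {F : ℝ → M → ℝ} (hF : STS n I F) (h : J ⊆ I) : STS n J F := fun c =>
  (hF c).mono (prod_mono h subset_rfl)

variable [IsManifold (𝓡 n) ∞ M]

lemma STS.of_contMDiffOn {J : Set ℝ} {F : ℝ → M → ℝ}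
    (h : ContMDiffOn (𝓘(ℝ, ℝ).prod (𝓡 n)) 𝓘(ℝ, ℝ) ∞ (fun p : ℝ × M => F p.1 p.2) (J ×ˢ univ)) :
    STS n J F := by
  intro c
  have h1 : ContMDiffOn (𝓘(ℝ, ℝ).prod 𝓘(ℝ, Model n)) (𝓘(ℝ, ℝ).prod (𝓡 n)) ∞
      (fun p : ℝ × Model n => (p.1, (Φ c).symm p.2)) (J ×ˢ (Φ c).target) :=
    contMDiffOn_fst.prodMk
      ((contMDiffOn_extChartAt_symm (I := 𝓡 n) (n := ∞) c).comp contMDiffOn_snd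
        fun p hp => hp.2)
  have h2 := h.comp h1 fun p hp => ⟨hp.1, mem_univ _⟩
  rw [← modelWithCornersSelf_prod, chartedSpaceSelf_prod] at h2
  exact contMDiffOn_iff_contDiffOn.1 h2

section Identities

variable {g : Metric n M} {u : M → ℝ} {x : M}

lemma laplacian_sq (hu : SM n u) :
    laplacian g (fun z => u z * u z) x = 2 * u x * laplacian g u x + 2 * inn g u u x := by
  have hux : localRep (n := n) u x (Φ x x) = u x := localRep_chart u (mem_extChartAt_source x)
  have h1 : ∀ j, pd j (localRep (n := n) (fun z => u z * u z) x)
      =ᶠ[𝓝 (Φ x x)] fun z => 2 * (localRep u x z * pd j (localRep u x) z) := fun j =>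
    eventually_of_mem ((isOpen_target x).mem_nhds (mem_tgt x)) fun z hz => by
      have := pd_mul (i := j) (hu.diffAt hz) (hu.diffAt hz)
      rw [show localRep (n := n) (fun z => u z * u z) x
        = fun z => localRep u x z * localRep u x z from rfl, this]
      ring
  have h2 : ∀ i j, hessE (gMat g x) (localRep (n := n) (fun z => u z * u z) x) (Φ x x) i j
      = 2 * u x * hessE (gMat g x) (localRep u x) (Φ x x) i j
        + 2 * (pd i (localRep u x) (Φ x x) * pd j (localRep u x) (Φ x x)) := by
    intro i j
    have d1 := hu.diffAt (mem_tgt (n := n) x)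
    have d2 : DifferentiableAt ℝ (pd j (localRep (n := n) u x)) (Φ x x) :=
      (contDiffOn_pd (isOpen_target x) (hu x)).diffAt (isOpen_target x) (mem_tgt x)
    simp only [hessE]
    rw [pd_congr (h1 j), pd_const_mul 2 (d1.fun_mul d2), pd_mul d1 d2, hux]
    have h3 : ∀ k, pd k (localRep (n := n) (fun z => u z * u z) x) (Φ x x)
        = 2 * (u x * pd k (localRep u x) (Φ x x)) := fun k => by
      rw [(h1 k).self_of_nhds]; simp only [hux]
    simp only [h3]
    have h4 : ∑ k, chr (gMat g x) k i j (Φ x x) * (2 * (u x * pd k (localRep u x) (Φ x x)))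
        = 2 * u x * ∑ k, chr (gMat g x) k i j (Φ x x) * pd k (localRep u x) (Φ x x) := by
      rw [Finset.mul_sum]; exact Finset.sum_congr rfl fun k _ => by ring
    rw [h4]; ring
  rw [laplacian_eq, laplacian_eq]
  simp only [lapE, h2, inn, innE, Finset.mul_sum, ← Finset.sum_add_distrib]
  exact Finset.sum_congr rfl fun i _ => Finset.sum_congr rfl fun j _ => by ring

lemma inn_sq_sq (hg : SmoothMetric g) (hu : SM n u) :
    inn g (fun z => u z * u z) (fun z => u z * u z) x = 4 * (u x * u x) * inn g u u x := by
  rw [inn_mul_right hu hu, inn_comm hg, inn_mul_right hu hu]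
  ring

/-- An upper bound of `Ric + ∇²f` and a lower bound of `Ric` bound `Δf` from above. -/
lemma laplacian_le {f : M → ℝ} {c Λ : ℝ} (hg : SmoothMetric g)
    (hBE : ∀ v : TangentSpace (𝓡 n) x, ricci g x v v + hess g f x v v ≤ c * g.inner x v v)
    (hΛ : ∀ v : TangentSpace (𝓡 n) x, |ricci g x v v| ≤ Λ * g.inner x v v) :
    laplacian g f x ≤ n * (c + Λ) :=
  (hg.isMetricOn x).trace_le (mem_tgt x) (T := hessMat g f x (Φ x x)) fun w =>
    coord_bound (x := x) (T := hessMat g f x (Φ x x)) (fun v => by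
      have h1 := hBE v
      have h2 := neg_le_of_abs_le (hΛ v)
      change hess g f x v v ≤ _
      linarith) w

variable [T2Space M] [SecondCountableTopology M] [MeasurableSpace M] [BorelSpace M]

/-- Bochner's formula on the manifold. -/
lemma laplacian_gradSq (hg : SmoothMetric g) (hu : SM n u) :
    laplacian g (inn g u u) x = 2 * hessSq g u x + 2 * inn g u (laplacian g u) x
      + 2 * ∑ i, ∑ j, ricE (gMat g x) (Φ x x) i j
          * gradV (gMat g x) (localRep u x) i (Φ x x)
          * gradV (gMat g x) (localRep u x) j (Φ x x) := by
  have e1 := localRep_gradSq_eventuallyEq (g := g) (x := x) hu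
  have e4 : ∀ j, pd j (localRep (n := n) (inn g u u) x)
      =ᶠ[𝓝 (Φ x x)] pd j (innE (gMat g x) (localRep u x) (localRep u x)) := fun j =>
    e1.eventually_nhds.mono fun z hz => pd_congr hz
  have e2 : localRep (n := n) (laplacian g u) x =ᶠ[𝓝 (Φ x x)] lapE (gMat g x) (localRep u x) :=
    eventually_of_mem ((isOpen_target x).mem_nhds (mem_tgt x)) fun z hz =>
      localRep_laplacian hg hu hz
  have e3 : laplacian g (inn g u u) x
      = lapE (gMat g x) (innE (gMat g x) (localRep u x) (localRep u x)) (Φ x x) := by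
    rw [laplacian_eq]
    simp only [lapE, hessE, pd_congr e1, pd_congr (e4 _)]
  have e5 : inn g u (laplacian g u) x
      = innE (gMat g x) (localRep u x) (lapE (gMat g x) (localRep u x)) (Φ x x) := by
    rw [inn]; simp only [innE, pd_congr e2]
  rw [e3, (hg.isMetricOn x).bochner (hu x) (mem_tgt x), e5]
  rfl

end Identities

/-- Under the heat equation, `(∂ₜ - Δ) |∇u|² = -2 |∇²u|²`: the Ricci term of Bochner's formula
cancels against the evolution of the metric. -/
lemma IsFlowOn.deriv_gradSq [T2Space M] [SecondCountableTopology M] [MeasurableSpace M]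
    [BorelSpace M] {g : ℝ → Metric n M}
    {I : Set ℝ} {u : ℝ → M → ℝ} {t : ℝ} (hg : IsFlowOn g I) (hu : STS n I u) (ht : t ∈ I)
    (heat : ∀ x, deriv (fun s => u s x) t = laplacian (g t) (u t) x) (x : M) :
    deriv (fun s => inn (g s) (u s) (u s) x) t
      = laplacian (g t) (inn (g t) (u t) (u t)) x - 2 * hessSq (g t) (u t) x := by
  rw [(hg.hasDerivAt_inn hu ht x).deriv, laplacian_gradSq (hg.smoothMetric ht) (hu.sm ht),
    funext heat]
  ring

/-- The Hessian of a solution of the heat equation has a continuous norm: by the preceding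
formula, it is a combination of smooth functions. -/
lemma IsFlowOn.continuous_hessSq [T2Space M] [SecondCountableTopology M] [MeasurableSpace M]
    [BorelSpace M] {g : ℝ → Metric n M}
    {I : Set ℝ} {u : ℝ → M → ℝ} {t : ℝ} (hg : IsFlowOn g I) (hu : STS n I u) (ht : t ∈ I)
    (heat : ∀ x, deriv (fun s => u s x) t = laplacian (g t) (u t) x) :
    Continuous fun x => hessSq (g t) (u t) x := by
  have h1 : (fun x => hessSq (g t) (u t) x) = fun x =>
      1 / 2 * (laplacian (g t) (inn (g t) (u t) (u t)) x
        - deriv (fun s => inn (g s) (u s) (u s) x) t) := by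
    funext x
    rw [hg.deriv_gradSq hu ht heat]
    ring
  have hgt := hg.smoothMetric ht
  rw [h1]
  exact continuous_const.mul ((SM.laplacian hgt (SM.inn hgt (hu.sm ht) (hu.sm ht))).sub
    (((hg.sts_inn hu).deriv hg.isOpen).sm ht)).continuous

variable [MeasurableSpace M]

lemma IsConjugateHeatKernel.isConjugateFlow {g : ℝ → Metric n M} {f : ℝ → M → ℝ}
    {t₀ t₁ a b : ℝ} {x₁ : M} (hK : IsConjugateHeatKernel g f t₀ t₁ x₁)
    (hg : IsRicciFlow g t₀ t₁) (h₀ : t₀ ≤ a) (h₁ : b ≤ t₁) :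
    IsConjugateFlow g f (fun t => (4 * Real.pi * (t₁ - t)) ^ (-(n : ℝ) / 2)) (Ioo a b) := by
  have hsub : Ioo a b ⊆ Ico t₀ t₁ := fun s hs => ⟨h₀.trans hs.1.le, hs.2.trans_le h₁⟩
  have hpos : ∀ t ∈ Ioo a b, 0 < 4 * Real.pi * (t₁ - t) := fun t ht =>
    mul_pos (by positivity) (sub_pos.2 (hsub ht).2)
  refine ⟨hg.isFlowOn h₀ h₁, (STS.of_contMDiffOn hK.smooth).mono hsub, ?_,
    fun t ht => Real.rpow_nonneg (hpos t ht).le _, fun t ht x => ?_⟩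
  · exact ContDiffOn.rpow_const_of_ne (by fun_prop) fun t ht => (hpos t ht).ne'
  · exact (hK.conjugate_heat t (hsub ht) x).hasDerivAt
      (mem_of_superset (isOpen_Ioo.mem_nhds ht) hsub)

variable [BorelSpace M]

/-- A continuous function that is dominated by the integrand of the Sobolev norm. -/
lemma integrable_of_sobolevSq {g : Metric n M} {ν : Measure M} {u q : M → ℝ} {C : ℝ≥0}
    (h : sobolevSq g ν u ≤ C) (hq : Continuous q) (h0 : ∀ x, 0 ≤ q x)
    (hle : ∀ x, q x ≤ u x ^ 2 + gradSq g u x + hessSq g u x) :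
    Integrable q ν ∧ ∫ x, q x ∂ν ≤ C := by
  have h1 : ∫⁻ x, ENNReal.ofReal (q x) ∂ν ≤ C :=
    (lintegral_mono fun x => ENNReal.ofReal_le_ofReal (hle x)).trans h
  have hint : Integrable q ν :=
    ⟨hq.measurable.aestronglyMeasurable, by
      rw [hasFiniteIntegral_iff_ofReal (Eventually.of_forall h0)]
      exact h1.trans_lt ENNReal.coe_lt_top⟩
  refine ⟨hint, ?_⟩
  rw [← ofReal_integral_eq_lintegral_ofReal hint (Eventually.of_forall h0)] at h1
  exact (ENNReal.ofReal_le_iff_le_toReal ENNReal.coe_ne_top).1 h1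

variable [SecondCountableTopology M] in
/-- A continuous function vanishes if the weighted integral of its square does. -/
lemma eq_zero_of_integral_sq {g : Metric n M} {f q : M → ℝ} {A : ℝ} (hg : SmoothMetric g)
    (hf : Continuous f) (hA : 0 < A) (hq : Continuous q)
    (hi : Integrable (fun x => q x * q x) (wvol g f A))
    (h : ∫ x, q x * q x ∂(wvol g f A) = 0) : q = 0 := by
  have := isOpenPos_vol hg
  rw [integral_eq_zero_iff_of_nonneg (fun x => mul_self_nonneg _) hi] at h
  have hac : vol g ≪ wvol g f A := withDensity_absolutelyContinuous'
    (by fun_prop) (Eventually.of_forall fun x => by simp [hA, Real.exp_pos])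
  have h2 : q =ᵐ[vol g] 0 := (hac.ae_eq h).mono fun x hx => mul_self_eq_zero.1 hx
  exact (Continuous.ae_eq_iff_eq (vol g) hq continuous_const).1 h2

end HeatFlow
end
end RicciHeat

theorem corollary2 (n : ℕ) {M : Type*} [TopologicalSpace M] [T2Space M]
    [SecondCountableTopology M] [ConnectedSpace M] [MeasurableSpace M] [BorelSpace M]
    [ChartedSpace (Model n) M] [IsManifold (𝓡 n) ∞ M]
    (t₀ t₁ : ℝ) (g : ℝ → Metric n M) (hg : IsRicciFlow g t₀ t₁)
    (f : ℝ → M → ℝ) (x₁ : M) (hK : IsConjugateHeatKernel g f t₀ t₁ x₁)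
    (a b : ℝ) (ht₀a : t₀ ≤ a) (hab : a < b) (hbt₁ : b < t₁)
    -- the Ricci curvature is bounded on `M × [a, b]`
    (hRic : ∃ Λ : ℝ, ∀ t ∈ Icc a b, ∀ (x : M) (v : TangentSpace (𝓡 n) x),
      |ricci (g t) x v v| ≤ Λ * (g t).inner x v v)
    -- the Bakry-Émery bound `Ric + ∇²f ≤ κ / (2τ) g`
    (κ : ℝ → ℝ) (hκ : IntervalIntegrable κ volume a b)
    (hBE : ∀ t ∈ Icc a b, ∀ (x : M) (v : TangentSpace (𝓡 n) x),
      ricci (g t) x v v + hess (g t) (f t) x v v ≤ κ t / (2 * (t₁ - t)) * (g t).inner x v v)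
    (u : ℝ → M → ℝ) (hu : IsHeatSolution g u a b)
    -- `u` and `∂ₜu` are in `W^{2,2}(dν)`, with bounded norm, for `t ∈ [a, b]`
    (hW : ∃ C : ℝ≥0, ∀ t ∈ Icc a b,
      sobolevSq (g t) (nu g f t₁ t) (u t) ≤ C ∧
      sobolevSq (g t) (nu g f t₁ t) (fun x => derivWithin (fun s => u s x) (Icc a b) t) ≤ C)
    (hub : ∀ x : M, u b x = 0) :
    ∀ t ∈ Icc a b, ∀ x : M, u t x = 0 := by
  have hsub : Icc a b ⊆ Ico t₀ t₁ := fun t ht => ⟨ht₀a.trans ht.1, ht.2.trans_lt hbt₁⟩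
  have hsm : ∀ t ∈ Icc a b, SmoothMetric (g t) := fun t ht => hg.smoothMetric (hsub ht)
  have hf : STS n (Icc a b) f := (STS.of_contMDiffOn hK.smooth).mono hsub
  have hus : STS n (Icc a b) u := STS.of_contMDiffOn hu.smooth
  obtain ⟨Λ, hΛ⟩ := hRic
  obtain ⟨B, hB⟩ := hW
  obtain ⟨η, C, hη⟩ := hg.exists_isCutoff ht₀a hab.le hbt₁ fun t ht x v =>
    (le_abs_self _).trans (hΛ t ht x v)
  have hC : 0 ≤ C := (hη a (left_mem_Icc.2 hab.le)).C_nonneg (hsm a (left_mem_Icc.2 hab.le)) x₁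
  set A : ℝ → ℝ := fun t => (4 * Real.pi * (t₁ - t)) ^ (-(n : ℝ) / 2) with hA
  have hApos : ∀ t ∈ Icc a b, 0 < A t := fun t ht =>
    Real.rpow_pos_of_pos (mul_pos (by positivity) (sub_pos.2 (hsub ht).2)) _
  set μ : ℝ → Measure M := fun t => wvol (g t) (f t) (A t) with hμ
  have hcf : ∀ {r s : ℝ}, a ≤ r → s ≤ b → IsConjugateFlow g f A (Ioo r s) := fun hr hs =>
    hK.isConjugateFlow hg (ht₀a.trans hr) (hs.trans hbt₁.le)
  have hheat : ∀ t ∈ Ioo a b, ∀ x, deriv (fun s => u s x) t = laplacian (g t) (u t) x :=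
    fun t ht x => ((hu.heat t (Ioo_subset_Icc_self ht) x).hasDerivAt
      (mem_of_superset (isOpen_Ioo.mem_nhds ht) Ioo_subset_Icc_self)).deriv
  -- the upper bound of `Δf`
  have hlam : IntervalIntegrable (fun t => κ t / (2 * (t₁ - t))) volume a b := by
    have hc : ContinuousOn (fun t => (2 * (t₁ - t))⁻¹) (uIcc a b) := by
      rw [uIcc_of_le hab.le]
      exact ContinuousOn.inv₀ (by fun_prop) fun t ht =>
        (mul_pos two_pos (sub_pos.2 (hsub ht).2)).ne'
    simpa only [div_eq_mul_inv] using hκ.mul_continuousOn hc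
  set β : ℝ → ℝ := fun t => n * (|κ t / (2 * (t₁ - t))| + |Λ|) with hβ
  have hβi : IntervalIntegrable β volume a b :=
    (hlam.abs.add intervalIntegrable_const).const_mul n
  have hβ0 : ∀ t, 0 ≤ β t := fun t => by positivity
  have hΔ : ∀ t ∈ Icc a b, ∀ x, laplacian (g t) (f t) x ≤ β t := fun t ht x =>
    (laplacian_le (hsm t ht) (hBE t ht x) (hΛ t ht x)).trans
      (mul_le_mul_of_nonneg_left (add_le_add (le_abs_self _) (le_abs_self _)) (Nat.cast_nonneg n))
  -- the integrals of `u²`, `|∇u|²` and `|∇²u|²`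
  have hu0 : ∀ t, ∀ x, 0 ≤ u t x * u t x := fun t x => mul_self_nonneg _
  have hP0 : ∀ t ∈ Icc a b, ∀ x, 0 ≤ inn (g t) (u t) (u t) x := fun t ht x =>
    inn_self_nonneg (hsm t ht)
  have hh0 : ∀ t ∈ Icc a b, ∀ x, 0 ≤ hessSq (g t) (u t) x := fun t ht x =>
    hessSq_nonneg (hsm t ht) (hus.sm ht)
  have hhc : ∀ t ∈ Ioo a b, Continuous fun x => hessSq (g t) (u t) x := fun t ht =>
    (hcf le_rfl le_rfl).flow.continuous_hessSq (hus.mono Ioo_subset_Icc_self) ht (hheat t ht)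
  have hbI : ∀ t ∈ Icc a b, Integrable (fun x => u t x * u t x) (μ t) ∧
      ∫ x, u t x * u t x ∂(μ t) ≤ B := fun t ht =>
    integrable_of_sobolevSq (hB t ht).1 ((hus.sm ht).mul (hus.sm ht)).continuous (hu0 t) fun x => by
      have h1 := hP0 t ht x
      have h2 := hh0 t ht x
      rw [gradSq_eq]; nlinarith
  have hbE : ∀ t ∈ Icc a b, Integrable (inn (g t) (u t) (u t)) (μ t) ∧
      ∫ x, inn (g t) (u t) (u t) x ∂(μ t) ≤ B := fun t ht =>
    integrable_of_sobolevSq (hB t ht).1 (SM.inn (hsm t ht) (hus.sm ht) (hus.sm ht)).continuous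
      (hP0 t ht) fun x => by
      have h2 := hh0 t ht x
      rw [gradSq_eq]; nlinarith [sq_nonneg (u t x)]
  have hbH : ∀ t ∈ Ioo a b, Integrable (fun x => hessSq (g t) (u t) x) (μ t) ∧
      ∫ x, hessSq (g t) (u t) x ∂(μ t) ≤ B := fun t ht => by
    have ht' := Ioo_subset_Icc_self ht
    refine integrable_of_sobolevSq (hB t ht').1 (hhc t ht) (hh0 t ht') fun x => ?_
    have h2 := hP0 t ht' x
    rw [gradSq_eq]; nlinarith [sq_nonneg (u t x)]
  -- the evolution of `∫ u²`
  have evoI : ∀ {r s : ℝ}, a < r → r ≤ s → s ≤ b →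
      IntervalIntegrable (fun t => ∫ x, inn (g t) (u t) (u t) x ∂(μ t)) volume r s ∧
        ∫ x, u s x * u s x ∂(μ s) - ∫ x, u r x * u r x ∂(μ r)
          = ∫ t in r..s, -2 * ∫ x, inn (g t) (u t) (u t) x ∂(μ t) := by
    intro r s har hrs hsb
    have hI1 : Icc r s ⊆ Icc a b := Icc_subset_Icc har.le hsb
    have hI2 : Ioo r s ⊆ Ioo a b := Ioo_subset_Ioo har.le hsb
    have hI3 : Ioo r s ⊆ Icc a b := hI2.trans Ioo_subset_Icc_self
    have huo : STS n (Ioo r s) u := hus.mono hI3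
    refine (hcf har.le hsb).integral_evolution (v := fun t x => u t x * u t x)
      (w := fun t => inn (g t) (u t) (u t)) (B := B) (β := β) hrs (fun t ht => hη t (hI1 ht)) hC
      (huo.mul huo) (fun t _ => hu0 t) (fun t ht => hP0 t (hI3 ht)) (fun t ht x => ?_)
      (fun t ht x => ?_) (fun t ht => (hbI t (hI1 ht)).1) (fun t ht => (hbE t (hI3 ht)).1)
      (fun t ht => (hbI t (hI3 ht)).2) (fun t ht => (hbE t (hI3 ht)).2)
      (hβi.mono_set (by rwa [uIcc_of_le hrs, uIcc_of_le hab.le])) (fun t _ => hβ0 t)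
      (fun t ht => hΔ t (hI3 ht)) fun k => ?_
    · exact (inn_sq_sq (hsm t (hI3 ht)) (hus.sm (hI3 ht))).le
    · have d := huo.hasDerivAt isOpen_Ioo ht x
      rw [(d.fun_mul d).deriv, hheat t (hI2 ht), laplacian_sq (hus.sm (hI3 ht))]
      ring
    · have hr' := hη r (hI1 (left_mem_Icc.2 hrs))
      have hAc : ContinuousOn A (Icc a b) := ContinuousOn.rpow_const (by fun_prop) fun t ht =>
        Or.inl (mul_pos (by positivity) (sub_pos.2 (hsub ht).2)).ne'
      have h1 := continuousOn_integral_vol (g := g)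
        (F := fun t x => A t * Real.exp (-f t x) * (u t x * u t x)) (J := Icc r s) isCompact_Icc
        (fun t ht => hsm t (hI1 ht))
        (fun c i j => (hg.smooth c i j).continuousOn.mono
          (prod_mono (hI1.trans hsub) subset_rfl))
        (fun c => (((hAc.comp continuousOn_fst fun p hp => hp.1).mul
          (hf c).continuousOn.neg.rexp).mul ((hus.mul hus) c).continuousOn).mono
            (prod_mono hI1 subset_rfl))
        (fun t ht => ((hf.sm (hI1 ht)).exp_neg (A t)).continuous.mul
          ((hus.mul hus).sm (hI1 ht)).continuous) (hr'.smooth k) (hr'.compact k)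
      refine h1.congr fun t ht => ?_
      rw [integral_wvol (hf.sm (hI1 ht)).continuous (hApos t (hI1 ht)).le]
      congr 1; funext x; ring
  -- the evolution of `∫ |∇u|²`
  have evoE : ∀ {r s : ℝ}, a < r → r ≤ s → s < b →
      IntervalIntegrable (fun t => ∫ x, hessSq (g t) (u t) x ∂(μ t)) volume r s ∧
        ∫ x, inn (g s) (u s) (u s) x ∂(μ s) - ∫ x, inn (g r) (u r) (u r) x ∂(μ r)
          = ∫ t in r..s, -2 * ∫ x, hessSq (g t) (u t) x ∂(μ t) := by
    intro r s har hrs hsb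
    have hI0 : Icc r s ⊆ Ioo a b := fun t ht => ⟨har.trans_le ht.1, ht.2.trans_lt hsb⟩
    have hI1 : Icc r s ⊆ Icc a b := hI0.trans Ioo_subset_Icc_self
    have hI2 : Ioo r s ⊆ Ioo a b := Ioo_subset_Icc_self.trans hI0
    have hI3 : Ioo r s ⊆ Icc a b := hI2.trans Ioo_subset_Icc_self
    have hab' := hcf (le_refl a) (le_refl b)
    have hP : STS n (Ioo a b) fun t => inn (g t) (u t) (u t) :=
      hab'.flow.sts_inn (hus.mono Ioo_subset_Icc_self)
    refine (hcf har.le hsb.le).integral_evolution (v := fun t => inn (g t) (u t) (u t))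
      (w := fun t x => hessSq (g t) (u t) x) (B := B) (β := β) hrs (fun t ht => hη t (hI1 ht)) hC
      (hP.mono hI2) (fun t ht => hP0 t (hI3 ht)) (fun t ht => hh0 t (hI3 ht)) (fun t ht x => ?_)
      (fun t ht x => ?_) (fun t ht => (hbE t (hI1 ht)).1) (fun t ht => (hbH t (hI2 ht)).1)
      (fun t ht => (hbE t (hI3 ht)).2) (fun t ht => (hbH t (hI2 ht)).2)
      (hβi.mono_set (by rwa [uIcc_of_le hrs, uIcc_of_le hab.le])) (fun t _ => hβ0 t)
      (fun t ht => hΔ t (hI3 ht)) fun k t ht => ?_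
    · exact inn_gradSq_le (hsm t (hI3 ht)) (hus.sm (hI3 ht))
    · exact hab'.flow.deriv_gradSq (hus.mono Ioo_subset_Icc_self) (hI2 ht) (hheat t (hI2 ht)) x
    · have ht' := hη t (hI1 ht)
      exact (hab'.hasDerivAt_integral hP (ht'.smooth k) (ht'.compact k)
        (hI0 ht)).continuousAt.continuousWithinAt
  -- Bochner's formula and the Cauchy–Schwarz inequality, at a fixed time
  have hQ : ∀ t, ∃ Q : ℝ, t ∈ Ioo a b →
      Q ≤ ∫ x, hessSq (g t) (u t) x ∂(μ t)
          + κ t / (2 * (t₁ - t)) * ∫ x, inn (g t) (u t) (u t) x ∂(μ t) ∧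
        (∫ x, inn (g t) (u t) (u t) x ∂(μ t)) ^ 2 ≤ (∫ x, u t x * u t x ∂(μ t)) * Q := by
    intro t
    by_cases ht : t ∈ Ioo a b
    · have ht' := Ioo_subset_Icc_self ht
      have h1 := hbI t ht'
      simp only [← sq] at h1 ⊢
      obtain ⟨Q, hQ⟩ := weighted_bochner (hsm t ht') (hf.sm ht') (hApos t ht').le (hη t ht') hC
        (hus.sm ht') (hhc t ht) h1.1 (hbE t ht').1 (hbH t ht).1 (hβ0 t) (hΔ t ht') (hBE t ht')
      exact ⟨Q, fun _ => hQ⟩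
    · exact ⟨0, fun h => absurd h ht⟩
  choose Q hQ using hQ
  have hint : ∀ t ∈ Ioo a b, ∀ x, u t x = 0 := by
    intro r hr
    have hr' := Ioo_subset_Icc_self hr
    have hin : ∀ t ∈ Ico r b, t ∈ Ioo a b := fun t ht => ⟨hr.1.trans_le ht.1, ht.2⟩
    have h0 := energy_eq_zero (I := fun t => ∫ x, u t x * u t x ∂(μ t))
      (E := fun t => ∫ x, inn (g t) (u t) (u t) x ∂(μ t))
      (H := fun t => ∫ x, hessSq (g t) (u t) x ∂(μ t)) (Q := Q) hr.2.le
      (evoI hr.1 hr.2.le le_rfl).1 (fun t ht => (evoI hr.1 ht.1 ht.2).2)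
      (fun t ht => (evoE hr.1 ht.1 ht.2).1) (fun t ht => (evoE hr.1 ht.1 ht.2).2)
      (hlam.mono_set (by
        rw [uIcc_of_le hr.2.le, uIcc_of_le hab.le]; exact Icc_subset_Icc_left hr.1.le))
      (fun t ht => integral_nonneg (hP0 t (Ioo_subset_Icc_self (hin t ht))))
      (fun t _ => integral_nonneg (hu0 t)) (fun t ht => hQ t (hin t ht)) (by simp [hub])
    have h1 := eq_zero_of_integral_sq (hsm r hr') (hf.sm hr').continuous (hApos r hr')
      (hus.sm hr').continuous (hbI r hr').1 h0
    exact fun x => congrFun h1 x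
  -- the solution is continuous up to the initial time
  intro t ht x
  rcases eq_or_lt_of_le ht.1 with rfl | hat
  · have hc : ContinuousWithinAt (fun s => u s x) (Ioo a b) a :=
      (hu.heat a ht x).continuousWithinAt.mono Ioo_subset_Icc_self
    have := mem_closure_iff_nhdsWithin_neBot.1
      (by rw [closure_Ioo hab.ne]; exact ht : a ∈ closure (Ioo a b))
    refine tendsto_nhds_unique hc (tendsto_const_nhds.congr' ?_)
    filter_upwards [self_mem_nhdsWithin] with s hs using (hint s hs x).symm
  · rcases eq_or_lt_of_le ht.2 with rfl | htb
    · exact hub x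
    · exact hint t ⟨hat, htb⟩ x
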